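/- Let $(M,\mathcal T)$ be a connected closed triangulated surface, i.e. the connected quotient of a finite disjoint union of triangles by identifying all edges of the triangles in pairs by homeomorphisms, with sets $V,E,F$ of vertices, edges and triangles, $N=|V|$ and Euler characteristic $\chi(M)=|V|-|E|+|F|$. Let $\varepsilon:V\to\{0,1\}$ and $\eta:E\to\mathbb R$ be weights satisfying the structure conditions $$\varepsilon_s\varepsilon_t+\eta_{st}>0\quad\text{for every edge } \{st\}\in E,\qquad \varepsilon_q\eta_{st}+\eta_{qs}\eta_{qt}\ge 0\quad\text{for } \{q,s,t\}=\{i,j,k\},\ \{ijk\}\in F .$$ For $f:V\to\mathbb R$ define edge lengths by $l_{ij}=\sqrt{\varepsilon_ie^{2f_i}+\varepsilon_je^{2f_j}+2\eta_{ij}e^{f_i+f_j}}$ in the Euclidean case and $l_{ij}=\cosh^{-1}\big(\sqrt{(1+\varepsilon_ie^{2f_i})(1+\varepsilon_je^{2f_j})}+\eta_{ij}e^{f_i+f_j}\big)$ in the hyperbolic case. Call $f$ a (nondegenerate) discrete conformal structure if all lengths are positive and the three strict triangle inequalities hold in every triangle; its curvature is $K_i=2\pi-\sum\theta_i$, the sum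 being over the inner angles at $i$ of the Euclidean, resp. hyperbolic, triangles with these side lengths. For arbitrary $f\in\mathbb R^V$ the angles are extended by constants: in a triangle that violates the strict triangle inequalities, the angle opposite to the side which is at least as long as the other two together is $\pi$ and the other two angles are $0$. Let $\widetilde K_i=2\pi-\sum\widetilde\theta_i$ be the resulting extended curvature. Set $u_i=f_i$ in the Euclidean case, and in the hyperbolic case $u_i=f_i$ if $\varepsilon_i=0$ and $u_i=\frac12\ln\frac{\sqrt{1+e^{2f_i}}-1}{\sqrt{1+e^{2f_i}}+1}$ if $\varepsilon_i=1$. For $\overline K:V\to\mathbb R$, the combinatorial Ricci flow is $\frac{du_i}{dt}=\overline K_i-K_i$ (through nondegenerate discrete conformal structures), and the extended flow is $\frac{du_i}{dt}=\overline K_i-\widetilde K_i$ (through arbitrary $f\in\mathbb R^V$). With $\overline K\equiv K_{av}=2\pi\chi(M)/N$ this is the normalized flow in the Euclidean case, and with $\overline K\equiv0$ it is the unnormalized flow. In both geometries the extended angles are continuous functions of $f\in\mathbb R^V$, and: (a) Let $\overline K:V\to\mathbb R$, with $\overline K_i<2\pi$ for all $i$ in the hyperbolic case. For every initial value $f_0\in\mathbb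 R^V$ the extended flow has a solution $f(t)$ on $[0,\infty)$ with $f(0)=f_0$. If $f_0$ is a nondegenerate discrete conformal structure, then $f$ solves the non-extended flow on $[0,\tau)$ for some $\tau>0$. Every solution of the non-extended flow on an interval $[0,\tau)$, $\tau\in(0,\infty]$, starting at $f_0$ is the restriction of $f$ to $[0,\tau)$. (b) For every $\overline K:V\to\mathbb R$, two solutions of the extended flow on $[0,\tau)$, $\tau\in(0,\infty]$, with the same initial value coincide. (c) Let $\overline f$ be a nondegenerate discrete conformal structure with curvature $\overline K$ and let $\overline u$ be its $u$-coordinates. Let $u(t)$, $t\in[0,\infty)$, be any solution of the extended flow with this $\overline K$, from any initial value in $\mathbb R^V$. Then, exponentially fast as $t\to\infty$ (that is, with $\max_i|u_i(t)-u_i^\infty|\le Ce^{-rt}$ for some $C$ and some $r>0$), $u(t)$ converges to $u^\infty=\overline u$ in the hyperbolic case, and to $u^\infty=\overline u+c(1,\dots,1)$ with $c=\frac1N\sum_i(u_i(0)-\overline u_i)$ in the Euclidean case (so to $\overline u$ if $\sum_iu_i(0)=\sum_i\overline u_i$). In particular, if there is a Euclidean discrete conformal structure with constant curvature, then every solution on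 $[0,\infty)$ of the extended normalized Euclidean flow converges exponentially fast to a Euclidean discrete conformal structure with curvature $K_{av}$; if there is a hyperbolic discrete conformal structure with zero curvature, then every solution on $[0,\infty)$ of the extended hyperbolic flow with $\overline K=0$ converges exponentially fast to a hyperbolic discrete conformal structure with zero curvature. -/

import Mathlib

open Real

noncomputable section

namespace DiscreteConformal

/-- A closed triangulated surface, presented as a disjoint union of triangles (indexed by `F`) whose
edges are identified in pairs by homeomorphisms.  The corners of each triangle are labelled by
`Fin 3`, and the side `(t, a)` of the triangle `t` is the one opposite to its corner `(t, a)`; it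
joins the corners `(t, a + 1)` and `(t, a + 2)`.  Up to isotopy the identification of two sides is
determined by the way it matches their end points, which is recorded by `reversed`.  Loops and
multiple edges are allowed, and the surface need not be orientable. -/
structure TriangleGluing (F : Type*) where
  /-- the side to which a side is glued -/
  mate : F × Fin 3 → F × Fin 3
  mate_mate : ∀ s, mate (mate s) = s
  mate_ne : ∀ s, mate s ≠ s
  /-- whether the first end point of `s` is glued to the second one of `mate s` -/
  reversed : F × Fin 3 → Bool
  reversed_mate : ∀ s, reversed (mate s) = reversed s

/-- First end point of a side. -/
def fstCorner {F : Type*} (s : F × Fin 3) : F × Fin 3 := (s.1, s.2 + 1)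

/-- Second end point of a side. -/
def sndCorner {F : Type*} (s : F × Fin 3) : F × Fin 3 := (s.1, s.2 + 2)

namespace TriangleGluing

variable {F : Type*} (T : TriangleGluing F)

/-- Two corners that are identified directly by the gluing of one pair of sides. -/
inductive CornerGlued : F × Fin 3 → F × Fin 3 → Prop
  | fst (s : F × Fin 3) : CornerGlued (fstCorner s)
      (if T.reversed s then sndCorner (T.mate s) else fstCorner (T.mate s))
  | snd (s : F × Fin 3) : CornerGlued (sndCorner s)
      (if T.reversed s then fstCorner (T.mate s) else sndCorner (T.mate s))

/-- The vertices: corners modulo the equivalence relation generated by the gluing. -/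
def Vertex : Type _ := Quot T.CornerGlued

/-- The edges: sides modulo the gluing. -/
def Edge : Type _ := Quot fun s s' : F × Fin 3 => s' = T.mate s

/-- The vertex of the surface at a corner of a triangle. -/
def vertex (c : F × Fin 3) : T.Vertex := Quot.mk _ c

/-- The edge of the surface given by a side of a triangle. -/
def edge (s : F × Fin 3) : T.Edge := Quot.mk _ s

instance [Finite F] : Finite T.Vertex := inferInstanceAs (Finite (Quot _))

instance [Finite F] : Finite T.Edge := inferInstanceAs (Finite (Quot _))

instance [Finite F] : Fintype T.Vertex := Fintype.ofFinite _

instance [Finite F] : Fintype T.Edge := Fintype.ofFinite _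

/-- The surface is (nonempty and) connected: any two triangles are joined by a chain of triangles
that are consecutively glued along sides. -/
def IsConnected : Prop :=
  (SimpleGraph.fromRel fun t t' : F => ∃ a b, T.mate (t, a) = (t', b)).Connected

/-- The Euler characteristic of the surface. -/
def eulerChar [Fintype F] : ℤ :=
  (Fintype.card T.Vertex : ℤ) - Fintype.card T.Edge + Fintype.card F

end TriangleGluing

/-- The background geometries: the Euclidean and the hyperbolic plane. -/
inductive Geometry
  | euclidean
  | hyperbolic

/-- The length of an edge with weight `η` whose end points have scheme coefficients `εi`, `εj` and
conformal factors `fi`, `fj`. -/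
def edgeLength : Geometry → (εi εj η fi fj : ℝ) → ℝ
  | .euclidean, εi, εj, η, fi, fj =>
      √(εi * exp (2 * fi) + εj * exp (2 * fj) + 2 * η * exp (fi + fj))
  | .hyperbolic, εi, εj, η, fi, fj =>
      arcosh (√((1 + εi * exp (2 * fi)) * (1 + εj * exp (2 * fj))) + η * exp (fi + fj))

/-- The lengths `a`, `b`, `c` are those of a nondegenerate triangle. -/
def IsTriangle (a b c : ℝ) : Prop :=
  (0 < a ∧ 0 < b ∧ 0 < c) ∧ a < b + c ∧ b < a + c ∧ c < a + b

/-- The inner angle opposite to the side `a` in a nondegenerate triangle with sides `a`, `b`, `c`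
(law of cosines). -/
def triangleAngle : Geometry → (a b c : ℝ) → ℝ
  | .euclidean, a, b, c => arccos ((b ^ 2 + c ^ 2 - a ^ 2) / (2 * b * c))
  | .hyperbolic, a, b, c => arccos ((cosh b * cosh c - cosh a) / (sinh b * sinh c))

open Classical in
/-- The inner angle opposite to `a`, extended by constants to degenerate triples of lengths: the
angle opposite to a side that is at least as long as the other two together is `π`, and the other
two angles are `0`. -/
def extTriangleAngle (g : Geometry) (a b c : ℝ) : ℝ :=
  if IsTriangle a b c then triangleAngle g a b c else if b + c ≤ a then π else 0

/-- The coordinate `u` of a vertex with scheme coefficient `ε` and conformal factor `f`. -/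
def uCoord : Geometry → (ε f : ℝ) → ℝ
  | .euclidean, _, f => f
  | .hyperbolic, ε, f =>
      if ε = 0 then f
      else 1 / 2 * log |(√(1 + ε * exp (2 * f)) - 1) / (√(1 + ε * exp (2 * f)) + 1)|

/-- The time interval `[0, τ)`, where `τ = ⊤` is allowed. -/
def timeInterval (τ : EReal) : Set ℝ := {t | 0 ≤ t ∧ (t : EReal) < τ}

/-- `x t` converges exponentially fast to `y` as `t` tends to infinity. -/
def ConvergesExp {V : Type*} (x : ℝ → V → ℝ) (y : V → ℝ) : Prop :=
  ∃ C r : ℝ, 0 < r ∧ ∀ t, 0 ≤ t → ∀ v, |x t v - y v| ≤ C * exp (-r * t)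

namespace TriangleGluing

variable {F : Type*} (T : TriangleGluing F) (g : Geometry) (ε : T.Vertex → ℝ) (η : T.Edge → ℝ)

/-- The first structure condition: `ε_s ε_t + η_st > 0` for every edge `st`. -/
def StructureCondition1 : Prop :=
  ∀ s, 0 < ε (T.vertex (fstCorner s)) * ε (T.vertex (sndCorner s)) + η (T.edge s)

/-- The second structure condition: `ε_q η_st + η_qs η_qt ≥ 0` for every corner `q` of every
triangle `qst`. -/
def StructureCondition2 : Prop :=
  ∀ (t : F) (a : Fin 3), 0 ≤ ε (T.vertex (t, a)) * η (T.edge (t, a)) +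
    η (T.edge (t, a + 1)) * η (T.edge (t, a + 2))

/-- The length of a side; it depends only on the edge that the side represents. -/
def sideLength (f : T.Vertex → ℝ) (s : F × Fin 3) : ℝ :=
  edgeLength g (ε (T.vertex (fstCorner s))) (ε (T.vertex (sndCorner s))) (η (T.edge s))
    (f (T.vertex (fstCorner s))) (f (T.vertex (sndCorner s)))

theorem sideLength_mate (f : T.Vertex → ℝ) (s : F × Fin 3) :
    T.sideLength g ε η f (T.mate s) = T.sideLength g ε η f s := by
  have he : T.edge (T.mate s) = T.edge s :=
    (Quot.sound (r := fun s s' : F × Fin 3 => s' = T.mate s) rfl).symm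
  have h1 : T.vertex (fstCorner s) = _ := Quot.sound (CornerGlued.fst s)
  have h2 : T.vertex (sndCorner s) = _ := Quot.sound (CornerGlued.snd s)
  have hsymm : ∀ x y e a b : ℝ, edgeLength g x y e a b = edgeLength g y x e b a := by
    intro x y e a b
    cases g
    · simp only [edgeLength, add_comm a b, add_comm (x * exp (2 * a))]
    · simp only [edgeLength, add_comm a b, mul_comm (1 + x * exp (2 * a))]
  unfold sideLength
  rw [he]
  cases hr : T.reversed s
  · simp only [hr, Bool.false_eq_true, if_false] at h1 h2
    rw [h1, h2]
    rfl
  · simp only [hr, if_true] at h1 h2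
    rw [h1, h2, hsymm]
    rfl

/-- `f` is a (nondegenerate) discrete conformal structure: the edge lengths are positive and satisfy
the strict triangle inequalities in every triangle. -/
def IsConformalStructure (f : T.Vertex → ℝ) : Prop :=
  ∀ t : F, IsTriangle (T.sideLength g ε η f (t, 0)) (T.sideLength g ε η f (t, 1))
    (T.sideLength g ε η f (t, 2))

/-- The inner angle at the corner `c`. -/
def angle (f : T.Vertex → ℝ) (c : F × Fin 3) : ℝ :=
  triangleAngle g (T.sideLength g ε η f c) (T.sideLength g ε η f (c.1, c.2 + 1))
    (T.sideLength g ε η f (c.1, c.2 + 2))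

/-- The extended inner angle at the corner `c`. -/
def extAngle (f : T.Vertex → ℝ) (c : F × Fin 3) : ℝ :=
  extTriangleAngle g (T.sideLength g ε η f c) (T.sideLength g ε η f (c.1, c.2 + 1))
    (T.sideLength g ε η f (c.1, c.2 + 2))

open Classical in
/-- The combinatorial curvature: `2π` minus the sum of the inner angles at the vertex. -/
def curvature [Fintype F] (f : T.Vertex → ℝ) (v : T.Vertex) : ℝ :=
  2 * π - ∑ c : F × Fin 3, if T.vertex c = v then T.angle g ε η f c else 0

open Classical in
/-- The extended combinatorial curvature, defined for every `f`. -/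
def extCurvature [Fintype F] (f : T.Vertex → ℝ) (v : T.Vertex) : ℝ :=
  2 * π - ∑ c : F × Fin 3, if T.vertex c = v then T.extAngle g ε η f c else 0

/-- The average curvature in the Euclidean background geometry. -/
def averageCurvature [Fintype F] : ℝ :=
  2 * π * T.eulerChar / Fintype.card T.Vertex

/-- The discrete conformal structure in the coordinates `u`. -/
def uVec (f : T.Vertex → ℝ) (v : T.Vertex) : ℝ := uCoord g (ε v) (f v)

/-- `f` solves on `[0, τ)` the combinatorial Ricci flow `du/dt = Kbar - K` with prescribed curvature
`Kbar`, through nondegenerate discrete conformal structures. -/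
def IsRicciFlow [Fintype F] (Kbar : T.Vertex → ℝ) (τ : EReal) (f : ℝ → T.Vertex → ℝ) : Prop :=
  ∀ t ∈ timeInterval τ, T.IsConformalStructure g ε η (f t) ∧
    ∀ v, HasDerivWithinAt (fun s => T.uVec g ε (f s) v)
      (Kbar v - T.curvature g ε η (f t) v) (timeInterval τ) t

/-- `f` solves on `[0, τ)` the extended combinatorial Ricci flow with prescribed curvature
`Kbar`. -/
def IsExtRicciFlow [Fintype F] (Kbar : T.Vertex → ℝ) (τ : EReal) (f : ℝ → T.Vertex → ℝ) : Prop :=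
  ∀ t ∈ timeInterval τ, ∀ v, HasDerivWithinAt (fun s => T.uVec g ε (f s) v)
    (Kbar v - T.extCurvature g ε η (f t) v) (timeInterval τ) t

end TriangleGluing

end DiscreteConformal

end

open DiscreteConformal

/-! In the coordinates `u` the extended flow is `u' = X(u)` with `X` equal to `Kbar` minus the
extended curvature (`flowField`). Everything rests on `X` being dissipative: `∑ (v - u) * (X v - X
u) ≤ 0`.

For a nondegenerate triangle this is a statement about a quadratic form in three variables: the
derivative of the angles in a direction `x`, paired with `x`, is minus a form divided by the square
root of a positive area or Gram determinant. That form is positive definite in the hyperbolic case,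
and positive semidefinite with the constants as kernel in the Euclidean case (`hypForm_pos`,
`eucForm_pos`). Its weights are, up to positive factors, the signed heights of a centre of the
triangle over the sides, and they may be negative. In both cases the relevant determinant is a
positive multiple of the sum in `cyclic_product_pos`, which is positive by the structure conditions.
A positive determinant does not fix the signature. In the Euclidean case the form is paired with the
Gram matrix of the triangle itself (`laplaceForm_pos`). In the hyperbolic case at most one height is
nonpositive, and the determinant does not decrease when the negative weight is raised
(`hypSlope_nonneg`), so the weight can be moved to where a leading minor would vanish without losing
positivity (`blockForm_pos_of_det_pos`). An edge with negative `η` makes this a hard polynomial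
inequality (`slope_nonneg_of_neg_weight`).

Across degenerate triangles nothing is differentiated. On a segment with direction `d`, the sum of
`d` times the angles of a triangle is continuous, has nonpositive derivative where the triangle is
nondegenerate, and takes one of three values elsewhere, so it is nonincreasing
(`antitoneOn_of_hasDerivAt_nonpos_or_mem_finite`, `sum_mul_extAngle_le`). Summation over triangles
gives dissipativity.

The rest is the theory of dissipative fields. Distances between solutions do not increase, which
gives uniqueness. The field is continuous and bounded, and solutions of nearby smooth fields form a
Cauchy sequence, which gives existence for all time. In the hyperbolic case `u` must stay negative
where `ε = 1`: there the angles tend to `0` as the conformal factor grows, uniformly in the other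
factors, so `Kbar < 2π` provides a barrier (`exists_barrier`). At a nondegenerate equilibrium the
linearization is negative definite, in the Euclidean case on the hyperplane fixed by the conserved
sum of `u`. Dissipativity along rays spreads the resulting coercivity from a neighbourhood to any
ball, and the squared distance decays exponentially. -/

namespace DiscreteConformal

/-! ### Positivity of the quadratic form of a hyperbolic triangle -/


/-- Since `ε² = ε`, the sum equals `2 a₁ a₂ a₃` times the product of the three expressions of the
first structure condition, plus squares weighted by those of the second. The determinants of both
geometries reduce to it. -/
theorem cyclic_product_pos {ε₁ ε₂ ε₃ η₁ η₂ η₃ a₁ a₂ a₃ : ℝ}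
    (hε₁ : ε₁ = 0 ∨ ε₁ = 1) (hε₂ : ε₂ = 0 ∨ ε₂ = 1) (hε₃ : ε₃ = 0 ∨ ε₃ = 1)
    (h₁ : 0 < ε₂ * ε₃ + η₁) (h₂ : 0 < ε₃ * ε₁ + η₂) (h₃ : 0 < ε₁ * ε₂ + η₃)
    (g₁ : 0 ≤ ε₁ * η₁ + η₂ * η₃) (g₂ : 0 ≤ ε₂ * η₂ + η₃ * η₁) (g₃ : 0 ≤ ε₃ * η₃ + η₁ * η₂)
    (ha₁ : 0 < a₁) (ha₂ : 0 < a₂) (ha₃ : 0 < a₃) :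
    0 < (ε₂ * a₂ + η₁ * a₃) * (ε₃ * a₃ + η₂ * a₁) * (ε₁ * a₁ + η₃ * a₂) +
      (ε₃ * a₃ + η₁ * a₂) * (ε₁ * a₁ + η₂ * a₃) * (ε₂ * a₂ + η₃ * a₁) := by
  have key : (ε₂ * a₂ + η₁ * a₃) * (ε₃ * a₃ + η₂ * a₁) * (ε₁ * a₁ + η₃ * a₂) +
      (ε₃ * a₃ + η₁ * a₂) * (ε₁ * a₁ + η₂ * a₃) * (ε₂ * a₂ + η₃ * a₁) =
      2 * (a₁ * a₂ * a₃) * ((ε₂ * ε₃ + η₁) * (ε₃ * ε₁ + η₂) * (ε₁ * ε₂ + η₃)) +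
      ((ε₁ * η₁ + η₂ * η₃) * a₁ * (ε₂ * a₂ - ε₃ * a₃) ^ 2 +
      (ε₂ * η₂ + η₃ * η₁) * a₂ * (ε₃ * a₃ - ε₁ * a₁) ^ 2 +
      (ε₃ * η₃ + η₁ * η₂) * a₃ * (ε₁ * a₁ - ε₂ * a₂) ^ 2) := by
    rcases hε₁ with rfl | rfl <;> rcases hε₂ with rfl | rfl <;> rcases hε₃ with rfl | rfl <;> ring
  rw [key]
  positivity

/-- The symmetric `3 × 3` form built from the blocks `w (H (x² + y²) - 2 x y)` is positive definite
if it has positive determinant, and the determinant increases with the only negative weight. -/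
theorem blockForm_pos_of_det_pos {H₁ H₂ H₃ w₁ w₂ w₃ : ℝ} (hH₁ : 1 < H₁) (hH₂ : 1 < H₂)
    (hH₃ : 1 < H₃) (hw₂ : 0 < w₂) (hw₃ : 0 < w₃)
    (hF : 0 < 2 * w₁ * w₂ * w₃ * (H₁ * H₂ * H₃ - 1) + w₁ ^ 2 * (H₁ ^ 2 - 1) * (w₂ * H₂ + w₃ * H₃) +
      w₂ ^ 2 * (H₂ ^ 2 - 1) * (w₃ * H₃ + w₁ * H₁) + w₃ ^ 2 * (H₃ ^ 2 - 1) * (w₁ * H₁ + w₂ * H₂))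
    (hF' : 0 ≤ 2 * w₂ * w₃ * (H₁ * H₂ * H₃ - 1) + 2 * w₁ * (H₁ ^ 2 - 1) * (w₂ * H₂ + w₃ * H₃) +
      H₁ * (w₂ ^ 2 * (H₂ ^ 2 - 1) + w₃ ^ 2 * (H₃ ^ 2 - 1)))
    {x₁ x₂ x₃ : ℝ} (hx : ¬ (x₁ = 0 ∧ x₂ = 0 ∧ x₃ = 0)) :
    0 < w₁ * (H₁ * (x₂ ^ 2 + x₃ ^ 2) - 2 * x₂ * x₃) + w₂ * (H₂ * (x₃ ^ 2 + x₁ ^ 2) - 2 * x₃ * x₁) +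
      w₃ * (H₃ * (x₁ ^ 2 + x₂ ^ 2) - 2 * x₁ * x₂) := by
  set F := 2 * w₁ * w₂ * w₃ * (H₁ * H₂ * H₃ - 1) + w₁ ^ 2 * (H₁ ^ 2 - 1) * (w₂ * H₂ + w₃ * H₃) +
      w₂ ^ 2 * (H₂ ^ 2 - 1) * (w₃ * H₃ + w₁ * H₁) + w₃ ^ 2 * (H₃ ^ 2 - 1) * (w₁ * H₁ + w₂ * H₂)
    with hFdef
  set F' := 2 * w₂ * w₃ * (H₁ * H₂ * H₃ - 1) + 2 * w₁ * (H₁ ^ 2 - 1) * (w₂ * H₂ + w₃ * H₃) +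
      H₁ * (w₂ ^ 2 * (H₂ ^ 2 - 1) + w₃ ^ 2 * (H₃ ^ 2 - 1)) with hFdef'
  set b := w₂ * H₂ + w₃ * H₃ with hb
  have hb0 : 0 < b := by positivity
  -- `b` and this expression are the leading minors, `F` is the determinant and `F'` its derivative
  -- in `w₁`. If the second minor were nonpositive, raise `w₁` until it vanishes: the determinant,
  -- quadratic in `w₁`, stays positive, yet `b` times it becomes minus a square.
  have hm : 0 < b * (w₁ * H₁ + w₃ * H₃) - w₃ ^ 2 := by
    by_contra! hm
    obtain ⟨w, hw⟩ : ∃ w, b * (w * H₁ + w₃ * H₃) - w₃ ^ 2 = 0 :=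
      ⟨(w₃ ^ 2 / b - w₃ * H₃) / H₁, by field_simp; ring⟩
    have hle : w₁ ≤ w := by
      by_contra! hlt
      have : b * (w * H₁ + w₃ * H₃) < b * (w₁ * H₁ + w₃ * H₃) := by gcongr
      linarith
    have h1 : 0 < F + F' * (w - w₁) + (H₁ ^ 2 - 1) * b * (w - w₁) ^ 2 := by
      have : 0 ≤ H₁ ^ 2 - 1 := by nlinarith
      have : 0 ≤ w - w₁ := by linarith
      positivity
    have h2 : b * (F + F' * (w - w₁) + (H₁ ^ 2 - 1) * b * (w - w₁) ^ 2) =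
        (b * (w * H₁ + w₃ * H₃) - w₃ ^ 2) * (b * (w * H₁ + w₂ * H₂) - w₂ ^ 2) -
          (b * w + w₂ * w₃) ^ 2 := by
      rw [hFdef, hFdef', hb]; ring
    rw [hw] at h2
    nlinarith [mul_pos hb0 h1, sq_nonneg (b * w + w₂ * w₃)]
  set m := b * (w₁ * H₁ + w₃ * H₃) - w₃ ^ 2 with hmdef
  set q := w₁ * (H₁ * (x₂ ^ 2 + x₃ ^ 2) - 2 * x₂ * x₃) +
    w₂ * (H₂ * (x₃ ^ 2 + x₁ ^ 2) - 2 * x₃ * x₁) +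
      w₃ * (H₃ * (x₁ ^ 2 + x₂ ^ 2) - 2 * x₁ * x₂) with hq
  -- Completion of squares with the leading minors `b`, `m` and the determinant `F`.
  have e1 : b * m * q = m * (b * x₁ - w₃ * x₂ - w₂ * x₃) ^ 2 +
      (m * x₂ - (b * w₁ + w₂ * w₃) * x₃) ^ 2 + b * F * x₃ ^ 2 := by
    rw [hq, hFdef, hmdef, hb]; ring
  have e2 : 0 < m * (b * x₁ - w₃ * x₂ - w₂ * x₃) ^ 2 +
      (m * x₂ - (b * w₁ + w₂ * w₃) * x₃) ^ 2 + b * F * x₃ ^ 2 := by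
    by_cases h3 : x₃ = 0
    · by_cases h2 : x₂ = 0
      · have h1 : x₁ ≠ 0 := fun h1 => hx ⟨h1, h2, h3⟩
        rw [h2, h3]
        have : b * x₁ - w₃ * 0 - w₂ * 0 ≠ 0 := by simp [hb0.ne', h1]
        positivity
      · have : m * x₂ - (b * w₁ + w₂ * w₃) * x₃ ≠ 0 := by simp [h3, hm.ne', h2]
        positivity
    · positivity
  rw [← e1] at e2
  exact (mul_pos_iff_of_pos_left (by positivity)).1 e2

theorem block_pos {H w x y : ℝ} (hH : 1 < H) (hw : 0 < w) (h : x ≠ 0 ∨ y ≠ 0) :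
    0 < w * (H * (x ^ 2 + y ^ 2) - 2 * x * y) := by
  apply mul_pos hw
  have : 0 < x ^ 2 + y ^ 2 := by rcases h with h | h <;> positivity
  nlinarith [sq_nonneg (x - y)]

theorem block_nonneg {H w : ℝ} (x y : ℝ) (hH : 1 < H) (hw : 0 ≤ w) :
    0 ≤ w * (H * (x ^ 2 + y ^ 2) - 2 * x * y) := by
  apply mul_nonneg hw
  nlinarith [sq_nonneg (x - y), sq_nonneg x, sq_nonneg y]

/-- At most one of the numbers `h` is nonpositive. -/
theorem height_pos_of_nonpos {ε₁ ε₂ ε₃ η₁ η₂ η₃ k₁ k₂ k₃ : ℝ}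
    (hε₁ : ε₁ = 0 ∨ ε₁ = 1) (hε₂ : ε₂ = 0 ∨ ε₂ = 1) (hε₃ : ε₃ = 0 ∨ ε₃ = 1)
    (h₁ : 0 < ε₂ * ε₃ + η₁) (h₂ : 0 < ε₃ * ε₁ + η₂) (h₃ : 0 < ε₁ * ε₂ + η₃)
    (g₁ : 0 ≤ ε₁ * η₁ + η₂ * η₃) (g₂ : 0 ≤ ε₂ * η₂ + η₃ * η₁) (g₃ : 0 ≤ ε₃ * η₃ + η₁ * η₂)
    (hk₁ : 0 < k₁) (hk₂ : 0 < k₂) (hk₃ : 0 < k₃)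
    (hn : k₁ * (ε₂ * ε₃ - η₁ ^ 2) + (ε₃ * η₃ + η₁ * η₂) * k₂ + (ε₂ * η₂ + η₃ * η₁) * k₃ ≤ 0) :
    0 < k₂ * (ε₃ * ε₁ - η₂ ^ 2) + (ε₁ * η₁ + η₂ * η₃) * k₃ + (ε₃ * η₃ + η₁ * η₂) * k₁ := by
  by_contra! hn'
  -- With both expressions nonpositive, dropping the `k₃` terms leaves two inequalities in which
  -- `k₁` and `k₂` play opposite roles; their product no longer contains `k₁ k₂`.
  have a1 : (ε₃ * η₃ + η₁ * η₂) * k₂ ≤ k₁ * (η₁ ^ 2 - ε₂ * ε₃) := by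
    nlinarith [mul_nonneg g₂ hk₃.le]
  have a2 : (ε₃ * η₃ + η₁ * η₂) * k₁ ≤ k₂ * (η₂ ^ 2 - ε₃ * ε₁) := by
    nlinarith [mul_nonneg g₁ hk₃.le]
  have b1 : 0 ≤ η₁ ^ 2 - ε₂ * ε₃ := nonneg_of_mul_nonneg_right
    ((mul_nonneg g₃ hk₂.le).trans a1) hk₁
  have b2 : 0 ≤ η₂ ^ 2 - ε₃ * ε₁ := nonneg_of_mul_nonneg_right
    ((mul_nonneg g₃ hk₁.le).trans a2) hk₂
  have c1 : 0 < η₁ := by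
    rcases hε₂ with rfl | rfl <;> rcases hε₃ with rfl | rfl <;> nlinarith
  have c2 : 0 < η₂ := by
    rcases hε₁ with rfl | rfl <;> rcases hε₃ with rfl | rfl <;> nlinarith
  rcases hε₃ with rfl | rfl
  -- For `ε₃ = 0` the two inequalities are opposite to each other, hence equalities, and the dropped
  -- `k₃` terms must vanish.
  · have d1 : η₂ * k₂ ≤ k₁ * η₁ := by
      have : η₁ * (η₂ * k₂) ≤ η₁ * (k₁ * η₁) := by linarith
      exact le_of_mul_le_mul_left this c1
    have d2 : k₁ * η₁ ≤ η₂ * k₂ := by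
      have : η₂ * (k₁ * η₁) ≤ η₂ * (η₂ * k₂) := by linarith
      exact le_of_mul_le_mul_left this c2
    have d3 : η₂ * k₂ = k₁ * η₁ := le_antisymm d1 d2
    have f1 : ε₁ * η₁ + η₂ * η₃ = 0 := by
      have : (ε₁ * η₁ + η₂ * η₃) * k₃ ≤ 0 := by linear_combination hn' + η₂ * d3
      nlinarith
    have f2 : ε₂ * η₂ + η₃ * η₁ = 0 := by
      have : (ε₂ * η₂ + η₃ * η₁) * k₃ ≤ 0 := by linear_combination hn - η₁ * d3
      nlinarith
    have f3 : ¬ (η₃ = 0) := by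
      rintro rfl
      rcases hε₁ with rfl | rfl <;> rcases hε₂ with rfl | rfl <;> simp at f1 f2 h₃ <;> linarith
    rcases hε₁ with rfl | rfl
    · simp at f1; rcases f1 with h | h <;> simp_all
    rcases hε₂ with rfl | rfl
    · simp at f2; rcases f2 with h | h <;> simp_all
    have : (η₁ + η₂) * (1 + η₃) = 0 := by linarith
    have : 0 < (η₁ + η₂) * (1 + η₃) := by apply mul_pos <;> linarith
    linarith
  · have e1 : (η₃ + η₁ * η₂) ^ 2 ≤ (η₁ ^ 2 - ε₂) * (η₂ ^ 2 - ε₁) := by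
      have := mul_le_mul a1 a2 (by positivity) (by positivity)
      have h12 : 0 < k₁ * k₂ := by positivity
      refine le_of_mul_le_mul_left ?_ h12
      linarith
    rcases lt_trichotomy η₃ 0 with hx | hx | hx
    · have : ε₁ = 1 ∧ ε₂ = 1 := by
        rcases hε₁ with rfl | rfl <;> rcases hε₂ with rfl | rfl <;>
          first | exact ⟨rfl, rfl⟩ | (exfalso; linarith)
      obtain ⟨rfl, rfl⟩ := this
      -- For `ε₁ = ε₂ = 1`, `e1` reads `η₁² + η₂² + η₃² + 2 η₁ η₂ η₃ ≤ 1`. It is symmetric in the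
      -- weights, so it can be regrouped around `η₃`, where `1 - η₃²` is positive.
      have hs : (η₁ + η₃ * η₂) ^ 2 ≤ (1 - η₃ ^ 2) * (1 - η₂ ^ 2) := by linarith
      have h3 : 0 < 1 - η₃ ^ 2 := by nlinarith
      have h4 : 1 - η₂ ^ 2 ≤ 0 := by linarith
      have h5 : η₁ + η₃ * η₂ = 0 := by
        have := mul_nonneg h3.le (neg_nonneg.2 h4)
        nlinarith
      have h6 : η₂ ^ 2 ≤ 1 := by
        rw [h5] at hs
        by_contra! h
        nlinarith
      nlinarith
    · subst hx
      have : ε₁ = 1 ∧ ε₂ = 1 := by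
        rcases hε₁ with rfl | rfl <;> rcases hε₂ with rfl | rfl <;>
          first | exact ⟨rfl, rfl⟩ | (exfalso; linarith)
      obtain ⟨rfl, rfl⟩ := this
      nlinarith
    · have : 0 < η₃ * (η₁ * η₂) := by positivity
      rcases hε₁ with rfl | rfl <;> rcases hε₂ with rfl | rfl <;> nlinarith

section

/-! ### A polynomial inequality for edges with negative weight -/

/-- Simultaneous parametrization of the ratios that occur below. -/
theorem exists_nonneg_coords {A b d : ℝ} (hA : 1 < A) (h₁ : d ≤ A * b) (h₂ : b ≤ A * d) :
    ∃ y₁ y₂ : ℝ, 0 ≤ y₁ ∧ 0 ≤ y₂ ∧ b = A * y₁ + y₂ ∧ d = y₁ + A * y₂ := by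
  have h : 0 < A ^ 2 - 1 := by nlinarith
  refine ⟨(A * b - d) / (A ^ 2 - 1), (A * d - b) / (A ^ 2 - 1), ?_, ?_, ?_, ?_⟩
  · exact div_nonneg (by linarith) h.le
  · exact div_nonneg (by linarith) h.le
  · field_simp; ring
  · field_simp; ring

section Polynomial

variable {s y z q y₁ y₂ k₁ k₂ k₃ b d p t : ℝ}

set_option maxRecDepth 100000
set_option maxHeartbeats 4000000

/-- The substitutions express everything through nonnegative parameters, and the expanded polynomial
has no negative coefficient. This is the case `e = 0` of `slope_nonneg_of_neg_weight`, multiplied by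
`(1 + s)²` where `1 + s = 1 / a`. -/
theorem slope_poly_ideal (hs : 0 ≤ s) (hy : 0 ≤ y) (hz : 0 ≤ k₃) (hq : 0 ≤ q) (h₁ : 0 ≤ y₁)
    (h₂ : 0 ≤ y₂) (hk₂ : k₂ = 1 + y) (hk₁ : k₁ = (1 + s) * (k₂ + q))
    (hb : b = (1 + s) * y₁ + y₂) (hd : d = y₁ + (1 + s) * y₂) (hp : p = (1 + s) * k₁ - k₂)
    (ht : t = p ^ 2 + ((1 + s) ^ 2 - 1) * (k₂ ^ 2 - 1)) :
    0 ≤ (k₃ + b * k₁) * (d * k₃ * t +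
        p * ((k₃ * (b * k₂ + d * k₁) + b * d) * (1 + s) + k₃ ^ 2)) -
      q * ((k₃ + d * k₂) * (2 * b * k₁ * k₃ + b ^ 2 + k₃ ^ 2) * (1 + s) ^ 2 +
        b * k₃ * (k₃ * p * (1 + s) + (d * k₁ * k₂ - b * k₂ ^ 2 + b) * (1 + s) ^ 2 -
          d * (1 + s))) := by
  subst hk₂ hk₁ hb hd hp ht
  ring_nf
  positivity

/-- For `e = 1` the polynomial is split by its degree in `(b, d)`. The parts of degree three and two
expand with nonnegative coefficients by themselves. -/
theorem slope_poly_cubic (hs : 0 ≤ s) (hy : 0 ≤ y) (hq : 0 ≤ q) (h₁ : 0 ≤ y₁)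
    (h₂ : 0 ≤ y₂) (hk₂ : k₂ = 1 + y) (hk₁ : k₁ = (1 + s) * (k₂ + q))
    (hb : b = (1 + s) * y₁ + y₂) (hd : d = y₁ + (1 + s) * y₂) (hp : p = (1 + s) * k₁ - k₂) :
    0 ≤ b * k₁ * (p * (b * d * (1 + s))) - q * (d * k₂ * (b ^ 2 * (1 + s) ^ 2)) := by
  subst hk₂ hk₁ hb hd hp
  ring_nf
  positivity

theorem slope_poly_quadratic (hs : 0 ≤ s) (hy : 0 ≤ y) (hz : 0 ≤ z) (hq : 0 ≤ q) (h₁ : 0 ≤ y₁)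
    (h₂ : 0 ≤ y₂) (hk₂ : k₂ = 1 + y) (hk₁ : k₁ = (1 + s) * (k₂ + q)) (hk₃ : k₃ = 1 + z)
    (hb : b = (1 + s) * y₁ + y₂) (hd : d = y₁ + (1 + s) * y₂) (hp : p = (1 + s) * k₁ - k₂)
    (ht : t = p ^ 2 + ((1 + s) ^ 2 - 1) * (k₂ ^ 2 - 1)) :
    0 ≤ k₃ * (p * (b * d * (1 + s))) +
        b * k₁ * (d * k₃ * t + p * (k₃ * (b * k₂ + d * k₁) * (1 + s))) -
      q * (k₃ * (b ^ 2 * (1 + s) ^ 2) + d * k₂ * (2 * b * k₁ * k₃ * (1 + s) ^ 2) +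
        b * k₃ * ((d * k₁ * k₂ - b * k₂ ^ 2 + b) * (1 + s) ^ 2 - d * (1 + s))) := by
  subst hk₂ hk₁ hk₃ hb hd hp ht
  ring_nf
  positivity

/-- The part of degree zero is homogenized by the factor `(1 + s) b d` and added to the part of
degree two; the next lemma treats degrees one and three in the same way. -/
theorem slope_poly_even (hs : 0 ≤ s) (hy : 0 ≤ y) (hz : 0 ≤ z) (hq : 0 ≤ q) (h₁ : 0 ≤ y₁)
    (h₂ : 0 ≤ y₂) (hk₂ : k₂ = 1 + y) (hk₁ : k₁ = (1 + s) * (k₂ + q)) (hk₃ : k₃ = 1 + z)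
    (hb : b = (1 + s) * y₁ + y₂) (hd : d = y₁ + (1 + s) * y₂) (hp : p = (1 + s) * k₁ - k₂)
    (ht : t = p ^ 2 + ((1 + s) ^ 2 - 1) * (k₂ ^ 2 - 1)) :
    0 ≤ k₃ * (p * (b * d * (1 + s))) +
        b * k₁ * (d * k₃ * t + p * (k₃ * (b * k₂ + d * k₁) * (1 + s))) -
      q * (k₃ * (b ^ 2 * (1 + s) ^ 2) + d * k₂ * (2 * b * k₁ * k₃ * (1 + s) ^ 2) +
        b * k₃ * ((d * k₁ * k₂ - b * k₂ ^ 2 + b) * (1 + s) ^ 2 - d * (1 + s))) +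
      (1 + s) * b * d * (k₃ * (k₂ * t + p * (k₁ * k₂ * (1 + s) + (k₃ ^ 2 - 1))) -
        q * (k₃ * ((k₁ ^ 2 + k₃ ^ 2 - 1) * (1 + s) ^ 2) + k₁ * (k₃ * p * (1 + s)))) := by
  subst hk₂ hk₁ hk₃ hb hd hp ht
  ring_nf
  positivity

theorem slope_poly_odd (hs : 0 ≤ s) (hy : 0 ≤ y) (hz : 0 ≤ z) (hq : 0 ≤ q) (h₁ : 0 ≤ y₁)
    (h₂ : 0 ≤ y₂) (hk₂ : k₂ = 1 + y) (hk₁ : k₁ = (1 + s) * (k₂ + q)) (hk₃ : k₃ = 1 + z)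
    (hb : b = (1 + s) * y₁ + y₂) (hd : d = y₁ + (1 + s) * y₂) (hp : p = (1 + s) * k₁ - k₂)
    (ht : t = p ^ 2 + ((1 + s) ^ 2 - 1) * (k₂ ^ 2 - 1)) :
    0 ≤ b * k₁ * (p * (b * d * (1 + s))) - q * (d * k₂ * (b ^ 2 * (1 + s) ^ 2)) +
      (1 + s) * b * d * (k₃ * (d * k₃ * t + p * (k₃ * (b * k₂ + d * k₁) * (1 + s))) +
        b * k₁ * (k₂ * t + p * (k₁ * k₂ * (1 + s) + (k₃ ^ 2 - 1))) -
        q * (k₃ * (2 * b * k₁ * k₃ * (1 + s) ^ 2) + d * k₂ * ((k₁ ^ 2 + k₃ ^ 2 - 1) * (1 + s) ^ 2) +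
          k₁ * ((d * k₁ * k₂ - b * k₂ ^ 2 + b) * (1 + s) ^ 2 - d * (1 + s)) +
          b * k₃ * (k₃ * p * (1 + s)))) := by
  subst hk₂ hk₁ hk₃ hb hd hp ht
  ring_nf
  positivity

end Polynomial

/-- `P + Q` lies between `P` and `P + l * Q`. This undoes the homogenization. -/
theorem add_nonneg_of_scaled {P Q l : ℝ} (hl : 1 ≤ l) (hP : 0 ≤ P) (h : 0 ≤ P + l * Q) :
    0 ≤ P + Q := by
  rcases le_or_gt 0 Q with hQ | hQ
  · positivity
  · nlinarith

end

section

/-- The hard case of `hypSlope_nonneg`, with `a = -η₃`, `b = η₂`, `d = η₁`, `e = ε₃` and `kᵢ = cᵢ /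
rᵢ`, after division by `r₁⁴ r₂³ r₃³`. The hypothesis `hk` corresponds to `c₁ * H₃ - c₂ ≤ 0`, so that
the second summand competes with the first. -/
theorem slope_nonneg_of_neg_weight {e a b d k₁ k₂ k₃ : ℝ} (he : e = 0 ∨ e = 1) (ha₀ : 0 < a)
    (ha₁ : a < 1) (hb : 0 ≤ b - a * d) (hd : 0 ≤ d - a * b) (hg : 0 ≤ b * d - e * a)
    (hk₂ : 1 ≤ k₂) (hk₃ : 0 < k₃) (hk₃' : e ≤ k₃) (hk : k₂ ≤ a * k₁) :
    0 ≤ (k₃ + b * k₁) * ((e * k₂ + d * k₃) * (k₁ ^ 2 + k₂ ^ 2 - 2 * a * k₁ * k₂ + a ^ 2 - 1) +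
        (k₁ - a * k₂) * (e * k₁ * k₂ + k₃ * (b * k₂ + d * k₁) + b * d + a * (k₃ ^ 2 - e))) -
      (a * k₁ - k₂) * ((k₃ + d * k₂) * (2 * b * k₁ * k₃ + b ^ 2 + e * k₁ ^ 2 + k₃ ^ 2 - e) +
        (e * k₁ + b * k₃) * (k₃ * (k₁ - a * k₂) + d * k₁ * k₂ - b * k₂ ^ 2 + b - a * d)) := by
  obtain ⟨s, hs, rfl⟩ : ∃ s : ℝ, 0 < s ∧ a = (1 + s)⁻¹ :=
    ⟨a⁻¹ - 1, by linarith [(one_lt_inv₀ ha₀).2 ha₁], by simp⟩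
  have hA : (0 : ℝ) < 1 + s := by linarith
  have hd' : d ≤ (1 + s) * b := by
    have := mul_nonneg hA.le hb
    field_simp at this; linarith
  have hb' : b ≤ (1 + s) * d := by
    have := mul_nonneg hA.le hd
    field_simp at this; linarith
  -- The two bounds place `(b, d)` in the cone spanned by `(1 + s, 1)` and `(1, 1 + s)`.
  obtain ⟨y₁, y₂, hy₁, hy₂, hbe, hde⟩ := exists_nonneg_coords (by linarith) hd' hb'
  obtain ⟨y, hy, hk₂e⟩ : ∃ y : ℝ, 0 ≤ y ∧ k₂ = 1 + y := ⟨k₂ - 1, by linarith, by ring⟩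
  obtain ⟨q, hq, hqe⟩ : ∃ q : ℝ, 0 ≤ q ∧ (1 + s)⁻¹ * k₁ - k₂ = q :=
    ⟨_, by linarith, rfl⟩
  have hk₁e : k₁ = (1 + s) * (k₂ + q) := by rw [← hqe]; field_simp; ring
  rw [hqe]
  obtain ⟨p, hp⟩ : ∃ p, p = (1 + s) * k₁ - k₂ := ⟨_, rfl⟩
  obtain ⟨t, ht⟩ : ∃ t, t = p ^ 2 + ((1 + s) ^ 2 - 1) * (k₂ ^ 2 - 1) := ⟨_, rfl⟩
  have hA2 : (0 : ℝ) < (1 + s) ^ 2 := by positivity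
  refine nonneg_of_mul_nonneg_right (b := _) ?_ hA2
  rcases he with rfl | rfl
  · have := slope_poly_ideal hs.le hy hk₃.le hq hy₁ hy₂ hk₂e hk₁e hbe hde hp ht
    refine this.trans_eq ?_
    rw [ht, hp]
    field_simp
    ring
  · obtain ⟨z, hz, hk₃e⟩ : ∃ z : ℝ, 0 ≤ z ∧ k₃ = 1 + z := ⟨k₃ - 1, by linarith, by ring⟩
    -- The structure condition at the third vertex, `b d ≥ a = 1 / (1 + s)`, is what allows the
    -- lower-degree parts to be scaled up.
    have hl : 1 ≤ (1 + s) * b * d := by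
      have := mul_nonneg hA.le hg
      field_simp at this; linarith
    have h1 := add_nonneg_of_scaled hl
      (slope_poly_cubic hs.le hy hq hy₁ hy₂ hk₂e hk₁e hbe hde hp)
      (slope_poly_odd hs.le hy hz hq hy₁ hy₂ hk₂e hk₁e hk₃e hbe hde hp ht)
    have h2 := add_nonneg_of_scaled hl
      (slope_poly_quadratic hs.le hy hz hq hy₁ hy₂ hk₂e hk₁e hk₃e hbe hde hp ht)
      (slope_poly_even hs.le hy hz hq hy₁ hy₂ hk₂e hk₁e hk₃e hbe hde hp ht)
    refine (add_nonneg h1 h2).trans_eq ?_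
    rw [ht, hp]
    field_simp
    ring

end

section

/-! ### The quadratic form of a hyperbolic triangle -/

/-- A component of the adjugate of the matrix with diagonal entries `1` and off-diagonal entries
`H`, applied to the vector `c`. -/
def hypHeight (c₁ c₂ c₃ H₁ H₂ H₃ : ℝ) : ℝ :=
  c₁ * (1 - H₁ ^ 2) + c₂ * (H₁ * H₂ - H₃) + c₃ * (H₁ * H₃ - H₂)

/-- Replacing `c² - 1` by `ε r²` brings out the expressions of the second structure condition as
coefficients, so only the term with `ε₂ * ε₃ - η₁ ^ 2` can make a height negative. -/
theorem hypHeight_eq {ε₂ ε₃ η₁ η₂ η₃ r₁ r₂ r₃ c₁ c₂ c₃ : ℝ}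
    (hc₂ : c₂ ^ 2 = 1 + ε₂ * r₂ ^ 2) (hc₃ : c₃ ^ 2 = 1 + ε₃ * r₃ ^ 2) :
    hypHeight c₁ c₂ c₃ (c₂ * c₃ + η₁ * (r₂ * r₃)) (c₃ * c₁ + η₂ * (r₃ * r₁))
      (c₁ * c₂ + η₃ * (r₁ * r₂)) =
    c₁ * (r₂ * r₃) ^ 2 * (ε₂ * ε₃ - η₁ ^ 2) +
      c₂ * (r₁ * r₂ * r₃ ^ 2) * (ε₃ * η₃ + η₁ * η₂) +
      c₃ * (r₁ * r₂ ^ 2 * r₃) * (ε₂ * η₂ + η₃ * η₁) := by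
  have e₂ : ε₂ * r₂ ^ 2 = c₂ ^ 2 - 1 := by linarith
  have e₃ : ε₃ * r₃ ^ 2 = c₃ ^ 2 - 1 := by linarith
  have : c₁ * (r₂ * r₃) ^ 2 * (ε₂ * ε₃ - η₁ ^ 2) +
      c₂ * (r₁ * r₂ * r₃ ^ 2) * (ε₃ * η₃ + η₁ * η₂) +
      c₃ * (r₁ * r₂ ^ 2 * r₃) * (ε₂ * η₂ + η₃ * η₁) =
      c₁ * ((ε₂ * r₂ ^ 2) * (ε₃ * r₃ ^ 2) - (η₁ * (r₂ * r₃)) ^ 2) +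
      c₂ * ((ε₃ * r₃ ^ 2) * (η₃ * (r₁ * r₂)) + (η₁ * (r₂ * r₃)) * (η₂ * (r₃ * r₁))) +
      c₃ * ((ε₂ * r₂ ^ 2) * (η₂ * (r₃ * r₁)) + (η₃ * (r₁ * r₂)) * (η₁ * (r₂ * r₃))) := by ring
  rw [this, e₂, e₃, hypHeight]
  ring

theorem hypHeight_pos_of_nonpos {ε₁ ε₂ ε₃ η₁ η₂ η₃ r₁ r₂ r₃ c₁ c₂ c₃ : ℝ}
    (hε₁ : ε₁ = 0 ∨ ε₁ = 1) (hε₂ : ε₂ = 0 ∨ ε₂ = 1) (hε₃ : ε₃ = 0 ∨ ε₃ = 1)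
    (h₁ : 0 < ε₂ * ε₃ + η₁) (h₂ : 0 < ε₃ * ε₁ + η₂) (h₃ : 0 < ε₁ * ε₂ + η₃)
    (g₁ : 0 ≤ ε₁ * η₁ + η₂ * η₃) (g₂ : 0 ≤ ε₂ * η₂ + η₃ * η₁) (g₃ : 0 ≤ ε₃ * η₃ + η₁ * η₂)
    (hr₁ : 0 < r₁) (hr₂ : 0 < r₂) (hr₃ : 0 < r₃) (hc₁ : 0 < c₁) (hc₂ : 0 < c₂) (hc₃ : 0 < c₃)
    (e₁ : c₁ ^ 2 = 1 + ε₁ * r₁ ^ 2) (e₂ : c₂ ^ 2 = 1 + ε₂ * r₂ ^ 2)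
    (e₃ : c₃ ^ 2 = 1 + ε₃ * r₃ ^ 2)
    (hn : hypHeight c₁ c₂ c₃ (c₂ * c₃ + η₁ * (r₂ * r₃)) (c₃ * c₁ + η₂ * (r₃ * r₁))
      (c₁ * c₂ + η₃ * (r₁ * r₂)) ≤ 0) :
    0 < hypHeight c₂ c₃ c₁ (c₃ * c₁ + η₂ * (r₃ * r₁)) (c₁ * c₂ + η₃ * (r₁ * r₂))
      (c₂ * c₃ + η₁ * (r₂ * r₃)) := by
  rw [hypHeight_eq e₂ e₃] at hn
  rw [hypHeight_eq e₃ e₁]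
  have hn' : c₁ / r₁ * (ε₂ * ε₃ - η₁ ^ 2) + (ε₃ * η₃ + η₁ * η₂) * (c₂ / r₂) +
      (ε₂ * η₂ + η₃ * η₁) * (c₃ / r₃) ≤ 0 := by
    have hp : 0 < r₁ * (r₂ * r₃) ^ 2 := by positivity
    refine nonpos_of_mul_nonpos_right (hn.trans_eq' ?_) hp
    field_simp
  have := height_pos_of_nonpos hε₁ hε₂ hε₃ h₁ h₂ h₃ g₁ g₂ g₃ (div_pos hc₁ hr₁) (div_pos hc₂ hr₂)
    (div_pos hc₃ hr₃) hn'
  have hp : 0 < r₂ * (r₃ * r₁) ^ 2 := by positivity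
  refine (mul_pos hp this).trans_eq ?_
  field_simp

/-- `cosh` of the length of a hyperbolic edge is larger than `1`. -/
theorem one_lt_coshLength {ε ε' η r r' c c' : ℝ} (hε : ε = 0 ∨ ε = 1) (hε' : ε' = 0 ∨ ε' = 1)
    (h : 0 < ε * ε' + η) (hr : 0 < r) (hr' : 0 < r') (hc : 0 < c) (hc' : 0 < c')
    (e : c ^ 2 = 1 + ε * r ^ 2) (e' : c' ^ 2 = 1 + ε' * r' ^ 2) :
    1 < c * c' + η * (r * r') := by
  have h1 : 1 + ε * ε' * (r * r') ≤ c * c' := by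
    apply le_of_sq_le_sq _ (by positivity)
    rw [mul_pow, e, e']
    rcases hε with rfl | rfl <;> rcases hε' with rfl | rfl <;>
      nlinarith [sq_nonneg (r - r'), sq_nonneg r, sq_nonneg r']
  nlinarith [mul_pos h (mul_pos hr hr')]

theorem weight_pos {ε ε' η : ℝ} (hε : ε = 0 ∨ ε = 1) (hε' : ε' = 0 ∨ ε' = 1)
    (h : 0 < ε * ε' + η) (h' : 0 < η ^ 2 - ε * ε') : 0 < η := by
  rcases hε with rfl | rfl <;> rcases hε' with rfl | rfl <;> nlinarith

theorem sq_sub_one_pos {x : ℝ} (h : 1 < x) : 0 < x ^ 2 - 1 := by nlinarith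

theorem le_of_sq_sub_pos {ε x : ℝ} (hε : ε = 0 ∨ ε = 1) (hx : 0 < x) (h : 0 < x ^ 2 - ε) :
    ε ≤ x := by
  rcases hε with rfl | rfl <;> nlinarith

/-- Derivative of the determinant along the motion of the center towards a vertex. -/
theorem hypSlope_nonneg {ε₁ ε₂ ε₃ η₁ η₂ η₃ r₁ r₂ r₃ c₁ c₂ c₃ H₁ H₂ H₃ : ℝ}
    (hε₁ : ε₁ = 0 ∨ ε₁ = 1) (hε₂ : ε₂ = 0 ∨ ε₂ = 1) (hε₃ : ε₃ = 0 ∨ ε₃ = 1)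
    (h₁ : 0 < ε₂ * ε₃ + η₁) (h₃ : 0 < ε₁ * ε₂ + η₃)
    (g₁ : 0 ≤ ε₁ * η₁ + η₂ * η₃) (g₂ : 0 ≤ ε₂ * η₂ + η₃ * η₁) (g₃ : 0 ≤ ε₃ * η₃ + η₁ * η₂)
    (hr₁ : 0 < r₁) (hr₂ : 0 < r₂) (hr₃ : 0 < r₃) (hc₁ : 0 < c₁) (hc₂ : 0 < c₂) (hc₃ : 0 < c₃)
    (e₁ : c₁ ^ 2 = 1 + ε₁ * r₁ ^ 2) (e₂ : c₂ ^ 2 = 1 + ε₂ * r₂ ^ 2)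
    (e₃ : c₃ ^ 2 = 1 + ε₃ * r₃ ^ 2) (eH₁ : H₁ = c₂ * c₃ + η₁ * (r₂ * r₃))
    (eH₂ : H₂ = c₃ * c₁ + η₂ * (r₃ * r₁)) (eH₃ : H₃ = c₁ * c₂ + η₃ * (r₁ * r₂))
    (hn : hypHeight c₁ c₂ c₃ H₁ H₂ H₃ < 0) (hη₂ : 0 ≤ η₂) :
    0 ≤ (c₁ * H₂ - c₃) * ((c₃ * H₁ - c₂) * (H₃ ^ 2 - 1) + (H₁ * H₂ - H₃) * (c₂ * H₃ - c₁)) +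
      (c₁ * H₃ - c₂) * ((c₂ * H₁ - c₃) * (H₂ ^ 2 - 1) + (H₁ * H₃ - H₂) * (c₃ * H₂ - c₁)) := by
  have hn' := hn
  rw [eH₁, eH₂, eH₃, hypHeight_eq e₂ e₃] at hn'
  have n1 : c₁ * (r₂ * r₃) * (ε₂ * ε₃ - η₁ ^ 2) + c₂ * (r₁ * r₃) * (ε₃ * η₃ + η₁ * η₂) +
      c₃ * (r₁ * r₂) * (ε₂ * η₂ + η₃ * η₁) < 0 := by
    have hp : 0 < r₂ * r₃ := by positivity
    refine neg_of_mul_neg_left (hn'.trans_eq' ?_) hp.le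
    ring
  have hε₂0 : 0 ≤ ε₂ := by rcases hε₂ with rfl | rfl <;> norm_num
  have hε₃0 : 0 ≤ ε₃ := by rcases hε₃ with rfl | rfl <;> norm_num
  have hε₁0 : 0 ≤ ε₁ := by rcases hε₁ with rfl | rfl <;> norm_num
  have t1 : 0 ≤ c₂ * (r₁ * r₃) * (ε₃ * η₃ + η₁ * η₂) := by positivity
  have t2 : 0 ≤ c₃ * (r₁ * r₂) * (ε₂ * η₂ + η₃ * η₁) := by positivity
  -- A negative height with two nonnegative terms forces its first term to be negative; by the first
  -- structure condition this also makes `η₁` positive.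
  have hG : 0 < η₁ ^ 2 - ε₂ * ε₃ := by
    have h : 0 < c₁ * (r₂ * r₃) * (η₁ ^ 2 - ε₂ * ε₃) := by linarith
    exact (mul_pos_iff_of_pos_left (by positivity)).1 h
  have hη₁ : 0 < η₁ := weight_pos hε₂ hε₃ h₁ hG
  have n2 : c₂ * r₁ * (ε₃ * η₃ + η₁ * η₂) ≤ c₁ * r₂ * (η₁ ^ 2 - ε₂ * ε₃) := by
    refine le_of_mul_le_mul_right ?_ hr₃
    linarith
  have n3 : c₃ * r₁ * (ε₂ * η₂ + η₃ * η₁) ≤ c₁ * r₃ * (η₁ ^ 2 - ε₂ * ε₃) := by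
    refine le_of_mul_le_mul_right ?_ hr₂
    linarith
  -- Each of the six differences is a positive multiple of a combination with coefficients `ε` and
  -- the `η` of its own edge, so it can be negative only if that `η` is.
  have C12 : c₂ * H₁ - c₃ = r₂ * (ε₂ * r₂ * c₃ + η₁ * r₃ * c₂) := by
    rw [eH₁]; linear_combination c₃ * e₂
  have C13 : c₃ * H₁ - c₂ = r₃ * (ε₃ * r₃ * c₂ + η₁ * r₂ * c₃) := by
    rw [eH₁]; linear_combination c₂ * e₃
  have C23 : c₃ * H₂ - c₁ = r₃ * (ε₃ * r₃ * c₁ + η₂ * r₁ * c₃) := by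
    rw [eH₂]; linear_combination c₁ * e₃
  have C21 : c₁ * H₂ - c₃ = r₁ * (ε₁ * r₁ * c₃ + η₂ * r₃ * c₁) := by
    rw [eH₂]; linear_combination c₃ * e₁
  have C31 : c₁ * H₃ - c₂ = r₁ * (ε₁ * r₁ * c₂ + η₃ * r₂ * c₁) := by
    rw [eH₃]; linear_combination c₂ * e₁
  have C32 : c₂ * H₃ - c₁ = r₂ * (ε₂ * r₂ * c₁ + η₃ * r₁ * c₂) := by
    rw [eH₃]; linear_combination c₁ * e₂
  have C12p : 0 ≤ c₂ * H₁ - c₃ := by rw [C12]; positivity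
  have C13p : 0 ≤ c₃ * H₁ - c₂ := by rw [C13]; positivity
  have C23p : 0 ≤ c₃ * H₂ - c₁ := by rw [C23]; positivity
  have C21p : 0 ≤ c₁ * H₂ - c₃ := by rw [C21]; positivity
  have hS₂ : 0 ≤ H₂ ^ 2 - 1 := by
    have e : H₂ ^ 2 - 1 = ε₁ * r₁ ^ 2 + ε₃ * r₃ ^ 2 + ε₁ * ε₃ * (r₁ * r₃) ^ 2 +
        2 * c₃ * c₁ * η₂ * (r₃ * r₁) + (η₂ * (r₃ * r₁)) ^ 2 := by
      rw [eH₂]; linear_combination c₃ ^ 2 * e₁ + (1 + ε₁ * r₁ ^ 2) * e₃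
    rw [e]; positivity
  have hS₃ : 0 ≤ H₃ ^ 2 - 1 := by
    have := one_lt_coshLength hε₁ hε₂ h₃ hr₁ hr₂ hc₁ hc₂ e₁ e₂
    rw [← eH₃] at this
    exact (sq_sub_one_pos this).le
  rcases le_or_gt 0 η₃ with hη₃ | hη₃
  · have C31p : 0 ≤ c₁ * H₃ - c₂ := by rw [C31]; positivity
    have C32p : 0 ≤ c₂ * H₃ - c₁ := by rw [C32]; positivity
    have hα : 0 ≤ H₁ * H₃ - H₂ := by
      have h : c₂ * r₁ * η₂ ≤ c₁ * r₂ * η₁ := by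
        refine le_of_mul_le_mul_right ?_ hη₁
        have := mul_nonneg (mul_pos hc₂ hr₁).le (mul_nonneg hε₃0 hη₃)
        have := mul_nonneg (mul_pos hc₁ hr₂).le (mul_nonneg hε₂0 hε₃0)
        linarith
      have h' := mul_le_mul_of_nonneg_left h (mul_pos hc₂ hr₃).le
      have e : H₁ * H₃ - H₂ = ε₂ * r₂ ^ 2 * (c₁ * c₃) + c₂ * c₃ * (η₃ * (r₁ * r₂)) +
          (c₂ * r₃ * (c₁ * r₂ * η₁) - c₂ * r₃ * (c₂ * r₁ * η₂)) +
          ε₂ * r₂ ^ 2 * (r₁ * r₃ * η₂) + η₁ * η₃ * (r₁ * r₂ ^ 2 * r₃) := by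
        rw [eH₁, eH₂, eH₃]; linear_combination (c₁ * c₃ + r₁ * r₃ * η₂) * e₂
      rw [e]
      have := sub_nonneg.2 h'
      positivity
    have hβ : 0 ≤ H₁ * H₂ - H₃ := by
      have h : c₃ * r₁ * η₃ ≤ c₁ * r₃ * η₁ := by
        refine le_of_mul_le_mul_right ?_ hη₁
        have := mul_nonneg (mul_pos hc₃ hr₁).le (mul_nonneg hε₂0 hη₂)
        have := mul_nonneg (mul_pos hc₁ hr₃).le (mul_nonneg hε₂0 hε₃0)
        linarith
      have h' := mul_le_mul_of_nonneg_left h (mul_pos hc₃ hr₂).le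
      have e : H₁ * H₂ - H₃ = ε₃ * r₃ ^ 2 * (c₁ * c₂) + c₂ * c₃ * (η₂ * (r₁ * r₃)) +
          (c₃ * r₂ * (c₁ * r₃ * η₁) - c₃ * r₂ * (c₃ * r₁ * η₃)) +
          ε₃ * r₃ ^ 2 * (r₁ * r₂ * η₃) + η₁ * η₂ * (r₁ * r₃ ^ 2 * r₂) := by
        rw [eH₁, eH₂, eH₃]; linear_combination (c₁ * c₂ + r₁ * r₂ * η₃) * e₃
      rw [e]
      have := sub_nonneg.2 h'
      positivity
    positivity
  · obtain ⟨rfl, rfl⟩ : ε₁ = 1 ∧ ε₂ = 1 := by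
      rcases hε₁ with rfl | rfl <;> rcases hε₂ with rfl | rfl <;>
        first | exact ⟨rfl, rfl⟩ | (exfalso; linarith)
    rw [one_mul] at g₁ g₂ hG n2
    have C32p : 0 ≤ c₂ * H₃ - c₁ := by
      rw [C32]
      refine mul_nonneg hr₂.le (nonneg_of_mul_nonneg_left ?_ hG)
      have := mul_nonneg (mul_nonneg (mul_pos hc₂ hr₁).le hη₁.le) g₂
      linarith
    have hβ : 0 ≤ H₁ * H₂ - H₃ := by
      have e : H₁ * H₂ - H₃ = ε₃ * r₃ ^ 2 * (c₁ * c₂) + c₂ * c₃ * (η₂ * (r₁ * r₃)) +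
          c₁ * c₃ * (η₁ * (r₂ * r₃)) + η₁ * η₂ * (r₁ * r₃ ^ 2 * r₂) + (-η₃) * (r₁ * r₂) := by
        rw [eH₁, eH₂, eH₃]; linear_combination (c₁ * c₂) * e₃
      rw [e]
      have := neg_pos.2 hη₃
      positivity
    -- This is the only one of the six differences whose sign is still open. If it is nonnegative,
    -- every factor of the slope is; otherwise the two summands are compared by the polynomial
    -- inequality in the ratios `c / r`.
    rcases le_or_gt 0 (c₁ * H₃ - c₂) with C31p | C31n
    · have hα : 0 ≤ H₁ * H₃ - H₂ := by
        have h : η₂ * (r₁ * c₂) ≤ η₁ * (r₂ * c₁) := by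
          refine le_of_mul_le_mul_right ?_ hG
          have := mul_nonneg (mul_nonneg (mul_pos hc₂ hr₁).le hε₃0) g₂
          have := mul_le_mul_of_nonneg_left n2 hη₁.le
          linarith
        have h' := mul_le_mul_of_nonneg_left h (mul_pos hc₂ hr₃).le
        have e : H₁ * H₃ - H₂ = c₃ * (c₂ * H₃ - c₁) +
            (c₂ * r₃ * (η₁ * (r₂ * c₁)) - c₂ * r₃ * (η₂ * (r₁ * c₂))) +
            r₂ ^ 2 * (r₁ * r₃) * (η₂ + η₃ * η₁) := by
          rw [eH₁, eH₂, eH₃]; linear_combination (r₁ * r₃ * η₂) * e₂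
        rw [e]
        have := sub_nonneg.2 h'
        positivity
      positivity
    · obtain ⟨k₁, rfl⟩ : ∃ k₁, c₁ = k₁ * r₁ := ⟨c₁ / r₁, by field_simp⟩
      obtain ⟨k₂, rfl⟩ : ∃ k₂, c₂ = k₂ * r₂ := ⟨c₂ / r₂, by field_simp⟩
      obtain ⟨k₃, rfl⟩ : ∃ k₃, c₃ = k₃ * r₃ := ⟨c₃ / r₃, by field_simp⟩
      have hk₂ : 0 < k₂ := pos_of_mul_pos_left hc₂ hr₂.le
      have hk₃ : 0 < k₃ := pos_of_mul_pos_left hc₃ hr₃.le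
      have f₁ : 1 = (k₁ ^ 2 - 1) * r₁ ^ 2 := by linear_combination -e₁
      have f₂ : 1 = (k₂ ^ 2 - 1) * r₂ ^ 2 := by linear_combination -e₂
      have f₃ : 1 = (k₃ ^ 2 - ε₃) * r₃ ^ 2 := by linear_combination -e₃
      have hk₂' : 1 ≤ k₂ := by
        have : 0 < (k₂ ^ 2 - 1) * r₂ ^ 2 := by linarith
        exact le_of_sq_sub_pos (.inr rfl) hk₂ (pos_of_mul_pos_left this (sq_nonneg r₂))
      have hk₃' : ε₃ ≤ k₃ := by
        have : 0 < (k₃ ^ 2 - ε₃) * r₃ ^ 2 := by linarith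
        exact le_of_sq_sub_pos hε₃ hk₃ (pos_of_mul_pos_left this (sq_nonneg r₃))
      have hk : k₂ ≤ -η₃ * k₁ := by
        rw [C31] at C31n
        have h1 : r₁ ^ 2 * r₂ * (k₂ + η₃ * k₁) < 0 := by linarith
        have h2 : k₂ + η₃ * k₁ < 0 := neg_of_mul_neg_right h1 (by positivity)
        linarith
      have key := slope_nonneg_of_neg_weight (e := ε₃) (a := -η₃) (b := η₂) (d := η₁) hε₃
        (by linarith) (by linarith) (by linarith) (by linarith) (by linarith) hk₂' hk₃ hk₃' hk
      have S₃ : H₃ ^ 2 - 1 = (r₁ * r₂) ^ 2 *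
          (k₁ ^ 2 + k₂ ^ 2 - 2 * (-η₃) * k₁ * k₂ + (-η₃) ^ 2 - 1) := by
        rw [eH₃]; linear_combination -f₁ - (k₁ ^ 2 - 1) * r₁ ^ 2 * f₂
      have S₂ : H₂ ^ 2 - 1 = (r₁ * r₃) ^ 2 *
          (2 * η₂ * k₁ * k₃ + η₂ ^ 2 + ε₃ * k₁ ^ 2 + k₃ ^ 2 - ε₃) := by
        rw [eH₂]; linear_combination -f₁ - (k₁ ^ 2 - 1) * r₁ ^ 2 * f₃
      have eβ : H₁ * H₂ - H₃ = r₁ * r₂ * r₃ ^ 2 *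
          (ε₃ * k₁ * k₂ + k₃ * (η₂ * k₂ + η₁ * k₁) + η₂ * η₁ + -η₃ * (k₃ ^ 2 - ε₃)) := by
        rw [eH₁, eH₂, eH₃]; linear_combination (-k₁ * k₂ - η₃) * (r₁ * r₂) * f₃
      have eα : H₁ * H₃ - H₂ = r₁ * r₂ ^ 2 * r₃ *
          (k₃ * (k₁ - -η₃ * k₂) + η₁ * k₁ * k₂ - η₂ * k₂ ^ 2 + η₂ - -η₃ * η₁) := by
        rw [eH₁, eH₂, eH₃]; linear_combination (-k₁ * k₃ - η₂) * (r₁ * r₃) * f₂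
      rw [C12, C13, C21, C23, C31, C32, S₂, S₃, eα, eβ]
      have hp : 0 < r₁ ^ 4 * r₂ ^ 3 * r₃ ^ 3 := by positivity
      refine (mul_nonneg hp.le key).trans_eq ?_
      ring

end

/-! ### Positive definiteness of the hyperbolic form from the signs of the heights. -/

section

/-- Each block is definite in its two variables because `H > 1`. The hypotheses `z₁`, `z₂`, `z₃`
leave at least two positive weights, and two blocks involve all three variables. -/
theorem blockForm_pos_of_nonneg {H₁ H₂ H₃ w₁ w₂ w₃ x₁ x₂ x₃ : ℝ} (hH₁ : 1 < H₁) (hH₂ : 1 < H₂)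
    (hH₃ : 1 < H₃) (hw₁ : 0 ≤ w₁) (hw₂ : 0 ≤ w₂) (hw₃ : 0 ≤ w₃) (z₁ : w₁ = 0 → 0 < w₂)
    (z₂ : w₂ = 0 → 0 < w₃) (z₃ : w₃ = 0 → 0 < w₁) (hx : ¬ (x₁ = 0 ∧ x₂ = 0 ∧ x₃ = 0)) :
    0 < w₁ * (H₁ * (x₂ ^ 2 + x₃ ^ 2) - 2 * x₂ * x₃) + w₂ * (H₂ * (x₃ ^ 2 + x₁ ^ 2) - 2 * x₃ * x₁) +
      w₃ * (H₃ * (x₁ ^ 2 + x₂ ^ 2) - 2 * x₁ * x₂) := by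
  have b₁ := block_nonneg x₂ x₃ hH₁ hw₁
  have b₂ := block_nonneg x₃ x₁ hH₂ hw₂
  have b₃ := block_nonneg x₁ x₂ hH₃ hw₃
  by_contra! hle
  have p₁ : 0 < w₁ → x₂ = 0 ∧ x₃ = 0 := fun h => by
    by_contra hne
    linarith [block_pos hH₁ h (not_and_or.1 hne)]
  have p₂ : 0 < w₂ → x₃ = 0 ∧ x₁ = 0 := fun h => by
    by_contra hne
    linarith [block_pos hH₂ h (not_and_or.1 hne)]
  have p₃ : 0 < w₃ → x₁ = 0 ∧ x₂ = 0 := fun h => by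
    by_contra hne
    linarith [block_pos hH₃ h (not_and_or.1 hne)]
  rcases hw₁.eq_or_lt' with h | h
  · have h₂ := z₁ h
    have h₃ : 0 < w₃ := hw₃.lt_of_ne fun e => (z₃ e.symm).ne' h
    exact hx ⟨(p₃ h₃).1, (p₃ h₃).2, (p₂ h₂).1⟩
  · rcases hw₂.eq_or_lt' with h' | h'
    · exact hx ⟨(p₃ (z₂ h')).1, p₁ h⟩
    · exact hx ⟨(p₂ h').2, p₁ h⟩

/-- For the weights `n / (H ^ 2 - 1)` the left side is the determinant of the block form, cleared of
denominators. The factors on the right are the squared Gram determinant and the sum covered by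
`cyclic_product_pos`. -/
theorem hypHeight_det_identity (c₁ c₂ c₃ H₁ H₂ H₃ n₁ n₂ n₃ : ℝ)
    (h₁ : n₁ = hypHeight c₁ c₂ c₃ H₁ H₂ H₃) (h₂ : n₂ = hypHeight c₂ c₃ c₁ H₂ H₃ H₁)
    (h₃ : n₃ = hypHeight c₃ c₁ c₂ H₃ H₁ H₂) :
    2 * n₁ * n₂ * n₃ * (H₁ * H₂ * H₃ - 1) +
        n₁ ^ 2 * (n₂ * H₂ * (H₃ ^ 2 - 1) + n₃ * H₃ * (H₂ ^ 2 - 1)) +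
        n₂ ^ 2 * (n₃ * H₃ * (H₁ ^ 2 - 1) + n₁ * H₁ * (H₃ ^ 2 - 1)) +
        n₃ ^ 2 * (n₁ * H₁ * (H₂ ^ 2 - 1) + n₂ * H₂ * (H₁ ^ 2 - 1)) =
      (1 + 2 * H₁ * H₂ * H₃ - H₁ ^ 2 - H₂ ^ 2 - H₃ ^ 2) ^ 2 *
        ((c₂ * H₁ - c₃) * (c₃ * H₂ - c₁) * (c₁ * H₃ - c₂) +
          (c₃ * H₁ - c₂) * (c₁ * H₂ - c₃) * (c₂ * H₃ - c₁)) := by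
  subst h₁ h₂ h₃
  simp only [hypHeight]
  ring

/-- The analogous factorization of the derivative of that determinant in the first weight, with the
expression of `hypSlope_nonneg` as cofactor. -/
theorem hypHeight_slope_identity (c₁ c₂ c₃ H₁ H₂ H₃ n₁ n₂ n₃ : ℝ)
    (h₁ : n₁ = hypHeight c₁ c₂ c₃ H₁ H₂ H₃) (h₂ : n₂ = hypHeight c₂ c₃ c₁ H₂ H₃ H₁)
    (h₃ : n₃ = hypHeight c₃ c₁ c₂ H₃ H₁ H₂) :
    2 * n₂ * n₃ * (H₁ * H₂ * H₃ - 1) +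
        2 * n₁ * (n₂ * H₂ * (H₃ ^ 2 - 1) + n₃ * H₃ * (H₂ ^ 2 - 1)) +
        H₁ * (n₂ ^ 2 * (H₃ ^ 2 - 1) + n₃ ^ 2 * (H₂ ^ 2 - 1)) =
      (1 + 2 * H₁ * H₂ * H₃ - H₁ ^ 2 - H₂ ^ 2 - H₃ ^ 2) *
        ((c₁ * H₂ - c₃) * ((c₃ * H₁ - c₂) * (H₃ ^ 2 - 1) + (H₁ * H₂ - H₃) * (c₂ * H₃ - c₁)) +
      (c₁ * H₃ - c₂) * ((c₂ * H₁ - c₃) * (H₂ ^ 2 - 1) + (H₁ * H₃ - H₂) * (c₃ * H₂ - c₁))) := by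
  subst h₁ h₂ h₃
  simp only [hypHeight]
  ring

section

variable {ε₁ ε₂ ε₃ η₁ η₂ η₃ r₁ r₂ r₃ c₁ c₂ c₃ H₁ H₂ H₃ x₁ x₂ x₃ : ℝ}

theorem hypForm_pos_of_neg
    (hε₁ : ε₁ = 0 ∨ ε₁ = 1) (hε₂ : ε₂ = 0 ∨ ε₂ = 1) (hε₃ : ε₃ = 0 ∨ ε₃ = 1)
    (h₁ : 0 < ε₂ * ε₃ + η₁) (h₂ : 0 < ε₃ * ε₁ + η₂) (h₃ : 0 < ε₁ * ε₂ + η₃)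
    (g₁ : 0 ≤ ε₁ * η₁ + η₂ * η₃) (g₂ : 0 ≤ ε₂ * η₂ + η₃ * η₁) (g₃ : 0 ≤ ε₃ * η₃ + η₁ * η₂)
    (hr₁ : 0 < r₁) (hr₂ : 0 < r₂) (hr₃ : 0 < r₃) (hc₁ : 0 < c₁) (hc₂ : 0 < c₂) (hc₃ : 0 < c₃)
    (e₁ : c₁ ^ 2 = 1 + ε₁ * r₁ ^ 2) (e₂ : c₂ ^ 2 = 1 + ε₂ * r₂ ^ 2)
    (e₃ : c₃ ^ 2 = 1 + ε₃ * r₃ ^ 2) (eH₁ : H₁ = c₂ * c₃ + η₁ * (r₂ * r₃))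
    (eH₂ : H₂ = c₃ * c₁ + η₂ * (r₃ * r₁)) (eH₃ : H₃ = c₁ * c₂ + η₃ * (r₁ * r₂))
    (hΔ : 0 < 1 + 2 * H₁ * H₂ * H₃ - H₁ ^ 2 - H₂ ^ 2 - H₃ ^ 2)
    (hx : ¬ (x₁ = 0 ∧ x₂ = 0 ∧ x₃ = 0)) (hn : hypHeight c₁ c₂ c₃ H₁ H₂ H₃ < 0) :
    0 < hypHeight c₁ c₂ c₃ H₁ H₂ H₃ / (H₁ ^ 2 - 1) * (H₁ * (x₂ ^ 2 + x₃ ^ 2) - 2 * x₂ * x₃) +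
      hypHeight c₂ c₃ c₁ H₂ H₃ H₁ / (H₂ ^ 2 - 1) * (H₂ * (x₃ ^ 2 + x₁ ^ 2) - 2 * x₃ * x₁) +
      hypHeight c₃ c₁ c₂ H₃ H₁ H₂ / (H₃ ^ 2 - 1) * (H₃ * (x₁ ^ 2 + x₂ ^ 2) - 2 * x₁ * x₂) := by
  have hH₁ : 1 < H₁ := eH₁ ▸ one_lt_coshLength hε₂ hε₃ h₁ hr₂ hr₃ hc₂ hc₃ e₂ e₃
  have hH₂ : 1 < H₂ := eH₂ ▸ one_lt_coshLength hε₃ hε₁ h₂ hr₃ hr₁ hc₃ hc₁ e₃ e₁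
  have hH₃ : 1 < H₃ := eH₃ ▸ one_lt_coshLength hε₁ hε₂ h₃ hr₁ hr₂ hc₁ hc₂ e₁ e₂
  have hn₂ : 0 < hypHeight c₂ c₃ c₁ H₂ H₃ H₁ := by
    subst eH₁ eH₂ eH₃
    exact hypHeight_pos_of_nonpos hε₁ hε₂ hε₃ h₁ h₂ h₃ g₁ g₂ g₃ hr₁ hr₂ hr₃ hc₁ hc₂ hc₃ e₁ e₂ e₃
      hn.le
  have hn₃ : 0 < hypHeight c₃ c₁ c₂ H₃ H₁ H₂ := by
    by_contra! h
    refine hn.not_gt ?_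
    subst eH₁ eH₂ eH₃
    exact hypHeight_pos_of_nonpos hε₃ hε₁ hε₂ h₃ h₁ h₂ g₃ g₁ g₂ hr₃ hr₁ hr₂ hc₃ hc₁ hc₂ e₃ e₁ e₂ h
  have hslope : 0 ≤ (c₁ * H₂ - c₃) *
        ((c₃ * H₁ - c₂) * (H₃ ^ 2 - 1) + (H₁ * H₂ - H₃) * (c₂ * H₃ - c₁)) +
      (c₁ * H₃ - c₂) * ((c₂ * H₁ - c₃) * (H₂ ^ 2 - 1) + (H₁ * H₃ - H₂) * (c₃ * H₂ - c₁)) := by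
    -- `η₂` and `η₃` cannot both be negative, so `hypSlope_nonneg` applies directly or after
    -- exchanging the vertices 2 and 3.
    rcases le_or_gt 0 η₂ with hη₂ | hη₂
    · exact hypSlope_nonneg hε₁ hε₂ hε₃ h₁ h₃ g₁ g₂ g₃ hr₁ hr₂ hr₃ hc₁ hc₂ hc₃ e₁ e₂ e₃
        eH₁ eH₂ eH₃ hn hη₂
    · have hη₁ : 0 < η₁ := by
        refine weight_pos hε₂ hε₃ h₁ ?_
        rw [eH₁, eH₂, eH₃, hypHeight_eq e₂ e₃] at hn
        have t2 : 0 ≤ c₂ * (r₁ * r₂ * r₃ ^ 2) * (ε₃ * η₃ + η₁ * η₂) := by positivity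
        have t3 : 0 ≤ c₃ * (r₁ * r₂ ^ 2 * r₃) * (ε₂ * η₂ + η₃ * η₁) := by positivity
        have h : 0 < c₁ * (r₂ * r₃) ^ 2 * (η₁ ^ 2 - ε₂ * ε₃) := by linarith
        exact (mul_pos_iff_of_pos_left (by positivity)).1 h
      have hη₃ : 0 ≤ η₃ := by
        refine nonneg_of_mul_nonneg_left (b := η₁) ?_ hη₁
        have : ε₂ * η₂ ≤ 0 := by rcases hε₂ with rfl | rfl <;> linarith
        linarith
      have := hypSlope_nonneg (ε₁ := ε₁) (ε₂ := ε₃) (ε₃ := ε₂) (η₁ := η₁) (η₂ := η₃) (η₃ := η₂)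
        (H₁ := H₁) (H₂ := H₃) (H₃ := H₂) hε₁ hε₃ hε₂ (by rwa [mul_comm ε₃]) (by rwa [mul_comm ε₁])
        (by rwa [mul_comm η₃]) (by rwa [mul_comm η₂]) (by rwa [mul_comm η₁])
        hr₁ hr₃ hr₂ hc₁ hc₃ hc₂ e₁ e₃ e₂ (by rw [eH₁]; ring) (by rw [eH₃]; ring)
        (by rw [eH₂]; ring) (hn.trans_eq' (by simp only [hypHeight]; ring)) hη₃
      linarith
  have hdet : 0 < (c₂ * H₁ - c₃) * (c₃ * H₂ - c₁) * (c₁ * H₃ - c₂) +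
      (c₃ * H₁ - c₂) * (c₁ * H₂ - c₃) * (c₂ * H₃ - c₁) := by
    have C12 : c₂ * H₁ - c₃ = r₂ * (ε₂ * r₂ * c₃ + η₁ * r₃ * c₂) := by
      rw [eH₁]; linear_combination c₃ * e₂
    have C13 : c₃ * H₁ - c₂ = r₃ * (ε₃ * r₃ * c₂ + η₁ * r₂ * c₃) := by
      rw [eH₁]; linear_combination c₂ * e₃
    have C23 : c₃ * H₂ - c₁ = r₃ * (ε₃ * r₃ * c₁ + η₂ * r₁ * c₃) := by
      rw [eH₂]; linear_combination c₁ * e₃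
    have C21 : c₁ * H₂ - c₃ = r₁ * (ε₁ * r₁ * c₃ + η₂ * r₃ * c₁) := by
      rw [eH₂]; linear_combination c₃ * e₁
    have C31 : c₁ * H₃ - c₂ = r₁ * (ε₁ * r₁ * c₂ + η₃ * r₂ * c₁) := by
      rw [eH₃]; linear_combination c₂ * e₁
    have C32 : c₂ * H₃ - c₁ = r₂ * (ε₂ * r₂ * c₁ + η₃ * r₁ * c₂) := by
      rw [eH₃]; linear_combination c₁ * e₂
    -- Dividing each difference by its `r` and by the two `c` of its edge leaves a factor of the
    -- cyclic product at `aᵢ = rᵢ / cᵢ`.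
    have h := cyclic_product_pos hε₁ hε₂ hε₃ h₁ h₂ h₃ g₁ g₂ g₃ (div_pos hr₁ hc₁)
      (div_pos hr₂ hc₂) (div_pos hr₃ hc₃)
    have hp : 0 < r₁ * r₂ * r₃ * (c₁ * c₂ * c₃) ^ 2 := by positivity
    refine (mul_pos hp h).trans_eq ?_
    rw [C12, C13, C21, C23, C31, C32]
    field_simp
  have hS₁ := sq_sub_one_pos hH₁
  have hS₂ := sq_sub_one_pos hH₂
  have hS₃ := sq_sub_one_pos hH₃
  have i₁ := hypHeight_det_identity c₁ c₂ c₃ H₁ H₂ H₃ _ _ _ rfl rfl rfl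
  have i₂ := hypHeight_slope_identity c₁ c₂ c₃ H₁ H₂ H₃ _ _ _ rfl rfl rfl
  generalize hypHeight c₁ c₂ c₃ H₁ H₂ H₃ = n₁ at *
  generalize hypHeight c₂ c₃ c₁ H₂ H₃ H₁ = n₂ at *
  generalize hypHeight c₃ c₁ c₂ H₃ H₁ H₂ = n₃ at *
  refine blockForm_pos_of_det_pos hH₁ hH₂ hH₃ (by positivity) (by positivity) ?_ ?_ hx
  · have hp : 0 < (H₁ ^ 2 - 1) * (H₂ ^ 2 - 1) * (H₃ ^ 2 - 1) := by positivity
    have := div_pos (mul_pos (pow_pos hΔ 2) hdet) hp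
    rw [← i₁] at this
    refine this.trans_eq ?_
    field_simp
  · have hp : 0 < (H₂ ^ 2 - 1) * (H₃ ^ 2 - 1) := by positivity
    have := div_nonneg (mul_nonneg hΔ.le hslope) hp.le
    rw [← i₂] at this
    refine this.trans_eq ?_
    field_simp

/-- The quadratic form of the derivative of the angles of a hyperbolic triangle is definite. -/
theorem hypForm_pos
    (hε₁ : ε₁ = 0 ∨ ε₁ = 1) (hε₂ : ε₂ = 0 ∨ ε₂ = 1) (hε₃ : ε₃ = 0 ∨ ε₃ = 1)
    (h₁ : 0 < ε₂ * ε₃ + η₁) (h₂ : 0 < ε₃ * ε₁ + η₂) (h₃ : 0 < ε₁ * ε₂ + η₃)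
    (g₁ : 0 ≤ ε₁ * η₁ + η₂ * η₃) (g₂ : 0 ≤ ε₂ * η₂ + η₃ * η₁) (g₃ : 0 ≤ ε₃ * η₃ + η₁ * η₂)
    (hr₁ : 0 < r₁) (hr₂ : 0 < r₂) (hr₃ : 0 < r₃) (hc₁ : 0 < c₁) (hc₂ : 0 < c₂) (hc₃ : 0 < c₃)
    (e₁ : c₁ ^ 2 = 1 + ε₁ * r₁ ^ 2) (e₂ : c₂ ^ 2 = 1 + ε₂ * r₂ ^ 2)
    (e₃ : c₃ ^ 2 = 1 + ε₃ * r₃ ^ 2) (eH₁ : H₁ = c₂ * c₃ + η₁ * (r₂ * r₃))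
    (eH₂ : H₂ = c₃ * c₁ + η₂ * (r₃ * r₁)) (eH₃ : H₃ = c₁ * c₂ + η₃ * (r₁ * r₂))
    (hΔ : 0 < 1 + 2 * H₁ * H₂ * H₃ - H₁ ^ 2 - H₂ ^ 2 - H₃ ^ 2)
    (hx : ¬ (x₁ = 0 ∧ x₂ = 0 ∧ x₃ = 0)) :
    0 < hypHeight c₁ c₂ c₃ H₁ H₂ H₃ / (H₁ ^ 2 - 1) * (H₁ * (x₂ ^ 2 + x₃ ^ 2) - 2 * x₂ * x₃) +
      hypHeight c₂ c₃ c₁ H₂ H₃ H₁ / (H₂ ^ 2 - 1) * (H₂ * (x₃ ^ 2 + x₁ ^ 2) - 2 * x₃ * x₁) +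
      hypHeight c₃ c₁ c₂ H₃ H₁ H₂ / (H₃ ^ 2 - 1) * (H₃ * (x₁ ^ 2 + x₂ ^ 2) - 2 * x₁ * x₂) := by
  rcases lt_or_ge (hypHeight c₁ c₂ c₃ H₁ H₂ H₃) 0 with hn₁ | hn₁
  · exact hypForm_pos_of_neg hε₁ hε₂ hε₃ h₁ h₂ h₃ g₁ g₂ g₃ hr₁ hr₂ hr₃ hc₁ hc₂ hc₃ e₁ e₂ e₃
      eH₁ eH₂ eH₃ hΔ hx hn₁
  rcases lt_or_ge (hypHeight c₂ c₃ c₁ H₂ H₃ H₁) 0 with hn₂ | hn₂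
  · have := hypForm_pos_of_neg (x₁ := x₂) (x₂ := x₃) (x₃ := x₁) hε₂ hε₃ hε₁ h₂ h₃ h₁ g₂ g₃ g₁
      hr₂ hr₃ hr₁ hc₂ hc₃ hc₁ e₂ e₃ e₁ eH₂ eH₃ eH₁ (by linarith) (by tauto) hn₂
    linarith
  rcases lt_or_ge (hypHeight c₃ c₁ c₂ H₃ H₁ H₂) 0 with hn₃ | hn₃
  · have := hypForm_pos_of_neg (x₁ := x₃) (x₂ := x₁) (x₃ := x₂) hε₃ hε₁ hε₂ h₃ h₁ h₂ g₃ g₁ g₂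
      hr₃ hr₁ hr₂ hc₃ hc₁ hc₂ e₃ e₁ e₂ eH₃ eH₁ eH₂ (by linarith) (by tauto) hn₃
    linarith
  have hH₁ : 1 < H₁ := eH₁ ▸ one_lt_coshLength hε₂ hε₃ h₁ hr₂ hr₃ hc₂ hc₃ e₂ e₃
  have hH₂ : 1 < H₂ := eH₂ ▸ one_lt_coshLength hε₃ hε₁ h₂ hr₃ hr₁ hc₃ hc₁ e₃ e₁
  have hH₃ : 1 < H₃ := eH₃ ▸ one_lt_coshLength hε₁ hε₂ h₃ hr₁ hr₂ hc₁ hc₂ e₁ e₂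
  have z₁ : hypHeight c₁ c₂ c₃ H₁ H₂ H₃ = 0 → 0 < hypHeight c₂ c₃ c₁ H₂ H₃ H₁ := by
    subst eH₁ eH₂ eH₃
    exact fun h => hypHeight_pos_of_nonpos hε₁ hε₂ hε₃ h₁ h₂ h₃ g₁ g₂ g₃ hr₁ hr₂ hr₃ hc₁ hc₂ hc₃
      e₁ e₂ e₃ h.le
  have z₂ : hypHeight c₂ c₃ c₁ H₂ H₃ H₁ = 0 → 0 < hypHeight c₃ c₁ c₂ H₃ H₁ H₂ := by
    subst eH₁ eH₂ eH₃
    exact fun h => hypHeight_pos_of_nonpos hε₂ hε₃ hε₁ h₂ h₃ h₁ g₂ g₃ g₁ hr₂ hr₃ hr₁ hc₂ hc₃ hc₁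
      e₂ e₃ e₁ h.le
  have z₃ : hypHeight c₃ c₁ c₂ H₃ H₁ H₂ = 0 → 0 < hypHeight c₁ c₂ c₃ H₁ H₂ H₃ := by
    subst eH₁ eH₂ eH₃
    exact fun h => hypHeight_pos_of_nonpos hε₃ hε₁ hε₂ h₃ h₁ h₂ g₃ g₁ g₂ hr₃ hr₁ hr₂ hc₃ hc₁ hc₂
      e₃ e₁ e₂ h.le
  have hS₁ := sq_sub_one_pos hH₁
  have hS₂ := sq_sub_one_pos hH₂
  have hS₃ := sq_sub_one_pos hH₃
  refine blockForm_pos_of_nonneg hH₁ hH₂ hH₃ (div_nonneg hn₁ hS₁.le) (div_nonneg hn₂ hS₂.le)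
    (div_nonneg hn₃ hS₃.le) (fun h => div_pos (z₁ ?_) hS₂) (fun h => div_pos (z₂ ?_) hS₃)
    (fun h => div_pos (z₃ ?_) hS₁) hx
  · exact (div_eq_zero_iff.1 h).resolve_right hS₁.ne'
  · exact (div_eq_zero_iff.1 h).resolve_right hS₂.ne'
  · exact (div_eq_zero_iff.1 h).resolve_right hS₃.ne'

end

end

/-! ### The quadratic form of a Euclidean triangle -/

/-- In the differences from `x₃` this is a binary form whose determinant is the expression in `hw`,
hence definite. It is not negative definite: the sum in `hws` is its trace against the Gram matrix
of a triangle with squared sides `s`, which is positive semidefinite by `hΔ`. -/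
theorem laplaceForm_pos {w₁ w₂ w₃ s₁ s₂ s₃ x₁ x₂ x₃ : ℝ} (hs₁ : 0 < s₁) (hs₂ : 0 < s₂)
    (hΔ : (s₁ + s₂ - s₃) ^ 2 ≤ 4 * s₁ * s₂) (hw : 0 < w₁ * w₂ + w₂ * w₃ + w₃ * w₁)
    (hws : 0 < w₁ * s₁ + w₂ * s₂ + w₃ * s₃) (hx : ¬ (x₁ = x₃ ∧ x₂ = x₃)) :
    0 < w₁ * (x₂ - x₃) ^ 2 + w₂ * (x₃ - x₁) ^ 2 + w₃ * (x₁ - x₂) ^ 2 := by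
  have hp : 0 < w₂ + w₃ := by
    by_contra! hp
    have hdet : w₃ ^ 2 < (w₂ + w₃) * (w₁ + w₃) := by linarith
    have hp' : w₂ + w₃ < 0 := by
      refine lt_of_le_of_ne hp fun h => ?_
      rw [h] at hdet
      nlinarith
    have hq : w₁ + w₃ < 0 := by
      by_contra! hq
      nlinarith [mul_nonneg_of_nonpos_of_nonpos hp (neg_nonpos.2 hq)]
    have h1 : (w₃ * (s₁ + s₂ - s₃)) ^ 2 ≤ ((w₂ + w₃) * s₂ + (w₁ + w₃) * s₁) ^ 2 := by
      calc (w₃ * (s₁ + s₂ - s₃)) ^ 2 = w₃ ^ 2 * (s₁ + s₂ - s₃) ^ 2 := by ring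
        _ ≤ ((w₂ + w₃) * (w₁ + w₃)) * (4 * s₁ * s₂) :=
          mul_le_mul hdet.le hΔ (sq_nonneg _) ((sq_nonneg _).trans hdet.le)
        _ ≤ ((w₂ + w₃) * s₂ + (w₁ + w₃) * s₁) ^ 2 := by
          nlinarith [sq_nonneg ((w₂ + w₃) * s₂ - (w₁ + w₃) * s₁)]
    have h2 : 0 < -((w₂ + w₃) * s₂ + (w₁ + w₃) * s₁) := by
      nlinarith [mul_pos (neg_pos.2 hp') hs₂, mul_pos (neg_pos.2 hq) hs₁]
    have h3 := abs_le_of_sq_le_sq (h1.trans_eq (neg_sq _).symm) h2.le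
    linarith [(abs_le.1 h3).1]
  have e : (w₂ + w₃) * (w₁ * (x₂ - x₃) ^ 2 + w₂ * (x₃ - x₁) ^ 2 + w₃ * (x₁ - x₂) ^ 2) =
      ((w₂ + w₃) * (x₁ - x₃) - w₃ * (x₂ - x₃)) ^ 2 +
        (w₁ * w₂ + w₂ * w₃ + w₃ * w₁) * (x₂ - x₃) ^ 2 := by ring
  refine (mul_pos_iff_of_pos_left hp).1 ?_
  rw [e]
  by_cases h : x₂ - x₃ = 0
  · have h' : x₁ - x₃ ≠ 0 := fun h' => hx ⟨sub_eq_zero.1 h', sub_eq_zero.1 h⟩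
    rw [h]
    have : (w₂ + w₃) * (x₁ - x₃) - w₃ * 0 ≠ 0 := by simp [hp.ne', h']
    positivity
  · positivity

/-- Numerator of the derivative of an angle of a Euclidean triangle. -/
noncomputable def eucHeight (s₁ s₂ s₃ a b : ℝ) : ℝ := s₃ * a - (s₁ + s₃ - s₂) / 2 * b

/-- For these weights `∑ wᵢ sᵢ` is exactly the area expression in `hΔ`, and `∑ wᵢ wⱼ` is that
expression times the cyclic product sum divided by `s₁ s₂ s₃`. -/
theorem eucForm_pos {ε₁ ε₂ ε₃ η₁ η₂ η₃ r₁ r₂ r₃ s₁ s₂ s₃ x₁ x₂ x₃ : ℝ}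
    (hε₁ : ε₁ = 0 ∨ ε₁ = 1) (hε₂ : ε₂ = 0 ∨ ε₂ = 1) (hε₃ : ε₃ = 0 ∨ ε₃ = 1)
    (h₁ : 0 < ε₂ * ε₃ + η₁) (h₂ : 0 < ε₃ * ε₁ + η₂) (h₃ : 0 < ε₁ * ε₂ + η₃)
    (g₁ : 0 ≤ ε₁ * η₁ + η₂ * η₃) (g₂ : 0 ≤ ε₂ * η₂ + η₃ * η₁) (g₃ : 0 ≤ ε₃ * η₃ + η₁ * η₂)
    (hr₁ : 0 < r₁) (hr₂ : 0 < r₂) (hr₃ : 0 < r₃) (hs₁ : 0 < s₁) (hs₂ : 0 < s₂) (hs₃ : 0 < s₃)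
    (e₁ : s₁ = ε₂ * r₂ ^ 2 + ε₃ * r₃ ^ 2 + 2 * η₁ * (r₂ * r₃))
    (e₂ : s₂ = ε₃ * r₃ ^ 2 + ε₁ * r₁ ^ 2 + 2 * η₂ * (r₃ * r₁))
    (e₃ : s₃ = ε₁ * r₁ ^ 2 + ε₂ * r₂ ^ 2 + 2 * η₃ * (r₁ * r₂))
    (hΔ : 0 < s₁ * s₂ - ((s₁ + s₂ - s₃) / 2) ^ 2) (hx : ¬ (x₁ = x₃ ∧ x₂ = x₃)) :
    0 < eucHeight s₂ s₃ s₁ (ε₃ * r₃ ^ 2 + η₂ * (r₃ * r₁)) (ε₃ * r₃ ^ 2 + η₁ * (r₂ * r₃)) / s₁ *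
        (x₂ - x₃) ^ 2 +
      eucHeight s₃ s₁ s₂ (ε₁ * r₁ ^ 2 + η₃ * (r₁ * r₂)) (ε₁ * r₁ ^ 2 + η₂ * (r₃ * r₁)) / s₂ *
        (x₃ - x₁) ^ 2 +
      eucHeight s₁ s₂ s₃ (ε₂ * r₂ ^ 2 + η₁ * (r₂ * r₃)) (ε₂ * r₂ ^ 2 + η₃ * (r₁ * r₂)) / s₃ *
        (x₁ - x₂) ^ 2 := by
  have hdet : 0 < (ε₂ * r₂ ^ 2 + η₁ * (r₂ * r₃)) * (ε₃ * r₃ ^ 2 + η₂ * (r₃ * r₁)) *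
      (ε₁ * r₁ ^ 2 + η₃ * (r₁ * r₂)) + (ε₃ * r₃ ^ 2 + η₁ * (r₂ * r₃)) *
      (ε₁ * r₁ ^ 2 + η₂ * (r₃ * r₁)) * (ε₂ * r₂ ^ 2 + η₃ * (r₁ * r₂)) := by
    have h := cyclic_product_pos hε₁ hε₂ hε₃ h₁ h₂ h₃ g₁ g₂ g₃ hr₁ hr₂ hr₃
    have hp : 0 < r₁ * r₂ * r₃ := by positivity
    refine (mul_pos hp h).trans_eq ?_
    ring
  generalize ε₁ * r₁ ^ 2 = d₁ at *
  generalize ε₂ * r₂ ^ 2 = d₂ at *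
  generalize ε₃ * r₃ ^ 2 = d₃ at *
  rw [mul_assoc] at e₁ e₂ e₃
  generalize η₁ * (r₂ * r₃) = y₁ at *
  generalize η₂ * (r₃ * r₁) = y₂ at *
  generalize η₃ * (r₁ * r₂) = y₃ at *
  refine laplaceForm_pos (s₃ := s₃) hs₁ hs₂ (by linarith) ?_ ?_ hx
  · have hp : 0 < s₁ * s₂ * s₃ := by positivity
    refine (div_pos (mul_pos hΔ hdet) hp).trans_eq ?_
    simp only [eucHeight]
    field_simp
    rw [e₁, e₂, e₃]
    ring
  · refine hΔ.trans_eq ?_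
    simp only [eucHeight]
    field_simp
    rw [e₁, e₂, e₃]
    ring

/-! ### Derivatives of angles -/

/-- With the law of cosines written as `N / √P`, the difference `P - N ^ 2` is symmetric in the
three sides, so the derivatives of the three angles share one denominator. -/
theorem hasDerivAt_arccos_div_sqrt {N P : ℝ → ℝ} {N' P' t : ℝ} (hN : HasDerivAt N N' t)
    (hP : HasDerivAt P P' t) (h : N t ^ 2 < P t) :
    HasDerivAt (fun s => arccos (N s / √(P s)))
      (-(N' - N t * (P' / (2 * P t))) / √(P t - N t ^ 2)) t := by
  have hP0 : 0 < P t := (sq_nonneg _).trans_lt h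
  have hs : 0 < √(P t) := sqrt_pos.2 hP0
  have hlt : (N t / √(P t)) ^ 2 < 1 := by
    rw [div_pow, sq_sqrt hP0.le, div_lt_one hP0]; exact h
  have hne : N t / √(P t) ≠ -1 ∧ N t / √(P t) ≠ 1 := by
    constructor <;> intro h' <;> rw [h'] at hlt <;> norm_num at hlt
  have := (hasDerivAt_arccos hne.1 hne.2).comp t (hN.div (hP.sqrt hP0.ne') hs.ne')
  refine this.congr_deriv ?_
  have e : √(1 - (N t / √(P t)) ^ 2) = √(P t - N t ^ 2) / √(P t) := by
    rw [← sqrt_div' _ hP0.le, div_pow, sq_sqrt hP0.le]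
    congr 1; field_simp
  have hd : 0 < √(P t - N t ^ 2) := sqrt_pos.2 (sub_pos.2 h)
  rw [e]
  have h2 : √(P t) ^ 2 = P t := sq_sqrt hP0.le
  generalize √(P t) = q at *
  rw [← h2]
  field_simp

/-! ### Triangles -/

theorem IsTriangle.rotate {a b c : ℝ} (h : IsTriangle a b c) : IsTriangle b c a :=
  ⟨⟨h.1.2.1, h.1.2.2, h.1.1⟩, by linarith [h.2.2.1], by linarith [h.2.2.2], by linarith [h.2.1]⟩

theorem IsTriangle.gram_pos {a b c : ℝ} (h : IsTriangle a b c) :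
    0 < 1 + 2 * cosh a * cosh b * cosh c - cosh a ^ 2 - cosh b ^ 2 - cosh c ^ 2 := by
  obtain ⟨⟨ha, hb, hc⟩, h1, h2, h3⟩ := h
  have e : 1 + 2 * cosh a * cosh b * cosh c - cosh a ^ 2 - cosh b ^ 2 - cosh c ^ 2 =
      (cosh (a + b) - cosh c) * (cosh c - cosh (a - b)) := by
    rw [cosh_add, cosh_sub]
    linear_combination (cosh b ^ 2 - 1) * cosh_sq a + sinh a ^ 2 * cosh_sq b
  rw [e]
  apply mul_pos
  · rw [sub_pos, cosh_lt_cosh, abs_of_pos hc, abs_of_pos (by linarith)]; exact h3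
  · rw [sub_pos, cosh_lt_cosh, abs_of_pos hc, abs_lt]; constructor <;> linarith

theorem IsTriangle.sq_area_pos {a b c : ℝ} (h : IsTriangle a b c) :
    0 < a ^ 2 * b ^ 2 - ((a ^ 2 + b ^ 2 - c ^ 2) / 2) ^ 2 := by
  obtain ⟨⟨ha, hb, hc⟩, h1, h2, h3⟩ := h
  have e : a ^ 2 * b ^ 2 - ((a ^ 2 + b ^ 2 - c ^ 2) / 2) ^ 2 =
      (a + b + c) * (b + c - a) * (a + c - b) * (a + b - c) / 4 := by ring
  rw [e]
  have := sub_pos.2 h1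
  have := sub_pos.2 h2
  have := sub_pos.2 h3
  positivity

theorem triangleAngle_euclidean_eq {a b c : ℝ} (hb : 0 < b) (hc : 0 < c) :
    triangleAngle .euclidean a b c = arccos ((b ^ 2 + c ^ 2 - a ^ 2) / 2 / √(b ^ 2 * c ^ 2)) := by
  rw [← mul_pow, sqrt_sq (by positivity), triangleAngle]
  congr 1
  field_simp

theorem triangleAngle_hyperbolic_eq {a b c : ℝ} (hb : 0 < b) (hc : 0 < c) :
    triangleAngle .hyperbolic a b c =
      arccos ((cosh b * cosh c - cosh a) / √((cosh b ^ 2 - 1) * (cosh c ^ 2 - 1))) := by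
  have e : (cosh b ^ 2 - 1) * (cosh c ^ 2 - 1) = (sinh b * sinh c) ^ 2 := by
    rw [cosh_sq, cosh_sq]; ring
  have := sinh_pos_iff.2 hb
  have := sinh_pos_iff.2 hc
  rw [e, sqrt_sq (by positivity), triangleAngle]

/-- `arccos` clamps its argument, so the formula of the law of cosines extends the angles. -/
theorem extTriangleAngle_eq (g : Geometry) {a b c : ℝ} (ha : 0 < a) (hb : 0 < b) (hc : 0 < c) :
    extTriangleAngle g a b c = triangleAngle g a b c := by
  rw [extTriangleAngle]
  split_ifs with h h'
  · rfl
  · symm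
    cases g
    · rw [triangleAngle, arccos_eq_pi, div_le_iff₀ (by positivity)]
      nlinarith
    · have := sinh_pos_iff.2 hb
      have := sinh_pos_iff.2 hc
      rw [triangleAngle, arccos_eq_pi, div_le_iff₀ (by positivity)]
      have : cosh (b + c) ≤ cosh a := by
        rw [cosh_le_cosh, abs_of_pos ha, abs_of_pos (by positivity)]; exact h'
      rw [cosh_add] at this
      linarith
  · symm
    have h2 : a ≤ |b - c| := by
      by_contra! hlt
      rw [abs_lt] at hlt
      exact h ⟨⟨ha, hb, hc⟩, by linarith, by linarith, by linarith⟩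
    cases g
    · rw [triangleAngle, arccos_eq_zero, le_div_iff₀ (by positivity)]
      have : a ^ 2 ≤ (b - c) ^ 2 := by rw [← sq_abs (b - c)]; gcongr
      linarith
    · have := sinh_pos_iff.2 hb
      have := sinh_pos_iff.2 hc
      rw [triangleAngle, arccos_eq_zero, le_div_iff₀ (by positivity)]
      have : cosh a ≤ cosh (b - c) := by
        rw [cosh_le_cosh, abs_of_pos ha]; exact h2
      rw [cosh_sub] at this
      linarith

theorem extTriangleAngle_nonneg (g : Geometry) (a b c : ℝ) : 0 ≤ extTriangleAngle g a b c := by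
  rw [extTriangleAngle]
  split_ifs
  · cases g <;> exact arccos_nonneg _
  · exact pi_pos.le
  · exact le_rfl

theorem extTriangleAngle_le_pi (g : Geometry) (a b c : ℝ) : extTriangleAngle g a b c ≤ π := by
  rw [extTriangleAngle]
  split_ifs
  · cases g <;> exact arccos_le_pi _
  · exact le_rfl
  · exact pi_pos.le

theorem extTriangleAngle_of_not_isTriangle (g : Geometry) {a b c : ℝ} (ha : 0 < a) (hb : 0 < b)
    (hc : 0 < c) (h : ¬ IsTriangle a b c) :
    (extTriangleAngle g a b c = π ∧ extTriangleAngle g b c a = 0 ∧ extTriangleAngle g c a b = 0) ∨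
    (extTriangleAngle g a b c = 0 ∧ extTriangleAngle g b c a = π ∧ extTriangleAngle g c a b = 0) ∨
    (extTriangleAngle g a b c = 0 ∧ extTriangleAngle g b c a = 0 ∧ extTriangleAngle g c a b = π) := by
  have h' : ¬ IsTriangle b c a := fun k => h k.rotate.rotate
  have h'' : ¬ IsTriangle c a b := fun k => h k.rotate
  simp only [extTriangleAngle, h, h', h'', if_false]
  by_cases h1 : b + c ≤ a
  · left; exact ⟨if_pos h1, if_neg (by linarith), if_neg (by linarith)⟩
  · by_cases h2 : c + a ≤ b
    · right; left; exact ⟨if_neg h1, if_pos h2, if_neg (by linarith)⟩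
    · by_cases h3 : a + b ≤ c
      · right; right; exact ⟨if_neg h1, if_neg h2, if_pos h3⟩
      · exact absurd ⟨⟨ha, hb, hc⟩, by linarith, by linarith, by linarith⟩ h

/-- Degenerate triples contribute `π + 0 + 0`; this makes the total extended curvature constant. -/
theorem euclidean_extTriangleAngle_sum {a b c : ℝ} (ha : 0 < a) (hb : 0 < b) (hc : 0 < c) :
    extTriangleAngle .euclidean a b c + extTriangleAngle .euclidean b c a +
      extTriangleAngle .euclidean c a b = π := by
  by_cases h : IsTriangle a b c
  · rw [extTriangleAngle_eq _ ha hb hc, extTriangleAngle_eq _ hb hc ha,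
      extTriangleAngle_eq _ hc ha hb]
    have cosine : ∀ {a b c : ℝ}, IsTriangle a b c →
        cos (triangleAngle .euclidean a b c) = (b ^ 2 + c ^ 2 - a ^ 2) / (2 * b * c) := by
      rintro a b c ⟨⟨ha, hb, hc⟩, h1, h2, h3⟩
      refine cos_arccos ?_ ?_
      · rw [le_div_iff₀ (by positivity)]; nlinarith
      · rw [div_le_one (by positivity)]; nlinarith
    have sine : ∀ {a b c : ℝ}, IsTriangle a b c →
        sin (triangleAngle .euclidean a b c) =
          √(b ^ 2 * c ^ 2 - ((b ^ 2 + c ^ 2 - a ^ 2) / 2) ^ 2) / (b * c) := by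
      intro a b c h
      have hb := h.1.2.1
      have hc := h.1.2.2
      rw [triangleAngle, sin_arccos, eq_div_iff (by positivity), eq_comm,
        sqrt_eq_iff_mul_self_eq (by have := h.rotate.sq_area_pos; linarith) (by positivity),
        ← sq, mul_pow, sq_sqrt]
      · field_simp
      · rw [sub_nonneg, sq_le_one_iff_abs_le_one, abs_le, ← cosine h]
        exact ⟨neg_one_le_cos _, cos_le_one _⟩
    have hA := cosine h
    have hB := cosine h.rotate
    have hC := cosine h.rotate.rotate
    have sA := sine h
    have sB := sine h.rotate
    have e : c ^ 2 * a ^ 2 - ((c ^ 2 + a ^ 2 - b ^ 2) / 2) ^ 2 =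
      b ^ 2 * c ^ 2 - ((b ^ 2 + c ^ 2 - a ^ 2) / 2) ^ 2 := by ring
    have hpos := h.rotate.sq_area_pos
    rw [e] at sB
    set D := b ^ 2 * c ^ 2 - ((b ^ 2 + c ^ 2 - a ^ 2) / 2) ^ 2 with hD
    have hsq : √D ^ 2 = D := sq_sqrt hpos.le
    have rA : 0 ≤ triangleAngle .euclidean a b c := arccos_nonneg _
    have rB : 0 ≤ triangleAngle .euclidean b c a := arccos_nonneg _
    have rA' : triangleAngle .euclidean a b c ≤ π := arccos_le_pi _
    have rB' : triangleAngle .euclidean b c a ≤ π := arccos_le_pi _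
    have rC : 0 ≤ triangleAngle .euclidean c a b := arccos_nonneg _
    have rC' : triangleAngle .euclidean c a b ≤ π := arccos_le_pi _
    set A := triangleAngle .euclidean a b c
    set B := triangleAngle .euclidean b c a
    set C := triangleAngle .euclidean c a b
    have hsin : 0 ≤ sin (A + B) := by
      rw [sin_add, hA, hB, sA, sB]
      have : √D / (b * c) * ((c ^ 2 + a ^ 2 - b ^ 2) / (2 * c * a)) +
          (b ^ 2 + c ^ 2 - a ^ 2) / (2 * b * c) * (√D / (c * a)) = √D / (a * b) := by
        field_simp; ring
      rw [this]; positivity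
    -- A nonnegative sine excludes `π < A + B < 2π`, and `A + B = 2π` would force `A = π`.
    have hle : A + B ≤ π := by
      by_contra! hlt
      rcases (add_le_add rA' rB').eq_or_lt with h2 | h2
      · have : A = π := by linarith
        rw [this, cos_pi, eq_div_iff (by positivity)] at hA
        nlinarith [h.2.1]
      · have := sin_neg_of_neg_of_neg_pi_lt (x := A + B - 2 * π) (by linarith) (by linarith)
        rw [sin_sub_two_pi] at this
        linarith
    have hcos : cos (A + B) = cos (π - C) := by
      rw [cos_pi_sub, cos_add, hA, hB, hC, sA, sB]
      have : √D / (b * c) * (√D / (c * a)) = D / (a * b * c ^ 2) := by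
        rw [div_mul_div_comm, ← sq, hsq]; congr 1; ring
      rw [this, hD]
      field_simp
      ring
    have := injOn_cos ⟨by linarith, hle⟩ ⟨by linarith, by linarith⟩ hcos
    linarith
  · rcases extTriangleAngle_of_not_isTriangle .euclidean ha hb hc h with
      ⟨h1, h2, h3⟩ | ⟨h1, h2, h3⟩ | ⟨h1, h2, h3⟩ <;> rw [h1, h2, h3] <;> ring

theorem continuousAt_triangleAngle {X : Type*} [TopologicalSpace X] (g : Geometry) {a b c : X → ℝ}
    {x : X} (ha : ContinuousAt a x) (hb : ContinuousAt b x) (hc : ContinuousAt c x)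
    (hb0 : 0 < b x) (hc0 : 0 < c x) :
    ContinuousAt (fun y => triangleAngle g (a y) (b y) (c y)) x := by
  cases g
  · exact continuous_arccos.continuousAt.comp (((((hb.pow 2).add (hc.pow 2)).sub (ha.pow 2))).div
      ((continuousAt_const.mul hb).mul hc) (by positivity))
  · have := sinh_pos_iff.2 hb0
    have := sinh_pos_iff.2 hc0
    refine continuous_arccos.continuousAt.comp (ContinuousAt.div ?_ ?_ (by positivity))
    · exact ((continuous_cosh.continuousAt.comp hb).mul (continuous_cosh.continuousAt.comp hc)).sub
        (continuous_cosh.continuousAt.comp ha)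
    · exact (continuous_sinh.continuousAt.comp hb).mul (continuous_sinh.continuousAt.comp hc)

theorem differentiableAt_triangleAngle {E : Type*} [NormedAddCommGroup E] [NormedSpace ℝ E]
    (g : Geometry) {a b c : E → ℝ} {x : E} (ha : DifferentiableAt ℝ a x)
    (hb : DifferentiableAt ℝ b x) (hc : DifferentiableAt ℝ c x)
    (h : IsTriangle (a x) (b x) (c x)) :
    DifferentiableAt ℝ (fun y => triangleAngle g (a y) (b y) (c y)) x := by
  have hb0 := h.1.2.1
  have hc0 := h.1.2.2
  cases g
  · have h1 : (b x ^ 2 + c x ^ 2 - a x ^ 2) / (2 * b x * c x) ≠ -1 ∧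
        (b x ^ 2 + c x ^ 2 - a x ^ 2) / (2 * b x * c x) ≠ 1 := by
      rw [← sq_ne_one_iff.trans and_comm, div_pow]
      have := h.rotate.sq_area_pos
      refine ((div_lt_one (by positivity)).2 ?_).ne
      linarith
    exact DifferentiableAt.comp (g := arccos)
      (f := fun y => (b y ^ 2 + c y ^ 2 - a y ^ 2) / (2 * b y * c y)) x
      (differentiableAt_arccos.2 h1) (by
        have : 2 * b x * c x ≠ 0 := by positivity
        fun_prop (disch := assumption))
  · have s1 := sinh_pos_iff.2 hb0
    have s2 := sinh_pos_iff.2 hc0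
    have h1 : (cosh (b x) * cosh (c x) - cosh (a x)) / (sinh (b x) * sinh (c x)) ≠ -1 ∧
        (cosh (b x) * cosh (c x) - cosh (a x)) / (sinh (b x) * sinh (c x)) ≠ 1 := by
      rw [← sq_ne_one_iff.trans and_comm, div_pow]
      have := h.gram_pos
      refine ((div_lt_one (by positivity)).2 ?_).ne
      rw [mul_pow, sinh_sq, sinh_sq]
      linarith
    exact DifferentiableAt.comp (g := arccos)
      (f := fun y => (cosh (b y) * cosh (c y) - cosh (a y)) / (sinh (b y) * sinh (c y))) x
      (differentiableAt_arccos.2 h1) (by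
        have : sinh (b x) * sinh (c x) ≠ 0 := by positivity
        fun_prop (disch := assumption))

/-! ### Edge lengths -/

theorem exp_two_mul_eq_sq (x : ℝ) : exp (2 * x) = exp x ^ 2 := by
  rw [two_mul, exp_add, sq]

theorem euclideanSqLength_pos {ε ε' η r r' : ℝ} (hε : ε = 0 ∨ ε = 1) (hε' : ε' = 0 ∨ ε' = 1)
    (h : 0 < ε * ε' + η) (hr : 0 < r) (hr' : 0 < r') :
    0 < ε * r ^ 2 + ε' * r' ^ 2 + 2 * η * (r * r') := by
  have h1 : 2 * (ε * ε') * (r * r') ≤ ε * r ^ 2 + ε' * r' ^ 2 := by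
    rcases hε with rfl | rfl <;> rcases hε' with rfl | rfl <;>
      nlinarith [sq_nonneg (r - r'), sq_nonneg r, sq_nonneg r']
  nlinarith [mul_pos h (mul_pos hr hr')]

/-- The factor `df/du`: it is `1` in the Euclidean and `√(1 + ε e^{2f})` in the hyperbolic case. -/
noncomputable def confFactor : Geometry → (ε f : ℝ) → ℝ
  | .euclidean, _, _ => 1
  | .hyperbolic, ε, f => √(1 + ε * exp f ^ 2)

theorem one_add_mul_pos {ε : ℝ} (hε : ε = 0 ∨ ε = 1) (x : ℝ) : 0 < 1 + ε * x ^ 2 := by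
  rcases hε with rfl | rfl <;> positivity

theorem confFactor_hyperbolic_sq {ε : ℝ} (hε : ε = 0 ∨ ε = 1) (f : ℝ) :
    confFactor .hyperbolic ε f ^ 2 = 1 + ε * exp f ^ 2 :=
  sq_sqrt (one_add_mul_pos hε _).le

theorem confFactor_pos (g : Geometry) {ε : ℝ} (hε : ε = 0 ∨ ε = 1) (f : ℝ) :
    0 < confFactor g ε f := by
  cases g
  · exact one_pos
  · exact sqrt_pos.2 (one_add_mul_pos hε _)

theorem edgeLength_euclidean_eq (ε ε' η f f' : ℝ) : edgeLength .euclidean ε ε' η f f' =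
    √(ε * exp f ^ 2 + ε' * exp f' ^ 2 + 2 * η * (exp f * exp f')) := by
  rw [edgeLength, exp_two_mul_eq_sq, exp_two_mul_eq_sq, exp_add]

theorem edgeLength_hyperbolic_eq {ε : ℝ} (hε : ε = 0 ∨ ε = 1) (ε' η f f' : ℝ) :
    edgeLength .hyperbolic ε ε' η f f' =
      arcosh (confFactor .hyperbolic ε f * confFactor .hyperbolic ε' f' +
        η * (exp f * exp f')) := by
  rw [edgeLength, exp_two_mul_eq_sq, exp_two_mul_eq_sq, exp_add,
    sqrt_mul (one_add_mul_pos hε _).le]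
  rfl

section

variable {ε ε' η : ℝ}

theorem one_lt_coshEdgeLength (hε : ε = 0 ∨ ε = 1) (hε' : ε' = 0 ∨ ε' = 1) (h : 0 < ε * ε' + η)
    (f f' : ℝ) :
    1 < confFactor .hyperbolic ε f * confFactor .hyperbolic ε' f' + η * (exp f * exp f') :=
  one_lt_coshLength hε hε' h (exp_pos f) (exp_pos f') (confFactor_pos _ hε f)
    (confFactor_pos _ hε' f') (confFactor_hyperbolic_sq hε f) (confFactor_hyperbolic_sq hε' f')

theorem cosh_edgeLength (hε : ε = 0 ∨ ε = 1) (hε' : ε' = 0 ∨ ε' = 1) (h : 0 < ε * ε' + η)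
    (f f' : ℝ) : cosh (edgeLength .hyperbolic ε ε' η f f') =
      confFactor .hyperbolic ε f * confFactor .hyperbolic ε' f' + η * (exp f * exp f') := by
  rw [edgeLength_hyperbolic_eq hε, cosh_arcosh (one_lt_coshEdgeLength hε hε' h f f').le]

theorem edgeLength_sq (hε : ε = 0 ∨ ε = 1) (hε' : ε' = 0 ∨ ε' = 1) (h : 0 < ε * ε' + η)
    (f f' : ℝ) : edgeLength .euclidean ε ε' η f f' ^ 2 =
      ε * exp f ^ 2 + ε' * exp f' ^ 2 + 2 * η * (exp f * exp f') := by
  rw [edgeLength_euclidean_eq,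
    sq_sqrt (euclideanSqLength_pos hε hε' h (exp_pos f) (exp_pos f')).le]

theorem edgeLength_pos (g : Geometry) (hε : ε = 0 ∨ ε = 1) (hε' : ε' = 0 ∨ ε' = 1)
    (h : 0 < ε * ε' + η) (f f' : ℝ) : 0 < edgeLength g ε ε' η f f' := by
  cases g
  · rw [edgeLength_euclidean_eq]
    exact sqrt_pos.2 (euclideanSqLength_pos hε hε' h (exp_pos f) (exp_pos f'))
  · rw [edgeLength_hyperbolic_eq hε]
    exact arcosh_pos (one_lt_coshEdgeLength hε hε' h f f')

theorem differentiableAt_confFactor {E : Type*} [NormedAddCommGroup E] [NormedSpace ℝ E]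
    (hε : ε = 0 ∨ ε = 1) {f : E → ℝ} {x : E} (hf : DifferentiableAt ℝ f x) :
    DifferentiableAt ℝ (fun y => confFactor .hyperbolic ε (f y)) x := by
  have := (one_add_mul_pos hε (exp (f x))).ne'
  exact DifferentiableAt.sqrt (by fun_prop) this

theorem differentiableAt_edgeLength {E : Type*} [NormedAddCommGroup E] [NormedSpace ℝ E]
    (g : Geometry) (hε : ε = 0 ∨ ε = 1) (hε' : ε' = 0 ∨ ε' = 1) (h : 0 < ε * ε' + η)
    {f f' : E → ℝ} {x : E} (hf : DifferentiableAt ℝ f x) (hf' : DifferentiableAt ℝ f' x) :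
    DifferentiableAt ℝ (fun y => edgeLength g ε ε' η (f y) (f' y)) x := by
  cases g
  · simp only [edgeLength_euclidean_eq]
    exact DifferentiableAt.sqrt (by fun_prop)
      (euclideanSqLength_pos hε hε' h (exp_pos _) (exp_pos _)).ne'
  · simp only [edgeLength_hyperbolic_eq hε]
    have h1 := differentiableAt_confFactor hε hf
    have h2 := differentiableAt_confFactor hε' hf'
    exact DifferentiableAt.comp (g := arcosh)
      (f := fun y => confFactor .hyperbolic ε (f y) * confFactor .hyperbolic ε' (f' y) +
        η * (exp (f y) * exp (f' y))) x
      (differentiableAt_arcosh (one_lt_coshEdgeLength hε hε' h _ _)) (by fun_prop)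

end

/-! ### The derivative of the angles of a triangle -/

section

variable {ε₁ ε₂ ε₃ η₁ η₂ η₃ x₁ x₂ x₃ t : ℝ} {f₁ f₂ f₃ : ℝ → ℝ}

theorem sign_of_eq_neg_div {A Q R : ℝ} {p : Prop} (hA : A = -Q / R) (hR : 0 < R)
    (hQ : ¬ p → 0 < Q) (hQ0 : p → Q = 0) : A ≤ 0 ∧ (¬ p → A < 0) := by
  have h : ¬ p → A < 0 := fun hp => hA ▸ div_neg_of_neg_of_pos (neg_neg_of_pos (hQ hp)) hR
  refine ⟨?_, h⟩
  by_cases hp : p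
  · rw [hA, hQ0 hp]; simp
  · exact (h hp).le

/-- Squared lengths are differentiated instead of lengths, which keeps the computation rational
apart from the common root; the pairing is then minus the form of `eucForm_pos` over that root. -/
theorem hasDerivAt_euclideanAngles
    (hε₁ : ε₁ = 0 ∨ ε₁ = 1) (hε₂ : ε₂ = 0 ∨ ε₂ = 1) (hε₃ : ε₃ = 0 ∨ ε₃ = 1)
    (h₁ : 0 < ε₂ * ε₃ + η₁) (h₂ : 0 < ε₃ * ε₁ + η₂) (h₃ : 0 < ε₁ * ε₂ + η₃)
    (g₁ : 0 ≤ ε₁ * η₁ + η₂ * η₃) (g₂ : 0 ≤ ε₂ * η₂ + η₃ * η₁) (g₃ : 0 ≤ ε₃ * η₃ + η₁ * η₂)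
    (hf₁ : HasDerivAt f₁ x₁ t) (hf₂ : HasDerivAt f₂ x₂ t) (hf₃ : HasDerivAt f₃ x₃ t)
    {l₁ l₂ l₃ : ℝ → ℝ} (hl₁ : l₁ = fun s => edgeLength .euclidean ε₂ ε₃ η₁ (f₂ s) (f₃ s))
    (hl₂ : l₂ = fun s => edgeLength .euclidean ε₃ ε₁ η₂ (f₃ s) (f₁ s))
    (hl₃ : l₃ = fun s => edgeLength .euclidean ε₁ ε₂ η₃ (f₁ s) (f₂ s))
    (tri : IsTriangle (l₁ t) (l₂ t) (l₃ t)) :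
    ∃ θ₁ θ₂ θ₃ : ℝ, HasDerivAt (fun s => triangleAngle .euclidean (l₁ s) (l₂ s) (l₃ s)) θ₁ t ∧
      HasDerivAt (fun s => triangleAngle .euclidean (l₂ s) (l₃ s) (l₁ s)) θ₂ t ∧
      HasDerivAt (fun s => triangleAngle .euclidean (l₃ s) (l₁ s) (l₂ s)) θ₃ t ∧
      x₁ * θ₁ + x₂ * θ₂ + x₃ * θ₃ ≤ 0 ∧
      (¬ (x₁ = x₃ ∧ x₂ = x₃) → x₁ * θ₁ + x₂ * θ₂ + x₃ * θ₃ < 0) := by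
  have l₁p : ∀ s, 0 < l₁ s := fun s => hl₁ ▸ edgeLength_pos _ hε₂ hε₃ h₁ _ _
  have l₂p : ∀ s, 0 < l₂ s := fun s => hl₂ ▸ edgeLength_pos _ hε₃ hε₁ h₂ _ _
  have l₃p : ∀ s, 0 < l₃ s := fun s => hl₃ ▸ edgeLength_pos _ hε₁ hε₂ h₃ _ _
  have e₁ : (fun s => l₁ s ^ 2) = fun s => ε₂ * exp (f₂ s) ^ 2 + ε₃ * exp (f₃ s) ^ 2 +
      2 * η₁ * (exp (f₂ s) * exp (f₃ s)) := by
    funext s; rw [hl₁]; exact edgeLength_sq hε₂ hε₃ h₁ _ _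
  have e₂ : (fun s => l₂ s ^ 2) = fun s => ε₃ * exp (f₃ s) ^ 2 + ε₁ * exp (f₁ s) ^ 2 +
      2 * η₂ * (exp (f₃ s) * exp (f₁ s)) := by
    funext s; rw [hl₂]; exact edgeLength_sq hε₃ hε₁ h₂ _ _
  have e₃ : (fun s => l₃ s ^ 2) = fun s => ε₁ * exp (f₁ s) ^ 2 + ε₂ * exp (f₂ s) ^ 2 +
      2 * η₃ * (exp (f₁ s) * exp (f₂ s)) := by
    funext s; rw [hl₃]; exact edgeLength_sq hε₁ hε₂ h₃ _ _
  have key : ∀ {ε ε' η x x' : ℝ} {f f' : ℝ → ℝ}, HasDerivAt f x t → HasDerivAt f' x' t →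
      HasDerivAt (fun s => ε * exp (f s) ^ 2 + ε' * exp (f' s) ^ 2 +
        2 * η * (exp (f s) * exp (f' s)))
        (2 * ((ε * exp (f t) ^ 2 + η * (exp (f t) * exp (f' t))) * x +
          (ε' * exp (f' t) ^ 2 + η * (exp (f t) * exp (f' t))) * x')) t := by
    intro ε ε' η x x' f f' hf hf'
    refine ((((hf.exp.pow 2).const_mul ε).add ((hf'.exp.pow 2).const_mul ε')).add
      ((hf.exp.mul hf'.exp).const_mul (2 * η))).congr_deriv ?_
    ring
  have s₁ := key (ε := ε₂) (ε' := ε₃) (η := η₁) hf₂ hf₃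
  have s₂ := key (ε := ε₃) (ε' := ε₁) (η := η₂) hf₃ hf₁
  have s₃ := key (ε := ε₁) (ε' := ε₂) (η := η₃) hf₁ hf₂
  rw [← e₁] at s₁
  rw [← e₂] at s₂
  rw [← e₃] at s₃
  have angle : ∀ {a b c : ℝ → ℝ} {a' b' c' : ℝ}, HasDerivAt (fun s => a s ^ 2) a' t →
      HasDerivAt (fun s => b s ^ 2) b' t → HasDerivAt (fun s => c s ^ 2) c' t →
      (∀ s, 0 < b s) → (∀ s, 0 < c s) → IsTriangle (a t) (b t) (c t) →
      HasDerivAt (fun s => triangleAngle .euclidean (a s) (b s) (c s))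
        (-((b' + c' - a') / 2 - (b t ^ 2 + c t ^ 2 - a t ^ 2) / 2 *
          ((b' * c t ^ 2 + b t ^ 2 * c') / (2 * (b t ^ 2 * c t ^ 2)))) /
          √(b t ^ 2 * c t ^ 2 - ((b t ^ 2 + c t ^ 2 - a t ^ 2) / 2) ^ 2)) t := by
    intro a b c a' b' c' ha hb hc hb0 hc0 htri
    simp only [fun s => triangleAngle_euclidean_eq (a := a s) (hb0 s) (hc0 s)]
    exact hasDerivAt_arccos_div_sqrt (((hb.add hc).sub ha).div_const 2) (hb.mul hc)
      (sub_pos.1 htri.rotate.sq_area_pos)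
  refine ⟨_, _, _, angle s₁ s₂ s₃ l₂p l₃p tri, angle s₂ s₃ s₁ l₃p l₁p tri.rotate,
    angle s₃ s₁ s₂ l₁p l₂p tri.rotate.rotate, ?_⟩
  have hA := tri.sq_area_pos
  have d₁ : l₂ t ^ 2 * l₃ t ^ 2 - ((l₂ t ^ 2 + l₃ t ^ 2 - l₁ t ^ 2) / 2) ^ 2 =
    l₁ t ^ 2 * l₂ t ^ 2 - ((l₁ t ^ 2 + l₂ t ^ 2 - l₃ t ^ 2) / 2) ^ 2 := by ring
  have d₂ : l₃ t ^ 2 * l₁ t ^ 2 - ((l₃ t ^ 2 + l₁ t ^ 2 - l₂ t ^ 2) / 2) ^ 2 =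
    l₁ t ^ 2 * l₂ t ^ 2 - ((l₁ t ^ 2 + l₂ t ^ 2 - l₃ t ^ 2) / 2) ^ 2 := by ring
  rw [d₁, d₂]
  have p₁ := pow_pos (l₁p t) 2
  have p₂ := pow_pos (l₂p t) 2
  have p₃ := pow_pos (l₃p t) 2
  have q₁ := congrFun e₁ t
  have q₂ := congrFun e₂ t
  have q₃ := congrFun e₃ t
  have hform := eucForm_pos (x₁ := x₁) (x₂ := x₂) (x₃ := x₃) hε₁ hε₂ hε₃ h₁ h₂ h₃ g₁ g₂ g₃
    (exp_pos (f₁ t)) (exp_pos (f₂ t)) (exp_pos (f₃ t)) p₁ p₂ p₃ q₁ q₂ q₃ hA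
  have hR := sqrt_pos.2 hA
  generalize √(l₁ t ^ 2 * l₂ t ^ 2 - ((l₁ t ^ 2 + l₂ t ^ 2 - l₃ t ^ 2) / 2) ^ 2) = R at *
  generalize l₁ t ^ 2 = S₁ at *
  generalize l₂ t ^ 2 = S₂ at *
  generalize l₃ t ^ 2 = S₃ at *
  generalize ε₁ * exp (f₁ t) ^ 2 = a₁ at *
  generalize ε₂ * exp (f₂ t) ^ 2 = a₂ at *
  generalize ε₃ * exp (f₃ t) ^ 2 = a₃ at *
  rw [mul_assoc] at q₁ q₂ q₃
  generalize η₁ * (exp (f₂ t) * exp (f₃ t)) = y₁ at *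
  generalize η₂ * (exp (f₃ t) * exp (f₁ t)) = y₂ at *
  generalize η₃ * (exp (f₁ t) * exp (f₂ t)) = y₃ at *
  refine sign_of_eq_neg_div ?_ hR hform ?_
  · simp only [eucHeight]
    field_simp
    rw [q₁, q₂, q₃]
    ring
  · rintro ⟨rfl, rfl⟩
    ring

end

section

variable {ε₁ ε₂ ε₃ η₁ η₂ η₃ x₁ x₂ x₃ t : ℝ} {f₁ f₂ f₃ : ℝ → ℝ}

theorem hasDerivAt_confFactor {ε x : ℝ} {f : ℝ → ℝ} (hε : ε = 0 ∨ ε = 1)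
    (hf : HasDerivAt f (confFactor .hyperbolic ε (f t) * x) t) :
    HasDerivAt (fun s => confFactor .hyperbolic ε (f s))
      ((confFactor .hyperbolic ε (f t) ^ 2 - 1) * x) t := by
  have h := (((hf.exp.pow 2).const_mul ε).const_add 1).sqrt (one_add_mul_pos hε (exp (f t))).ne'
  have hc := confFactor_pos .hyperbolic hε (f t)
  refine h.congr_deriv ?_
  rw [confFactor_hyperbolic_sq hε]
  change _ / (2 * confFactor .hyperbolic ε (f t)) = _
  field_simp
  ring

/-- The factor `df/du` turns the partial derivatives into the differences `c H - c'` that run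
through the algebra of the hyperbolic form. -/
theorem hasDerivAt_cosh_edgeLength {ε ε' η x x' : ℝ} {f f' : ℝ → ℝ} (hε : ε = 0 ∨ ε = 1)
    (hε' : ε' = 0 ∨ ε' = 1) (h : 0 < ε * ε' + η)
    (hf : HasDerivAt f (confFactor .hyperbolic ε (f t) * x) t)
    (hf' : HasDerivAt f' (confFactor .hyperbolic ε' (f' t) * x') t) :
    HasDerivAt (fun s => cosh (edgeLength .hyperbolic ε ε' η (f s) (f' s)))
      ((confFactor .hyperbolic ε (f t) * cosh (edgeLength .hyperbolic ε ε' η (f t) (f' t)) -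
          confFactor .hyperbolic ε' (f' t)) * x +
        (confFactor .hyperbolic ε' (f' t) * cosh (edgeLength .hyperbolic ε ε' η (f t) (f' t)) -
          confFactor .hyperbolic ε (f t)) * x') t := by
  simp only [cosh_edgeLength hε hε' h]
  refine (((hasDerivAt_confFactor hε hf).mul (hasDerivAt_confFactor hε' hf')).add
    ((hf.exp.mul hf'.exp).const_mul η)).congr_deriv ?_
  ring

theorem hasDerivAt_hyperbolicAngles
    (hε₁ : ε₁ = 0 ∨ ε₁ = 1) (hε₂ : ε₂ = 0 ∨ ε₂ = 1) (hε₃ : ε₃ = 0 ∨ ε₃ = 1)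
    (h₁ : 0 < ε₂ * ε₃ + η₁) (h₂ : 0 < ε₃ * ε₁ + η₂) (h₃ : 0 < ε₁ * ε₂ + η₃)
    (g₁ : 0 ≤ ε₁ * η₁ + η₂ * η₃) (g₂ : 0 ≤ ε₂ * η₂ + η₃ * η₁) (g₃ : 0 ≤ ε₃ * η₃ + η₁ * η₂)
    (hf₁ : HasDerivAt f₁ (confFactor .hyperbolic ε₁ (f₁ t) * x₁) t)
    (hf₂ : HasDerivAt f₂ (confFactor .hyperbolic ε₂ (f₂ t) * x₂) t)
    (hf₃ : HasDerivAt f₃ (confFactor .hyperbolic ε₃ (f₃ t) * x₃) t)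
    {l₁ l₂ l₃ : ℝ → ℝ} (hl₁ : l₁ = fun s => edgeLength .hyperbolic ε₂ ε₃ η₁ (f₂ s) (f₃ s))
    (hl₂ : l₂ = fun s => edgeLength .hyperbolic ε₃ ε₁ η₂ (f₃ s) (f₁ s))
    (hl₃ : l₃ = fun s => edgeLength .hyperbolic ε₁ ε₂ η₃ (f₁ s) (f₂ s))
    (tri : IsTriangle (l₁ t) (l₂ t) (l₃ t)) :
    ∃ θ₁ θ₂ θ₃ : ℝ, HasDerivAt (fun s => triangleAngle .hyperbolic (l₁ s) (l₂ s) (l₃ s)) θ₁ t ∧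
      HasDerivAt (fun s => triangleAngle .hyperbolic (l₂ s) (l₃ s) (l₁ s)) θ₂ t ∧
      HasDerivAt (fun s => triangleAngle .hyperbolic (l₃ s) (l₁ s) (l₂ s)) θ₃ t ∧
      x₁ * θ₁ + x₂ * θ₂ + x₃ * θ₃ ≤ 0 ∧
      (¬ (x₁ = 0 ∧ x₂ = 0 ∧ x₃ = 0) → x₁ * θ₁ + x₂ * θ₂ + x₃ * θ₃ < 0) := by
  have l₁p : ∀ s, 0 < l₁ s := fun s => hl₁ ▸ edgeLength_pos _ hε₂ hε₃ h₁ _ _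
  have l₂p : ∀ s, 0 < l₂ s := fun s => hl₂ ▸ edgeLength_pos _ hε₃ hε₁ h₂ _ _
  have l₃p : ∀ s, 0 < l₃ s := fun s => hl₃ ▸ edgeLength_pos _ hε₁ hε₂ h₃ _ _
  have s₁ := hasDerivAt_cosh_edgeLength hε₂ hε₃ h₁ hf₂ hf₃
  have s₂ := hasDerivAt_cosh_edgeLength hε₃ hε₁ h₂ hf₃ hf₁
  have s₃ := hasDerivAt_cosh_edgeLength hε₁ hε₂ h₃ hf₁ hf₂
  have q₁ := (congrArg cosh (congrFun hl₁ t)).trans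
    (cosh_edgeLength hε₂ hε₃ h₁ (f₂ t) (f₃ t))
  have q₂ := (congrArg cosh (congrFun hl₂ t)).trans
    (cosh_edgeLength hε₃ hε₁ h₂ (f₃ t) (f₁ t))
  have q₃ := (congrArg cosh (congrFun hl₃ t)).trans
    (cosh_edgeLength hε₁ hε₂ h₃ (f₁ t) (f₂ t))
  rw [show edgeLength .hyperbolic ε₂ ε₃ η₁ (f₂ t) (f₃ t) = l₁ t by rw [hl₁]] at s₁
  rw [show edgeLength .hyperbolic ε₃ ε₁ η₂ (f₃ t) (f₁ t) = l₂ t by rw [hl₂]] at s₂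
  rw [show edgeLength .hyperbolic ε₁ ε₂ η₃ (f₁ t) (f₂ t) = l₃ t by rw [hl₃]] at s₃
  rw [show (fun s => cosh (edgeLength .hyperbolic ε₂ ε₃ η₁ (f₂ s) (f₃ s))) =
    fun s => cosh (l₁ s) by rw [hl₁]] at s₁
  rw [show (fun s => cosh (edgeLength .hyperbolic ε₃ ε₁ η₂ (f₃ s) (f₁ s))) =
    fun s => cosh (l₂ s) by rw [hl₂]] at s₂
  rw [show (fun s => cosh (edgeLength .hyperbolic ε₁ ε₂ η₃ (f₁ s) (f₂ s))) =
    fun s => cosh (l₃ s) by rw [hl₃]] at s₃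
  have gram : ∀ {A B C : ℝ}, (B ^ 2 - 1) * (C ^ 2 - 1) - (B * C - A) ^ 2 =
      1 + 2 * A * B * C - A ^ 2 - B ^ 2 - C ^ 2 := by intros; ring
  have angle : ∀ {a b c : ℝ → ℝ} {a' b' c' : ℝ}, HasDerivAt (fun s => cosh (a s)) a' t →
      HasDerivAt (fun s => cosh (b s)) b' t → HasDerivAt (fun s => cosh (c s)) c' t →
      (∀ s, 0 < b s) → (∀ s, 0 < c s) → IsTriangle (a t) (b t) (c t) →
      HasDerivAt (fun s => triangleAngle .hyperbolic (a s) (b s) (c s))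
        (-((b' * cosh (c t) + cosh (b t) * c' - a') - (cosh (b t) * cosh (c t) - cosh (a t)) *
          ((2 * cosh (b t) * b' * (cosh (c t) ^ 2 - 1) +
            (cosh (b t) ^ 2 - 1) * (2 * cosh (c t) * c')) /
            (2 * ((cosh (b t) ^ 2 - 1) * (cosh (c t) ^ 2 - 1))))) /
          √(1 + 2 * cosh (a t) * cosh (b t) * cosh (c t) - cosh (a t) ^ 2 - cosh (b t) ^ 2 -
            cosh (c t) ^ 2)) t := by
    intro a b c a' b' c' ha hb hc hb0 hc0 htri
    simp only [fun s => triangleAngle_hyperbolic_eq (a := a s) (hb0 s) (hc0 s)]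
    rw [← gram]
    refine (hasDerivAt_arccos_div_sqrt ((hb.mul hc).sub ha)
      (((hb.pow 2).sub_const 1).mul ((hc.pow 2).sub_const 1)) ?_).congr_deriv ?_
    · have := htri.gram_pos
      rw [← gram] at this
      exact sub_pos.1 this
    · simp
  refine ⟨_, _, _, angle s₁ s₂ s₃ l₂p l₃p tri, angle s₂ s₃ s₁ l₃p l₁p tri.rotate,
    angle s₃ s₁ s₂ l₁p l₂p tri.rotate.rotate, ?_⟩
  have hA := tri.gram_pos
  have d₁ : 1 + 2 * cosh (l₂ t) * cosh (l₃ t) * cosh (l₁ t) - cosh (l₂ t) ^ 2 - cosh (l₃ t) ^ 2 -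
      cosh (l₁ t) ^ 2 = 1 + 2 * cosh (l₁ t) * cosh (l₂ t) * cosh (l₃ t) - cosh (l₁ t) ^ 2 -
      cosh (l₂ t) ^ 2 - cosh (l₃ t) ^ 2 := by ring
  have d₂ : 1 + 2 * cosh (l₃ t) * cosh (l₁ t) * cosh (l₂ t) - cosh (l₃ t) ^ 2 - cosh (l₁ t) ^ 2 -
      cosh (l₂ t) ^ 2 = 1 + 2 * cosh (l₁ t) * cosh (l₂ t) * cosh (l₃ t) - cosh (l₁ t) ^ 2 -
      cosh (l₂ t) ^ 2 - cosh (l₃ t) ^ 2 := by ring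
  rw [d₁, d₂]
  have hform := hypForm_pos (x₁ := x₁) (x₂ := x₂) (x₃ := x₃) hε₁ hε₂ hε₃ h₁ h₂ h₃ g₁ g₂ g₃
    (exp_pos (f₁ t)) (exp_pos (f₂ t)) (exp_pos (f₃ t)) (confFactor_pos _ hε₁ _)
    (confFactor_pos _ hε₂ _) (confFactor_pos _ hε₃ _) (confFactor_hyperbolic_sq hε₁ _)
    (confFactor_hyperbolic_sq hε₂ _) (confFactor_hyperbolic_sq hε₃ _) q₁ q₂ q₃ hA
  have hR := sqrt_pos.2 hA
  have p₁ : cosh (l₁ t) ^ 2 - 1 ≠ 0 :=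
    (sub_pos.2 (one_lt_pow₀ (one_lt_cosh.2 (l₁p t).ne') two_ne_zero)).ne'
  have p₂ : cosh (l₂ t) ^ 2 - 1 ≠ 0 :=
    (sub_pos.2 (one_lt_pow₀ (one_lt_cosh.2 (l₂p t).ne') two_ne_zero)).ne'
  have p₃ : cosh (l₃ t) ^ 2 - 1 ≠ 0 :=
    (sub_pos.2 (one_lt_pow₀ (one_lt_cosh.2 (l₃p t).ne') two_ne_zero)).ne'
  generalize √(1 + 2 * cosh (l₁ t) * cosh (l₂ t) * cosh (l₃ t) - cosh (l₁ t) ^ 2 -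
      cosh (l₂ t) ^ 2 - cosh (l₃ t) ^ 2) = R at *
  clear q₁ q₂ q₃ hA s₁ s₂ s₃ d₁ d₂
  generalize cosh (l₁ t) = H₁ at *
  generalize cosh (l₂ t) = H₂ at *
  generalize cosh (l₃ t) = H₃ at *
  generalize confFactor .hyperbolic ε₁ (f₁ t) = c₁ at *
  generalize confFactor .hyperbolic ε₂ (f₂ t) = c₂ at *
  generalize confFactor .hyperbolic ε₃ (f₃ t) = c₃ at *
  refine sign_of_eq_neg_div ?_ hR hform ?_
  · simp only [hypHeight]
    have := hR.ne'
    field_simp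
    ring
  · rintro ⟨rfl, rfl, rfl⟩
    ring

end

/-- The directions in which the angles of a triangle do not vary to first order. -/
def IsNeutral : Geometry → (x₁ x₂ x₃ : ℝ) → Prop
  | .euclidean, x₁, x₂, x₃ => x₁ = x₃ ∧ x₂ = x₃
  | .hyperbolic, x₁, x₂, x₃ => x₁ = 0 ∧ x₂ = 0 ∧ x₃ = 0

theorem hasDerivAt_angles (g : Geometry) {ε₁ ε₂ ε₃ η₁ η₂ η₃ x₁ x₂ x₃ t : ℝ} {f₁ f₂ f₃ : ℝ → ℝ}
    (hε₁ : ε₁ = 0 ∨ ε₁ = 1) (hε₂ : ε₂ = 0 ∨ ε₂ = 1) (hε₃ : ε₃ = 0 ∨ ε₃ = 1)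
    (h₁ : 0 < ε₂ * ε₃ + η₁) (h₂ : 0 < ε₃ * ε₁ + η₂) (h₃ : 0 < ε₁ * ε₂ + η₃)
    (g₁ : 0 ≤ ε₁ * η₁ + η₂ * η₃) (g₂ : 0 ≤ ε₂ * η₂ + η₃ * η₁) (g₃ : 0 ≤ ε₃ * η₃ + η₁ * η₂)
    (hf₁ : HasDerivAt f₁ (confFactor g ε₁ (f₁ t) * x₁) t)
    (hf₂ : HasDerivAt f₂ (confFactor g ε₂ (f₂ t) * x₂) t)
    (hf₃ : HasDerivAt f₃ (confFactor g ε₃ (f₃ t) * x₃) t)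
    {l₁ l₂ l₃ : ℝ → ℝ} (hl₁ : l₁ = fun s => edgeLength g ε₂ ε₃ η₁ (f₂ s) (f₃ s))
    (hl₂ : l₂ = fun s => edgeLength g ε₃ ε₁ η₂ (f₃ s) (f₁ s))
    (hl₃ : l₃ = fun s => edgeLength g ε₁ ε₂ η₃ (f₁ s) (f₂ s))
    (tri : IsTriangle (l₁ t) (l₂ t) (l₃ t)) :
    ∃ θ₁ θ₂ θ₃ : ℝ, HasDerivAt (fun s => triangleAngle g (l₁ s) (l₂ s) (l₃ s)) θ₁ t ∧
      HasDerivAt (fun s => triangleAngle g (l₂ s) (l₃ s) (l₁ s)) θ₂ t ∧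
      HasDerivAt (fun s => triangleAngle g (l₃ s) (l₁ s) (l₂ s)) θ₃ t ∧
      x₁ * θ₁ + x₂ * θ₂ + x₃ * θ₃ ≤ 0 ∧
      (¬ IsNeutral g x₁ x₂ x₃ → x₁ * θ₁ + x₂ * θ₂ + x₃ * θ₃ < 0) := by
  cases g
  · simp only [confFactor, one_mul] at hf₁ hf₂ hf₃
    exact hasDerivAt_euclideanAngles hε₁ hε₂ hε₃ h₁ h₂ h₃ g₁ g₂ g₃ hf₁ hf₂ hf₃ hl₁ hl₂ hl₃ tri
  · exact hasDerivAt_hyperbolicAngles hε₁ hε₂ hε₃ h₁ h₂ h₃ g₁ g₂ g₃ hf₁ hf₂ hf₃ hl₁ hl₂ hl₃ tri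

/-! ### The coordinates `u` -/

/-- With `c = √(1 + exp f ^ 2)` one has `(c - 1) / (c + 1) = ((c + 1) / exp f)⁻²`. The closed form
exhibits the range `u < 0` and the inverse. -/
theorem uCoord_hyperbolic_one (f : ℝ) : uCoord .hyperbolic 1 f = -arsinh (exp (-f)) := by
  have hc0 : (0 : ℝ) < 1 + exp f ^ 2 := by positivity
  have hc := sq_sqrt hc0.le
  rw [uCoord, if_neg one_ne_zero, one_mul, exp_two_mul_eq_sq, arsinh]
  have hs : √(1 + exp (-f) ^ 2) = √(1 + exp f ^ 2) / exp f := by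
    rw [exp_neg, show 1 + (exp f)⁻¹ ^ 2 = (1 + exp f ^ 2) / exp f ^ 2 by field_simp; ring,
      sqrt_div hc0.le, sqrt_sq (exp_pos f).le]
  have h1 : 1 < √(1 + exp f ^ 2) := lt_sqrt_of_sq_lt (by nlinarith [exp_pos f])
  rw [hs, exp_neg, abs_of_pos (div_pos (by linarith) (by linarith)), one_div, inv_mul_eq_iff_eq_mul₀
    two_ne_zero, ← log_inv, two_mul, ← log_mul (by positivity) (by positivity)]
  congr 1
  have he := exp_pos f
  generalize √(1 + exp f ^ 2) = c at *
  have : c + 1 ≠ 0 := by positivity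
  have : 1 + c ≠ 0 := by positivity
  field_simp
  rw [show exp f ^ 2 = c ^ 2 - 1 by linarith]
  ring

/-- The conformal factor as a function of the coordinate `u`. -/
noncomputable def uInv : Geometry → (ε u : ℝ) → ℝ
  | .euclidean, _, u => u
  | .hyperbolic, ε, u => if ε = 0 then u else -log (sinh (-u))

/-- The range of the coordinate `u`. -/
def uRange : Geometry → (ε : ℝ) → Set ℝ
  | .euclidean, _ => Set.univ
  | .hyperbolic, ε => {u | ε ≠ 0 → u < 0}

theorem uRange_convex (g : Geometry) (ε : ℝ) : Convex ℝ (uRange g ε) := by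
  cases g
  · exact convex_univ
  · by_cases h : ε = 0
    · simp [uRange, h, convex_univ]
    · simp only [uRange, h, ne_eq, not_false_eq_true, true_imp_iff]
      exact convex_Iio 0

theorem uCoord_mem_uRange (g : Geometry) {ε : ℝ} (hε : ε = 0 ∨ ε = 1) (f : ℝ) :
    uCoord g ε f ∈ uRange g ε := by
  cases g
  · trivial
  · rcases hε with rfl | rfl
    · exact fun h => absurd rfl h
    · intro _
      rw [uCoord_hyperbolic_one, neg_lt_zero, arsinh_pos_iff]
      exact exp_pos _

theorem uInv_uCoord (g : Geometry) {ε : ℝ} (hε : ε = 0 ∨ ε = 1) (f : ℝ) :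
    uInv g ε (uCoord g ε f) = f := by
  cases g
  · rfl
  · rcases hε with rfl | rfl
    · simp [uInv, uCoord]
    · rw [uCoord_hyperbolic_one, uInv, if_neg one_ne_zero, neg_neg, sinh_arsinh, log_exp, neg_neg]

theorem uCoord_uInv (g : Geometry) {ε : ℝ} (hε : ε = 0 ∨ ε = 1) {u : ℝ} (hu : u ∈ uRange g ε) :
    uCoord g ε (uInv g ε u) = u := by
  cases g
  · rfl
  · rcases hε with rfl | rfl
    · simp [uInv, uCoord]
    · have : 0 < sinh (-u) := sinh_pos_iff.2 (neg_pos.2 (hu one_ne_zero))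
      rw [uCoord_hyperbolic_one, uInv, if_neg one_ne_zero, neg_neg, exp_log this, arsinh_sinh,
        neg_neg]

theorem hasDerivAt_uInv (g : Geometry) {ε : ℝ} (hε : ε = 0 ∨ ε = 1) {u : ℝ}
    (hu : u ∈ uRange g ε) : HasDerivAt (uInv g ε) (confFactor g ε (uInv g ε u)) u := by
  cases g
  · exact hasDerivAt_id u
  · rcases hε with rfl | rfl
    · have e : uInv .hyperbolic 0 = id := by
        funext u; rw [uInv, if_pos rfl, id]
      rw [e]
      simpa [confFactor] using hasDerivAt_id u
    · have hs : 0 < sinh (-u) := sinh_pos_iff.2 (neg_pos.2 (hu one_ne_zero))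
      have h := ((hasDerivAt_neg u).sinh.log hs.ne').neg
      have e : uInv .hyperbolic 1 = fun u => -log (sinh (-u)) := by
        funext u; rw [uInv, if_neg one_ne_zero]
      rw [e]
      refine h.congr_deriv ?_
      rw [confFactor, one_mul, exp_neg, exp_log hs,
        show 1 + (sinh (-u))⁻¹ ^ 2 = cosh (-u) ^ 2 / sinh (-u) ^ 2 by
          rw [cosh_sq]; field_simp,
        sqrt_div (sq_nonneg _), sqrt_sq (cosh_pos _).le, sqrt_sq hs.le]
      ring

/-! ### Angles at vertices with a large conformal factor -/

/-- A lower bound for `sinh²` of an edge at a vertex with coefficient `1`, with a constant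
independent of the other end. For `ε = 1` it comes from `c₁ * c ≥ 1 + r₁ * r`, for `ε = 0` from `c =
1` and `η ≥ p`. -/
theorem sq_mul_le_sinhSqLength {ε η p r c r₁ c₁ : ℝ} (hε : ε = 0 ∨ ε = 1) (hp : 0 < p)
    (hp1 : p ≤ 1) (hpη : p ≤ ε + η) (hr : 0 < r) (hr₁ : 0 < r₁) (hc : 0 < c) (hc₁ : 0 < c₁)
    (e : c ^ 2 = 1 + ε * r ^ 2) (e₁ : c₁ ^ 2 = 1 + r₁ ^ 2) :
    p ^ 2 * (r₁ ^ 2 * (1 + r ^ 2)) ≤ (c₁ * c + η * (r₁ * r)) ^ 2 - 1 := by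
  rcases hε with rfl | rfl
  · have hc1 : c = 1 := by nlinarith
    subst hc1
    rw [zero_add] at hpη
    have h1 : p * (r₁ * r) ≤ η * (r₁ * r) := by gcongr
    have h2 : (p * (r₁ * r)) ^ 2 ≤ (η * (r₁ * r)) ^ 2 := by gcongr
    have h3 : p ^ 2 * r₁ ^ 2 ≤ 1 * r₁ ^ 2 := by gcongr; exact pow_le_one₀ hp.le hp1
    have h4 : 0 < η * (r₁ * r) := by
      have := hp.trans_le hpη
      positivity
    nlinarith [mul_pos hc₁ h4]
  · have h1 : 1 + r₁ * r ≤ c₁ * c := by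
      rw [← sq_le_sq₀ (by positivity) (by positivity)]
      rw [mul_pow, e, e₁]
      nlinarith [sq_nonneg (r₁ - r)]
    have h2 : (p - 1) * (r₁ * r) ≤ η * (r₁ * r) := by gcongr; linarith
    have h3 : p * (c₁ * c) + (1 - p) ≤ c₁ * c + η * (r₁ * r) := by
      nlinarith [mul_nonneg (sub_nonneg.2 hp1) (sub_nonneg.2 h1)]
    have h4 : 1 ≤ c₁ * c := by nlinarith [mul_pos hr₁ hr]
    have h5 : (p * (c₁ * c) + (1 - p)) ^ 2 ≤ (c₁ * c + η * (r₁ * r)) ^ 2 := by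
      have : 0 ≤ p * (c₁ * c) + (1 - p) := by nlinarith
      gcongr
    have h6 : p ^ 2 * ((c₁ * c) ^ 2 - 1) ≤ (p * (c₁ * c) + (1 - p)) ^ 2 - 1 := by
      nlinarith [mul_nonneg (mul_nonneg hp.le (sub_nonneg.2 hp1)) (sub_nonneg.2 h4)]
    have h7 : r₁ ^ 2 * (1 + r ^ 2) ≤ (c₁ * c) ^ 2 - 1 := by
      rw [mul_pow, e, e₁]; nlinarith [sq_nonneg r]
    have h8 := mul_le_mul_of_nonneg_left h7 (sq_nonneg p)
    linarith

/-- The law of cosines gives at least `1 - cosh l₁ / (sinh l₂ * sinh l₃)`. The numerator is at most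
a constant times `√(1 + r₂²) √(1 + r₃²)`, the denominator at least a constant times `r₁²` and the
same roots, so `f₂` and `f₃` cancel. `q` may leave `[-1, 1]`, since `arccos` clamps. -/
theorem one_sub_cos_bound {ε₂ ε₃ η₁ η₂ η₃ : ℝ} (hε₂ : ε₂ = 0 ∨ ε₂ = 1) (hε₃ : ε₃ = 0 ∨ ε₃ = 1)
    (h₁ : 0 < ε₂ * ε₃ + η₁) (h₂ : 0 < ε₃ * 1 + η₂) (h₃ : 0 < 1 * ε₂ + η₃) :
    ∃ K, 0 < K ∧ ∀ f₁ f₂ f₃ : ℝ, ∃ q, 1 - K * exp (-f₁) ^ 2 ≤ q ∧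
      triangleAngle .hyperbolic (edgeLength .hyperbolic ε₂ ε₃ η₁ f₂ f₃)
        (edgeLength .hyperbolic ε₃ 1 η₂ f₃ f₁) (edgeLength .hyperbolic 1 ε₂ η₃ f₁ f₂) =
        arccos q := by
  set p₂ := min 1 (ε₃ + η₂)
  set p₃ := min 1 (ε₂ + η₃)
  have hp₂ : 0 < p₂ := lt_min one_pos (by linarith)
  have hp₃ : 0 < p₃ := lt_min one_pos (by linarith)
  refine ⟨(1 + |η₁|) / (p₂ * p₃), by positivity, fun f₁ f₂ f₃ => ⟨_, ?_,
    triangleAngle_hyperbolic_eq (edgeLength_pos _ hε₃ (.inr rfl) h₂ _ _)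
      (edgeLength_pos _ (.inr rfl) hε₂ h₃ _ _)⟩⟩
  have k₂ := one_lt_coshEdgeLength hε₃ (.inr rfl) h₂ f₃ f₁
  have k₃ := one_lt_coshEdgeLength (.inr rfl) hε₂ h₃ f₁ f₂
  rw [cosh_edgeLength hε₂ hε₃ h₁, cosh_edgeLength hε₃ (.inr rfl) h₂,
    cosh_edgeLength (.inr rfl) hε₂ h₃, exp_neg]
  have e₁ := confFactor_hyperbolic_sq (.inr rfl) f₁
  have e₂ := confFactor_hyperbolic_sq hε₂ f₂
  have e₃ := confFactor_hyperbolic_sq hε₃ f₃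
  have c₁ := confFactor_pos .hyperbolic (.inr rfl) f₁
  have c₂ := confFactor_pos .hyperbolic hε₂ f₂
  have c₃ := confFactor_pos .hyperbolic hε₃ f₃
  rw [one_mul] at e₁
  have b₂ := sq_mul_le_sinhSqLength hε₃ hp₂ (min_le_left _ _) (min_le_right _ _) (exp_pos f₃)
    (exp_pos f₁) c₃ c₁ e₃ e₁
  have b₃ := sq_mul_le_sinhSqLength hε₂ hp₃ (min_le_left _ _) (min_le_right _ _) (exp_pos f₂)
    (exp_pos f₁) c₂ c₁ e₂ e₁
  rw [mul_comm (confFactor _ _ f₁), mul_comm (exp f₁)] at b₂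
  generalize confFactor .hyperbolic 1 f₁ = d₁ at *
  generalize confFactor .hyperbolic ε₂ f₂ = d₂ at *
  generalize confFactor .hyperbolic ε₃ f₃ = d₃ at *
  have hr₁ := exp_pos f₁
  have hr₂ := exp_pos f₂
  have hr₃ := exp_pos f₃
  generalize exp f₁ = r₁ at *
  generalize exp f₂ = r₂ at *
  generalize exp f₃ = r₃ at *
  have m : d₂ * d₃ + η₁ * (r₂ * r₃) ≤ (1 + |η₁|) * (√(1 + r₂ ^ 2) * √(1 + r₃ ^ 2)) := by
    have a₂ : d₂ ≤ √(1 + r₂ ^ 2) := le_sqrt_of_sq_le (by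
      rcases hε₂ with rfl | rfl <;> nlinarith [sq_nonneg r₂])
    have a₃ : d₃ ≤ √(1 + r₃ ^ 2) := le_sqrt_of_sq_le (by
      rcases hε₃ with rfl | rfl <;> nlinarith [sq_nonneg r₃])
    have a₂' : r₂ ≤ √(1 + r₂ ^ 2) := le_sqrt_of_sq_le (by linarith)
    have a₃' : r₃ ≤ √(1 + r₃ ^ 2) := le_sqrt_of_sq_le (by linarith)
    have a₄ : d₂ * d₃ ≤ √(1 + r₂ ^ 2) * √(1 + r₃ ^ 2) := by gcongr
    have a₅ : η₁ * (r₂ * r₃) ≤ |η₁| * (√(1 + r₂ ^ 2) * √(1 + r₃ ^ 2)) := by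
      gcongr; exact le_abs_self _
    linarith
  generalize d₂ * d₃ + η₁ * (r₂ * r₃) = H₁ at *
  generalize d₃ * d₁ + η₂ * (r₃ * r₁) = H₂ at *
  generalize d₁ * d₂ + η₃ * (r₁ * r₂) = H₃ at *
  have s₂ : 0 < H₂ ^ 2 - 1 := by nlinarith
  have s₃ : 0 < H₃ ^ 2 - 1 := by nlinarith
  rw [sqrt_mul s₂.le]
  have t₂ : p₂ * (r₁ * √(1 + r₃ ^ 2)) ≤ √(H₂ ^ 2 - 1) := by
    apply le_sqrt_of_sq_le
    rwa [mul_pow, mul_pow, sq_sqrt (by positivity)]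
  have t₃ : p₃ * (r₁ * √(1 + r₂ ^ 2)) ≤ √(H₃ ^ 2 - 1) := by
    apply le_sqrt_of_sq_le
    rwa [mul_pow, mul_pow, sq_sqrt (by positivity)]
  have w₂ : √(H₂ ^ 2 - 1) ≤ H₂ := sqrt_le_iff.2 ⟨by linarith, by linarith⟩
  have w₃ : √(H₃ ^ 2 - 1) ≤ H₃ := sqrt_le_iff.2 ⟨by linarith, by linarith⟩
  have q₂ := sqrt_pos.2 s₂
  have q₃ := sqrt_pos.2 s₃
  rw [le_div_iff₀ (by positivity)]
  have v : √(H₂ ^ 2 - 1) * √(H₃ ^ 2 - 1) ≤ H₂ * H₃ := by gcongr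
  have v' : p₂ * (r₁ * √(1 + r₃ ^ 2)) * (p₃ * (r₁ * √(1 + r₂ ^ 2))) ≤
      √(H₂ ^ 2 - 1) * √(H₃ ^ 2 - 1) := by gcongr
  have v'' : H₁ ≤ (1 + |η₁|) / (p₂ * p₃) * r₁⁻¹ ^ 2 * (√(H₂ ^ 2 - 1) * √(H₃ ^ 2 - 1)) := by
    refine m.trans (le_trans (le_of_eq ?_) (mul_le_mul_of_nonneg_left v' (by positivity)))
    field_simp
  linarith

theorem exists_forall_extTriangleAngle_le {ε₂ ε₃ η₁ η₂ η₃ β : ℝ} (hε₂ : ε₂ = 0 ∨ ε₂ = 1)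
    (hε₃ : ε₃ = 0 ∨ ε₃ = 1) (h₁ : 0 < ε₂ * ε₃ + η₁) (h₂ : 0 < ε₃ * 1 + η₂)
    (h₃ : 0 < 1 * ε₂ + η₃) (hβ : 0 < β) :
    ∃ R, ∀ f₁ f₂ f₃ : ℝ, R ≤ f₁ →
      extTriangleAngle .hyperbolic (edgeLength .hyperbolic ε₂ ε₃ η₁ f₂ f₃)
        (edgeLength .hyperbolic ε₃ 1 η₂ f₃ f₁) (edgeLength .hyperbolic 1 ε₂ η₃ f₁ f₂) ≤ β := by
  obtain ⟨K, hK, h⟩ := one_sub_cos_bound hε₂ hε₃ h₁ h₂ h₃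
  have hm : 0 < min β π := lt_min hβ pi_pos
  have hcos : 0 < 1 - cos (min β π) := by
    have := cos_lt_cos_of_nonneg_of_le_pi le_rfl (min_le_right β π) hm
    rw [cos_zero] at this
    linarith
  have hlim : Filter.Tendsto (fun f : ℝ => K * exp (-f) ^ 2) Filter.atTop (nhds (K * 0 ^ 2)) :=
    ((tendsto_exp_neg_atTop_nhds_zero).pow 2).const_mul K
  rw [zero_pow two_ne_zero, mul_zero] at hlim
  obtain ⟨R, hR⟩ := Filter.eventually_atTop.1 (hlim.eventually (gt_mem_nhds hcos))
  refine ⟨R, fun f₁ f₂ f₃ hf => ?_⟩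
  rw [extTriangleAngle_eq _ (edgeLength_pos _ hε₂ hε₃ h₁ _ _)
    (edgeLength_pos _ hε₃ (.inr rfl) h₂ _ _) (edgeLength_pos _ (.inr rfl) hε₂ h₃ _ _)]
  obtain ⟨q, hq, e⟩ := h f₁ f₂ f₃
  have hR' := hR f₁ hf
  rw [e]
  refine le_trans (arccos_le_arccos (by linarith : cos (min β π) ≤ q)) ?_
  rw [arccos_cos hm.le (min_le_right _ _)]
  exact min_le_left _ _

/-- If `φ` rose, some value range in between would avoid the finite set `S`. A slowly rising line
through that range is first met by `φ` at a point outside `S`, where `φ` would have to rise at least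
as fast as the line. -/
theorem antitoneOn_of_hasDerivAt_nonpos_or_mem_finite {φ : ℝ → ℝ} {a b : ℝ} {S : Set ℝ}
    (hS : S.Finite) (hφ : ContinuousOn φ (Set.Icc a b))
    (h : ∀ s ∈ Set.Ioo a b, φ s ∈ S ∨ ∃ φ', φ' ≤ 0 ∧ HasDerivAt φ φ' s) :
    AntitoneOn φ (Set.Icc a b) := by
  intro x hx y hy hxy
  by_contra! hlt
  have hxy' : x < y := lt_of_le_of_ne hxy (by rintro rfl; exact lt_irrefl _ hlt)
  obtain ⟨c, hc, hcS⟩ := ((Set.Ioo_infinite hlt).sdiff hS).nonempty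
  have hopen : IsOpen (Set.Ioo (φ x) (φ y) \ S) := isOpen_Ioo.sdiff hS.isClosed
  obtain ⟨e, he, hball⟩ := Metric.isOpen_iff.1 hopen c ⟨hc, hcS⟩
  -- The line rises from `c` to `c + e / 2`, inside a ball that lies in the gap.
  set B : ℝ → ℝ := fun s => c + e / 2 * ((s - x) / (y - x)) with hB
  have hB' : ∀ s, HasDerivAt B (e / 2 * (1 / (y - x))) s := fun s =>
    ((((hasDerivAt_id s).sub_const x).div_const (y - x)).const_mul (e / 2)).const_add c
  have hBpos : 0 < e / 2 * (1 / (y - x)) := by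
    have := sub_pos.2 hxy'
    positivity
  have hBmem : ∀ s ∈ Set.Icc x y, B s ∈ Set.Ioo (φ x) (φ y) \ S := by
    intro s hs
    apply hball
    have h1 : 0 ≤ (s - x) / (y - x) := div_nonneg (by linarith [hs.1]) (by linarith)
    have h2 : (s - x) / (y - x) ≤ 1 := (div_le_one (by linarith)).2 (by linarith [hs.2])
    rw [Metric.mem_ball, dist_eq, hB, add_sub_cancel_left, abs_of_nonneg (by positivity)]
    nlinarith
  have hsub : Set.Icc x y ⊆ Set.Icc a b := Set.Icc_subset_Icc hx.1 hy.2
  have hcont : ContinuousOn (fun s => φ s - B s) (Set.Icc x y) :=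
    (hφ.mono hsub).sub (fun s _ => (hB' s).continuousAt.continuousWithinAt)
  have hcl : IsCompact (Set.Icc x y ∩ (fun s => φ s - B s) ⁻¹' Set.Ici 0) :=
    isCompact_Icc.of_isClosed_subset (hcont.preimage_isClosed_of_isClosed isClosed_Icc isClosed_Ici)
      Set.inter_subset_left
  obtain ⟨z, ⟨hz, hz0⟩, hmin⟩ := hcl.exists_isLeast
    ⟨y, ⟨hxy, le_rfl⟩, sub_nonneg.2 (hBmem y ⟨hxy, le_rfl⟩).1.2.le⟩
  have hbelow : ∀ s ∈ Set.Ico x z, φ s - B s < 0 := by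
    intro s hs
    by_contra! h'
    exact absurd (hmin ⟨⟨hs.1, hs.2.le.trans hz.2⟩, h'⟩) (not_le.2 hs.2)
  have hxz : x < z := by
    refine lt_of_le_of_ne hz.1 ?_
    rintro rfl
    have := (hBmem x ⟨le_rfl, hxy⟩).1.1
    have : (0 : ℝ) ≤ φ x - B x := hz0
    linarith
  have hzero : φ z - B z = 0 := by
    refine le_antisymm ?_ hz0
    have h1 : Filter.Tendsto (fun s => φ s - B s) (nhdsWithin z (Set.Ico x z))
        (nhds (φ z - B z)) :=
      ((hcont z hz).mono (Set.Ico_subset_Icc_self.trans (Set.Icc_subset_Icc_right hz.2)))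
    have : (nhdsWithin z (Set.Ico x z)).NeBot := by
      rw [nhdsWithin_Ico_eq_nhdsLT hxz]; infer_instance
    exact le_of_tendsto h1 (eventually_nhdsWithin_of_forall fun s hs => (hbelow s hs).le)
  have hzy : z < y := by
    refine lt_of_le_of_ne hz.2 ?_
    rintro rfl
    have := (hBmem z hz).1.2
    linarith
  rcases h z ⟨hx.1.trans_lt hxz, hzy.trans_le hy.2⟩ with hzS | ⟨φ', hφ', hd⟩
  · exact (hBmem z hz).2 (by rwa [sub_eq_zero.1 hzero] at hzS)
  · have hneg : φ' - e / 2 * (1 / (y - x)) < 0 := by linarith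
    have hder := hd.sub (hB' z)
    have hev : ∀ᶠ s in nhdsWithin z (Set.Iio z), slope (φ - B) z s < 0 :=
      ((hasDerivAt_iff_tendsto_slope.1 hder).mono_left
        (nhdsWithin_mono _ fun s hs => ne_of_lt hs)).eventually (gt_mem_nhds hneg)
    have hev2 : ∀ᶠ s in nhdsWithin z (Set.Iio z), s ∈ Set.Ico x z := by
      rw [← nhdsWithin_Ico_eq_nhdsLT hxz]; exact self_mem_nhdsWithin
    obtain ⟨s, hs, hs'⟩ := (hev.and hev2).exists
    rw [slope_def_field, div_neg_iff] at hs
    simp only [Pi.sub_apply, hzero, sub_zero] at hs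
    have := hbelow s hs'
    have := hs'.2
    rcases hs with hs | hs <;> linarith [hs.1, hs.2]

/-! ### Continuity and monotonicity of the angles on a triangulated surface. -/

namespace TriangleGluing

variable {F : Type*} {T : TriangleGluing F} {ε : T.Vertex → ℝ} {η : T.Edge → ℝ}

theorem sideLength_pos (hε : ∀ v, ε v = 0 ∨ ε v = 1) (h1 : T.StructureCondition1 ε η)
    (g : Geometry) (f : T.Vertex → ℝ) (s : F × Fin 3) : 0 < T.sideLength g ε η f s :=
  edgeLength_pos g (hε _) (hε _) (h1 s) _ _

theorem extAngle_eq_angle (hε : ∀ v, ε v = 0 ∨ ε v = 1) (h1 : T.StructureCondition1 ε η)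
    (g : Geometry) (f : T.Vertex → ℝ) (c : F × Fin 3) :
    T.extAngle g ε η f c = T.angle g ε η f c :=
  extTriangleAngle_eq g (sideLength_pos hε h1 g f _) (sideLength_pos hε h1 g f _)
    (sideLength_pos hε h1 g f _)

theorem extCurvature_eq_curvature [Fintype F] (hε : ∀ v, ε v = 0 ∨ ε v = 1)
    (h1 : T.StructureCondition1 ε η) (g : Geometry) :
    T.extCurvature g ε η = T.curvature g ε η := by
  funext f v
  simp only [extCurvature, curvature, extAngle_eq_angle hε h1]

theorem differentiableAt_sideLength {E : Type*} [NormedAddCommGroup E] [NormedSpace ℝ E]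
    (hε : ∀ v, ε v = 0 ∨ ε v = 1) (h1 : T.StructureCondition1 ε η) (g : Geometry)
    {f : E → T.Vertex → ℝ} {x : E} (hf : ∀ v, DifferentiableAt ℝ (fun y => f y v) x)
    (s : F × Fin 3) : DifferentiableAt ℝ (fun y => T.sideLength g ε η (f y) s) x :=
  differentiableAt_edgeLength g (hε _) (hε _) (h1 s) (hf _) (hf _)

theorem continuous_sideLength [Finite F] (hε : ∀ v, ε v = 0 ∨ ε v = 1)
    (h1 : T.StructureCondition1 ε η) (g : Geometry) (s : F × Fin 3) :
    Continuous fun f => T.sideLength g ε η f s :=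
  continuous_iff_continuousAt.2 fun f => (differentiableAt_sideLength hε h1 g
    (f := fun f : T.Vertex → ℝ => f) (fun v => by fun_prop) s).continuousAt

theorem continuous_extAngle [Finite F] (hε : ∀ v, ε v = 0 ∨ ε v = 1)
    (h1 : T.StructureCondition1 ε η) (g : Geometry) (c : F × Fin 3) :
    Continuous fun f => T.extAngle g ε η f c := by
  simp only [extAngle_eq_angle hε h1]
  exact continuous_iff_continuousAt.2 fun f => continuousAt_triangleAngle g
    (continuous_sideLength hε h1 g _).continuousAt (continuous_sideLength hε h1 g _).continuousAt
    (continuous_sideLength hε h1 g _).continuousAt (sideLength_pos hε h1 g f _)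
    (sideLength_pos hε h1 g f _)

variable (T ε) in
/-- The discrete conformal structure with given coordinates `u`. -/
noncomputable def confVec (g : Geometry) (u : T.Vertex → ℝ) (v : T.Vertex) : ℝ :=
  uInv g (ε v) (u v)

variable (T ε) in
/-- The range of the coordinates `u`. -/
def uBox (g : Geometry) : Set (T.Vertex → ℝ) := {u | ∀ v, u v ∈ uRange g (ε v)}

theorem uBox_convex (g : Geometry) : Convex ℝ (uBox T ε g) := by
  intro x hx y hy a b ha hb hab v
  exact uRange_convex g (ε v) (hx v) (hy v) ha hb hab

theorem uVec_mem_uBox (hε : ∀ v, ε v = 0 ∨ ε v = 1) (g : Geometry) (f : T.Vertex → ℝ) :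
    T.uVec g ε f ∈ uBox T ε g := fun v => uCoord_mem_uRange g (hε v) (f v)

theorem confVec_uVec (hε : ∀ v, ε v = 0 ∨ ε v = 1) (g : Geometry) (f : T.Vertex → ℝ) :
    confVec T ε g (T.uVec g ε f) = f := funext fun v => uInv_uCoord g (hε v) (f v)

theorem uVec_confVec (hε : ∀ v, ε v = 0 ∨ ε v = 1) (g : Geometry) {u : T.Vertex → ℝ}
    (hu : u ∈ uBox T ε g) : T.uVec g ε (confVec T ε g u) = u :=
  funext fun v => uCoord_uInv g (hε v) (hu v)

theorem isTriangle_corner {g : Geometry} {f : T.Vertex → ℝ}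
    {t : F} (h : IsTriangle (T.sideLength g ε η f (t, 0)) (T.sideLength g ε η f (t, 1))
      (T.sideLength g ε η f (t, 2))) (a : Fin 3) :
    IsTriangle (T.sideLength g ε η f (t, a)) (T.sideLength g ε η f (t, a + 1))
      (T.sideLength g ε η f (t, a + 2)) := by
  fin_cases a
  · exact h
  · exact h.rotate
  · exact h.rotate.rotate

theorem hasDerivAt_sum_extAngle (hε : ∀ v, ε v = 0 ∨ ε v = 1) (h1 : T.StructureCondition1 ε η)
    (h2 : T.StructureCondition2 ε η) (g : Geometry) (t : F) {u d : T.Vertex → ℝ} {s : ℝ}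
    (hs : u + s • d ∈ uBox T ε g)
    (tri : IsTriangle (T.sideLength g ε η (confVec T ε g (u + s • d)) (t, 0))
      (T.sideLength g ε η (confVec T ε g (u + s • d)) (t, 1))
      (T.sideLength g ε η (confVec T ε g (u + s • d)) (t, 2))) :
    ∃ φ', HasDerivAt (fun s : ℝ => ∑ a : Fin 3, d (T.vertex (t, a)) *
        T.extAngle g ε η (confVec T ε g (u + s • d)) (t, a)) φ' s ∧ φ' ≤ 0 ∧
      (¬ IsNeutral g (d (T.vertex (t, 0))) (d (T.vertex (t, 1))) (d (T.vertex (t, 2))) →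
        φ' < 0) := by
  have hf : ∀ v, HasDerivAt (fun s : ℝ => confVec T ε g (u + s • d) v)
      (confFactor g (ε v) (confVec T ε g (u + s • d) v) * d v) s := by
    intro v
    have h : HasDerivAt (fun s : ℝ => u v + s * d v) (d v) s := by
      simpa using ((hasDerivAt_id s).mul_const (d v)).const_add (u v)
    exact (hasDerivAt_uInv g (hε v) (hs v)).comp s h
  obtain ⟨θ₁, θ₂, θ₃, k₁, k₂, k₃, hle, hlt⟩ := hasDerivAt_angles g (hε (T.vertex (t, 0)))
    (hε (T.vertex (t, 1))) (hε (T.vertex (t, 2))) (h1 (t, 0)) (h1 (t, 1)) (h1 (t, 2)) (h2 t 0)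
    (h2 t 1) (h2 t 2) (hf _) (hf _) (hf _) rfl rfl rfl tri
  refine ⟨_, ?_, hle, hlt⟩
  simp only [Fin.sum_univ_three, extAngle_eq_angle hε h1]
  exact ((k₁.const_mul _).add (k₂.const_mul _)).add (k₃.const_mul _)

/-- Along the segment from `u` to `v` the derivative is nonpositive at nondegenerate triangles; at
degenerate ones one angle is `π` and the others vanish, so the sum is one of three fixed multiples
of `π`. -/
theorem sum_mul_extAngle_le [Finite F] (hε : ∀ v, ε v = 0 ∨ ε v = 1)
    (h1 : T.StructureCondition1 ε η) (h2 : T.StructureCondition2 ε η) (g : Geometry) (t : F)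
    {u v : T.Vertex → ℝ} (hu : u ∈ uBox T ε g) (hv : v ∈ uBox T ε g) :
    ∑ a : Fin 3, (v - u) (T.vertex (t, a)) * T.extAngle g ε η (confVec T ε g v) (t, a) ≤
      ∑ a : Fin 3, (v - u) (T.vertex (t, a)) * T.extAngle g ε η (confVec T ε g u) (t, a) := by
  set d := v - u with hd
  have hmem : ∀ s ∈ Set.Icc (0 : ℝ) 1, u + s • d ∈ uBox T ε g := fun s hs =>
    uBox_convex g |>.add_smul_sub_mem hu hv hs
  have hcont : ContinuousOn (fun s : ℝ => ∑ a : Fin 3, d (T.vertex (t, a)) *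
      T.extAngle g ε η (confVec T ε g (u + s • d)) (t, a)) (Set.Icc 0 1) := by
    refine continuousOn_finsetSum _ fun a _ => continuousOn_const.mul
      ((continuous_extAngle hε h1 g _).comp_continuousOn (continuousOn_pi.2 fun w => ?_))
    intro s hs
    have h : ContinuousAt (fun s : ℝ => u w + s * d w) s := by fun_prop
    exact (ContinuousAt.comp (g := uInv g (ε w)) (f := fun s : ℝ => u w + s * d w)
      (hasDerivAt_uInv g (hε w) (hmem s hs w)).continuousAt h).continuousWithinAt
  have hanti := antitoneOn_of_hasDerivAt_nonpos_or_mem_finite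
    (S := Set.range fun a : Fin 3 => d (T.vertex (t, a)) * π) (Set.finite_range _) hcont ?_
  · have := hanti (Set.left_mem_Icc.2 zero_le_one) (Set.right_mem_Icc.2 zero_le_one) zero_le_one
    simpa [hd] using this
  · intro s hs
    have hs' := hmem s (Set.Ioo_subset_Icc_self hs)
    by_cases tri : IsTriangle (T.sideLength g ε η (confVec T ε g (u + s • d)) (t, 0))
      (T.sideLength g ε η (confVec T ε g (u + s • d)) (t, 1))
      (T.sideLength g ε η (confVec T ε g (u + s • d)) (t, 2))
    · obtain ⟨φ', h, hle, -⟩ := hasDerivAt_sum_extAngle hε h1 h2 g t hs' tri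
      exact .inr ⟨φ', hle, h⟩
    · left
      have e := extTriangleAngle_of_not_isTriangle g (sideLength_pos hε h1 g _ _)
        (sideLength_pos hε h1 g _ _) (sideLength_pos hε h1 g _ _) tri
      have e' : ∀ x y z, T.extAngle g ε η (confVec T ε g (u + s • d)) (t, 0) = x →
          T.extAngle g ε η (confVec T ε g (u + s • d)) (t, 1) = y →
          T.extAngle g ε η (confVec T ε g (u + s • d)) (t, 2) = z →
          ∑ a : Fin 3, d (T.vertex (t, a)) * T.extAngle g ε η (confVec T ε g (u + s • d)) (t, a) =
            d (T.vertex (t, 0)) * x + d (T.vertex (t, 1)) * y + d (T.vertex (t, 2)) * z := by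
        rintro _ _ _ rfl rfl rfl
        exact Fin.sum_univ_three _
      rcases e with ⟨a, b, c⟩ | ⟨a, b, c⟩ | ⟨a, b, c⟩
      · exact ⟨0, by simp [e' _ _ _ a b c]⟩
      · exact ⟨1, by simp [e' _ _ _ a b c]⟩
      · exact ⟨2, by simp [e' _ _ _ a b c]⟩

/-- A direction in which no angle varies to first order. -/
def IsNeutralVec (T : TriangleGluing F) : Geometry → (T.Vertex → ℝ) → Prop
  | .euclidean, d => ∃ c, ∀ v, d v = c
  | .hyperbolic, d => d = 0

/-- In the Euclidean case `d` is constant on every triangle; glued triangles share vertices, so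
connectedness makes the constants equal. -/
theorem isNeutralVec_of_isNeutral (hT : T.IsConnected) (g : Geometry) {d : T.Vertex → ℝ}
    (h : ∀ t, IsNeutral g (d (T.vertex (t, 0))) (d (T.vertex (t, 1))) (d (T.vertex (t, 2)))) :
    T.IsNeutralVec g d := by
  cases g
  · have hc : ∀ t a, d (T.vertex (t, a)) = d (T.vertex (t, 2)) := by
      intro t a
      fin_cases a
      exacts [(h t).1, (h t).2, rfl]
    have hglue : ∀ {t t' a b}, T.mate (t, a) = (t', b) →
        d (T.vertex (t, 2)) = d (T.vertex (t', 2)) := by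
      intro t t' a b e
      have e1 : T.vertex (fstCorner (t, a)) = _ := Quot.sound (CornerGlued.fst (t, a))
      rw [← hc t (a + 1), show T.vertex (t, a + 1) = _ from e1, e]
      split_ifs <;> exact hc _ _
    have hadj : ∀ t t', (SimpleGraph.fromRel fun t t' : F => ∃ a b, T.mate (t, a) = (t', b)).Adj
        t t' → d (T.vertex (t, 2)) = d (T.vertex (t', 2)) := by
      intro t t' hadj
      rw [SimpleGraph.fromRel_adj] at hadj
      rcases hadj.2 with ⟨a, b, e⟩ | ⟨a, b, e⟩
      exacts [hglue e, (hglue e).symm]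
    obtain ⟨t₀⟩ := hT.nonempty
    refine ⟨d (T.vertex (t₀, 2)), fun v => ?_⟩
    obtain ⟨⟨t, a⟩, rfl⟩ := Quot.exists_rep v
    refine (hc t a).trans ?_
    obtain ⟨w⟩ := hT.preconnected t t₀
    induction w with
    | nil => rfl
    | cons hadj' _ ih => exact (hadj _ _ hadj').trans ih
  · funext v
    obtain ⟨⟨t, a⟩, rfl⟩ := Quot.exists_rep v
    fin_cases a
    exacts [(h t).1, (h t).2.1, (h t).2.2]

theorem sideLength_euclidean_add_const (f : T.Vertex → ℝ) (c : ℝ) (s : F × Fin 3) :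
    T.sideLength .euclidean ε η (fun v => f v + c) s =
      exp c * T.sideLength .euclidean ε η f s := by
  rw [sideLength, sideLength, edgeLength_euclidean_eq, edgeLength_euclidean_eq]
  conv_rhs => rw [← sqrt_sq (exp_pos c).le, ← sqrt_mul (sq_nonneg _)]
  simp only [exp_add]
  congr 1
  ring

theorem isConformalStructure_add_const {f : T.Vertex → ℝ} (c : ℝ)
    (hf : T.IsConformalStructure .euclidean ε η f) :
    T.IsConformalStructure .euclidean ε η fun v => f v + c := by
  intro t
  obtain ⟨⟨h1, h2, h3⟩, h4, h5, h6⟩ := hf t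
  have hc := exp_pos c
  simp only [sideLength_euclidean_add_const]
  refine ⟨⟨by positivity, by positivity, by positivity⟩, ?_, ?_, ?_⟩ <;>
    rw [← mul_add] <;> gcongr

end TriangleGluing

namespace TriangleGluing

variable {F : Type*} [Fintype F] {T : TriangleGluing F} {ε : T.Vertex → ℝ} {η : T.Edge → ℝ}

/-! ### The vector field of the extended flow -/

variable (T ε η) in
/-- The right-hand side of the extended flow in the coordinates `u`. -/
noncomputable def flowField (g : Geometry) (Kbar u : T.Vertex → ℝ) (v : T.Vertex) : ℝ :=
  Kbar v - T.extCurvature g ε η (confVec T ε g u) v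

open Classical in
theorem sum_mul_sum_corners (d : T.Vertex → ℝ) (θ : F × Fin 3 → ℝ) :
    ∑ v, d v * ∑ c, (if T.vertex c = v then θ c else 0) =
      ∑ t, ∑ a : Fin 3, d (T.vertex (t, a)) * θ (t, a) := by
  simp only [Finset.mul_sum]
  rw [Finset.sum_comm, Fintype.sum_prod_type]
  simp

theorem sum_mul_flowField (g : Geometry) (Kbar u d : T.Vertex → ℝ) :
    ∑ v, d v * flowField T ε η g Kbar u v = ∑ v, d v * (Kbar v - 2 * π) +
      ∑ t, ∑ a : Fin 3, d (T.vertex (t, a)) *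
        T.extAngle g ε η (confVec T ε g u) (t, a) := by
  rw [← sum_mul_sum_corners, ← Finset.sum_add_distrib]
  refine Finset.sum_congr rfl fun v _ => ?_
  rw [flowField, extCurvature]
  ring

theorem flowField_dissipative (hε : ∀ v, ε v = 0 ∨ ε v = 1) (h1 : T.StructureCondition1 ε η)
    (h2 : T.StructureCondition2 ε η) (g : Geometry) (Kbar : T.Vertex → ℝ)
    {u v : T.Vertex → ℝ} (hu : u ∈ uBox T ε g) (hv : v ∈ uBox T ε g) :
    ∑ w, (v w - u w) * (flowField T ε η g Kbar v w - flowField T ε η g Kbar u w) ≤ 0 := by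
  simp only [mul_sub _ (flowField _ _ _ _ _ _ _), Finset.sum_sub_distrib]
  rw [sub_nonpos, sum_mul_flowField, sum_mul_flowField]
  gcongr _ + ?_
  exact Finset.sum_le_sum fun t _ => sum_mul_extAngle_le hε h1 h2 g t hu hv

theorem continuousOn_flowField (hε : ∀ v, ε v = 0 ∨ ε v = 1) (h1 : T.StructureCondition1 ε η)
    (g : Geometry) (Kbar : T.Vertex → ℝ) :
    ContinuousOn (flowField T ε η g Kbar) (uBox T ε g) := by
  classical
  have hconf : ContinuousOn (confVec T ε g) (uBox T ε g) := continuousOn_pi.2 fun v u hu =>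
    (ContinuousAt.comp (g := uInv g (ε v)) (f := fun u : T.Vertex → ℝ => u v)
      (hasDerivAt_uInv g (hε v) (hu v)).continuousAt
      (continuous_apply v).continuousAt).continuousWithinAt
  refine continuousOn_pi.2 fun v => ContinuousOn.sub continuousOn_const
    (ContinuousOn.sub continuousOn_const (continuousOn_finsetSum _ fun c _ => ?_))
  by_cases h : T.vertex c = v
  · simp only [h, if_true]
    exact (continuous_extAngle hε h1 g c).comp_continuousOn hconf
  · simp only [h, if_false]
    exact continuousOn_const

theorem abs_flowField_le (g : Geometry) (Kbar u : T.Vertex → ℝ) (v : T.Vertex) :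
    |flowField T ε η g Kbar u v| ≤ ∑ w, |Kbar w| + 2 * π + Fintype.card (F × Fin 3) * π := by
  classical
  have h0 : 0 ≤ ∑ c, (if T.vertex c = v then T.extAngle g ε η (confVec T ε g u) c else 0) :=
    Finset.sum_nonneg fun c _ => by split_ifs; exacts [extTriangleAngle_nonneg _ _ _ _, le_rfl]
  have h1 : ∑ c, (if T.vertex c = v then T.extAngle g ε η (confVec T ε g u) c else 0) ≤
      Fintype.card (F × Fin 3) * π := by
    rw [← nsmul_eq_mul, ← Finset.card_univ]
    refine Finset.sum_le_card_nsmul _ _ _ fun c _ => ?_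
    split_ifs
    exacts [extTriangleAngle_le_pi _ _ _ _, pi_pos.le]
  have h2 : |Kbar v| ≤ ∑ w, |Kbar w| :=
    Finset.single_le_sum (f := fun w => |Kbar w|) (fun w _ => abs_nonneg _) (Finset.mem_univ v)
  have h3 := abs_le.1 h2
  have := pi_pos
  rw [flowField, extCurvature, abs_le]
  constructor <;> linarith [h3.1, h3.2]

/-- The derivative of `∑ d * X` along the line in direction `d` is computed twice: through the total
derivative, and as a sum over triangles of nonpositive terms that are not all zero unless `d` is
neutral. -/
theorem exists_hasFDerivAt_flowField (hT : T.IsConnected) (hε : ∀ v, ε v = 0 ∨ ε v = 1)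
    (h1 : T.StructureCondition1 ε η) (h2 : T.StructureCondition2 ε η) (g : Geometry)
    (Kbar : T.Vertex → ℝ) {f : T.Vertex → ℝ} (hf : T.IsConformalStructure g ε η f) :
    ∃ L : (T.Vertex → ℝ) →L[ℝ] (T.Vertex → ℝ),
      HasFDerivAt (flowField T ε η g Kbar) L (T.uVec g ε f) ∧
        ∀ d, ¬ T.IsNeutralVec g d → ∑ v, d v * L d v < 0 := by
  classical
  set u := T.uVec g ε f with hu_def
  have hu : u ∈ uBox T ε g := uVec_mem_uBox hε g f
  have hfu : confVec T ε g u = f := confVec_uVec hε g f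
  have hconf : ∀ v, DifferentiableAt ℝ (fun u => confVec T ε g u v) u := fun v =>
    DifferentiableAt.comp (g := uInv g (ε v)) (f := fun u : T.Vertex → ℝ => u v) u
      (hasDerivAt_uInv g (hε v) (hu v)).differentiableAt (by fun_prop)
  have hangle : ∀ c, DifferentiableAt ℝ
      (fun u => T.extAngle g ε η (confVec T ε g u) c) u := by
    rintro ⟨t, a⟩
    simp only [extAngle_eq_angle hε h1]
    refine differentiableAt_triangleAngle g (differentiableAt_sideLength hε h1 g hconf _)
      (differentiableAt_sideLength hε h1 g hconf _) (differentiableAt_sideLength hε h1 g hconf _) ?_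
    rw [hfu]
    exact isTriangle_corner (hf t) a
  have hX : DifferentiableAt ℝ (flowField T ε η g Kbar) u := by
    refine differentiableAt_pi.2 fun v => DifferentiableAt.const_sub
      (DifferentiableAt.const_sub (DifferentiableAt.fun_sum fun c _ => ?_) _) _
    by_cases h : T.vertex c = v
    · simp only [h, if_true]
      exact hangle c
    · simp only [h, if_false]
      exact differentiableAt_const _
  refine ⟨_, hX.hasFDerivAt, fun d hd => ?_⟩
  have hline : HasDerivAt (fun s : ℝ => u + s • d) d 0 := by
    simpa using ((hasDerivAt_id (0 : ℝ)).smul_const d).const_add u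
  have hcomp : HasDerivAt (fun s : ℝ => flowField T ε η g Kbar (u + s • d))
      (fderiv ℝ (flowField T ε η g Kbar) u d) 0 := by
    have e : u = u + (0 : ℝ) • d := by simp
    have hX' := hX.hasFDerivAt
    nth_rewrite 2 [e] at hX'
    exact hX'.comp_hasDerivAt (0 : ℝ) hline
  have hsum : HasDerivAt (fun s : ℝ => ∑ v, d v * flowField T ε η g Kbar (u + s • d) v)
      (∑ v, d v * fderiv ℝ (flowField T ε η g Kbar) u d v) 0 :=
    HasDerivAt.fun_sum fun v _ => (hasDerivAt_pi.1 hcomp v).const_mul (d v)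
  have h0 : u + (0 : ℝ) • d = u := by simp
  choose φ' hφ' hle hlt using fun t => hasDerivAt_sum_extAngle (u := u) (d := d) (s := 0) hε h1 h2 g
    t (by rwa [h0]) (by rw [h0, hfu]; exact hf t)
  have hsum' : HasDerivAt (fun s : ℝ => ∑ v, d v * flowField T ε η g Kbar (u + s • d) v)
      (∑ t, φ' t) 0 := by
    simp only [sum_mul_flowField]
    exact (HasDerivAt.fun_sum fun t _ => hφ' t).const_add _
  rw [hsum.unique hsum']
  refine Finset.sum_neg' (fun t _ => hle t) ?_
  by_contra! hall
  exact hd (isNeutralVec_of_isNeutral hT g fun t => by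
    by_contra hn
    exact absurd (hlt t hn) (not_lt.2 (hall t (Finset.mem_univ t))))

/-! ### The total curvature in the Euclidean case -/

theorem sum_extCurvature_euclidean (hε : ∀ v, ε v = 0 ∨ ε v = 1)
    (h1 : T.StructureCondition1 ε η) (f : T.Vertex → ℝ) :
    ∑ v, T.extCurvature .euclidean ε η f v =
      2 * π * Fintype.card T.Vertex - π * Fintype.card F := by
  classical
  have h := sum_mul_sum_corners (T := T) (fun _ => 1) (T.extAngle .euclidean ε η f)
  simp only [one_mul, Fin.sum_univ_three] at h
  simp only [extCurvature]
  rw [Finset.sum_sub_distrib, h]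
  have : ∀ t : F, T.extAngle .euclidean ε η f (t, 0) + T.extAngle .euclidean ε η f (t, 1) +
      T.extAngle .euclidean ε η f (t, 2) = π := fun t =>
    euclidean_extTriangleAngle_sum (sideLength_pos hε h1 _ f _) (sideLength_pos hε h1 _ f _)
      (sideLength_pos hε h1 _ f _)
  simp only [this, Finset.sum_const, Finset.card_univ, nsmul_eq_mul]
  ring

/-- `mate` is an involution without fixed points, so every fibre of `edge` has exactly two sides.
This brings the Euler characteristic into the total curvature. -/
theorem two_mul_card_edge (T : TriangleGluing F) :
    2 * Fintype.card T.Edge = 3 * Fintype.card F := by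
  classical
  have hfib : ∀ s s' : F × Fin 3, T.edge s = T.edge s' ↔ s = s' ∨ s = T.mate s' := by
    intro s s'
    constructor
    · intro h
      induction Quot.eqvGen_exact h with
      | rel x y e => right; rw [e, T.mate_mate]
      | refl x => left; rfl
      | symm x y _ ih =>
        rcases ih (Quot.eqvGen_sound ‹_›) with rfl | rfl
        · left; rfl
        · right; rw [T.mate_mate]
      | trans x y z hxy hyz ih ih' =>
        rcases ih (Quot.eqvGen_sound hxy) with rfl | rfl <;>
          rcases ih' (Quot.eqvGen_sound hyz) with rfl | rfl
        · left; rfl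
        · right; rfl
        · right; rfl
        · left; rw [T.mate_mate]
    · rintro (rfl | rfl)
      · rfl
      · exact (Quot.sound (r := fun s s' : F × Fin 3 => s' = T.mate s) rfl).symm
  have hcard : ∀ e : T.Edge, (Finset.univ.filter fun s => T.edge s = e).card = 2 := by
    intro e
    obtain ⟨s, rfl⟩ := Quot.exists_rep e
    rw [← Finset.card_pair (T.mate_ne s).symm]
    congr 1
    ext s'
    simp only [Finset.mem_filter, Finset.mem_univ, true_and, Finset.mem_insert,
      Finset.mem_singleton]
    exact hfib s' s
  have := Finset.card_eq_sum_card_fiberwise (s := (Finset.univ : Finset (F × Fin 3)))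
    (t := (Finset.univ : Finset T.Edge)) (f := T.edge) (fun _ _ => Finset.mem_univ _)
  simp only [hcard, Finset.sum_const, Finset.card_univ, Fintype.card_prod, Fintype.card_fin,
    smul_eq_mul] at this
  omega

theorem sum_extCurvature_euclidean_eq_eulerChar (hε : ∀ v, ε v = 0 ∨ ε v = 1)
    (h1 : T.StructureCondition1 ε η) (f : T.Vertex → ℝ) :
    ∑ v, T.extCurvature .euclidean ε η f v = 2 * π * T.eulerChar := by
  have h : (2 : ℝ) * Fintype.card T.Edge = 3 * Fintype.card F := by
    exact_mod_cast T.two_mul_card_edge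
  rw [sum_extCurvature_euclidean hε h1, eulerChar]
  push_cast
  linear_combination π * h

theorem curvature_euclidean_add_const (f : T.Vertex → ℝ) (c : ℝ) :
    T.curvature .euclidean ε η (fun v => f v + c) = T.curvature .euclidean ε η f := by
  funext v
  have h : ∀ k, T.angle .euclidean ε η (fun v => f v + c) k = T.angle .euclidean ε η f k := by
    intro k
    simp only [angle, sideLength_euclidean_add_const, triangleAngle]
    congr 1
    have := (exp_pos c).ne'
    rw [← mul_div_mul_left _ (2 * T.sideLength .euclidean ε η f (k.1, k.2 + 1) * _)
      (pow_ne_zero 2 this)]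
    ring
  simp only [curvature, h]

end TriangleGluing

open Real Set Filter Topology

/-! ### Flows of dissipative vector fields -/

section

variable {ι : Type*} [Fintype ι]

/-- A vector field whose flow does not increase distances. -/
def DissipativeOn (X : (ι → ℝ) → ι → ℝ) (S : Set (ι → ℝ)) : Prop :=
  ∀ u ∈ S, ∀ v ∈ S, ∑ i, (v i - u i) * (X v i - X u i) ≤ 0

theorem hasDerivWithinAt_sum_sq_sub {x y : ℝ → ι → ℝ} {x' y' : ι → ℝ} {D : Set ℝ} {t : ℝ}
    (hx : HasDerivWithinAt x x' D t) (hy : HasDerivWithinAt y y' D t) :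
    HasDerivWithinAt (fun t => ∑ i, (x t i - y t i) ^ 2)
      (2 * ∑ i, (x t i - y t i) * (x' i - y' i)) D t := by
  rw [Finset.mul_sum]
  refine HasDerivWithinAt.fun_sum fun i _ => ?_
  refine (((hasDerivWithinAt_pi.1 hx i).sub (hasDerivWithinAt_pi.1 hy i)).pow 2).congr_deriv ?_
  simp only [Pi.sub_apply, Nat.cast_ofNat]
  ring

/-- The norm of `ι → ℝ` is the maximum norm, whereas dissipativity refers to the Euclidean one; this
and the next two inequalities translate. -/
theorem norm_sq_le_sum_sq (d : ι → ℝ) : ‖d‖ ^ 2 ≤ ∑ i, d i ^ 2 := by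
  have h : ‖d‖ ≤ √(∑ i, d i ^ 2) := by
    refine (pi_norm_le_iff_of_nonneg (sqrt_nonneg _)).2 fun i => ?_
    rw [norm_eq_abs]
    exact abs_le_sqrt (Finset.single_le_sum (f := fun i => d i ^ 2) (fun i _ => sq_nonneg _)
      (Finset.mem_univ i))
  exact (le_sqrt (norm_nonneg _) (Finset.sum_nonneg fun i _ => sq_nonneg _)).1 h

theorem sum_sq_le_card_mul_norm_sq (d : ι → ℝ) : ∑ i, d i ^ 2 ≤ Fintype.card ι * ‖d‖ ^ 2 := by
  rw [← nsmul_eq_mul, ← Finset.card_univ]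
  refine Finset.sum_le_card_nsmul _ _ _ fun i _ => ?_
  rw [← sq_abs, ← norm_eq_abs]
  gcongr
  exact norm_le_pi_norm d i

theorem sum_mul_le_card_mul_norm (d e : ι → ℝ) :
    ∑ i, d i * e i ≤ Fintype.card ι * (‖d‖ * ‖e‖) := by
  rw [← nsmul_eq_mul, ← Finset.card_univ]
  refine Finset.sum_le_card_nsmul _ _ _ fun i _ => ?_
  refine (le_abs_self _).trans ?_
  rw [abs_mul, ← norm_eq_abs, ← norm_eq_abs]
  gcongr
  exacts [norm_le_pi_norm d i, norm_le_pi_norm e i]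

theorem DissipativeOn.antitoneOn_sum_sq_sub {X : (ι → ℝ) → ι → ℝ} {S : Set (ι → ℝ)}
    (hX : DissipativeOn X S) {D : Set ℝ} (hD : Convex ℝ D) {x y : ℝ → ι → ℝ}
    (hx : ∀ t ∈ D, x t ∈ S ∧ HasDerivWithinAt x (X (x t)) D t)
    (hy : ∀ t ∈ D, y t ∈ S ∧ HasDerivWithinAt y (X (y t)) D t) :
    AntitoneOn (fun t => ∑ i, (x t i - y t i) ^ 2) D := by
  have hd := fun t ht => hasDerivWithinAt_sum_sq_sub (hx t ht).2 (hy t ht).2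
  refine antitoneOn_of_hasDerivWithinAt_nonpos hD (fun t ht => (hd t ht).continuousWithinAt)
    (fun t ht => (hd t (interior_subset ht)).mono interior_subset) fun t ht => ?_
  have := hX (y t) (hy t (interior_subset ht)).1 (x t) (hx t (interior_subset ht)).1
  linarith

theorem DissipativeOn.eqOn {X : (ι → ℝ) → ι → ℝ} {S : Set (ι → ℝ)}
    (hX : DissipativeOn X S) {D : Set ℝ} (hD : Convex ℝ D) (h0 : 0 ∈ D) (hD0 : ∀ t ∈ D, 0 ≤ t)
    {x y : ℝ → ι → ℝ} (hx : ∀ t ∈ D, x t ∈ S ∧ HasDerivWithinAt x (X (x t)) D t)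
    (hy : ∀ t ∈ D, y t ∈ S ∧ HasDerivWithinAt y (X (y t)) D t) (h : x 0 = y 0) :
    EqOn x y D := by
  intro t ht
  have hle := hX.antitoneOn_sum_sq_sub hD hx hy h0 ht (hD0 t ht)
  simp only [h, sub_self, ne_eq, OfNat.ofNat_ne_zero, not_false_eq_true, zero_pow,
    Finset.sum_const_zero] at hle
  have h1 := (norm_sq_le_sum_sq (x t - y t)).trans hle
  have h2 : ‖x t - y t‖ = 0 := by nlinarith [norm_nonneg (x t - y t)]
  exact sub_eq_zero.1 (norm_eq_zero.1 h2)

/-- A merely continuous `X` is outside the scope of Picard–Lindelöf, so it is replaced by a `C¹`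
field within `e`. The integral equation is recorded for the later passage to the limit. -/
theorem exists_approximate_solution {X : (ι → ℝ) → ι → ℝ} (hX : Continuous X) {M : ℝ}
    (hM : ∀ u, ‖X u‖ ≤ M) {T e : ℝ} (hT : 0 ≤ T) (he : 0 < e) (x₀ : ι → ℝ) :
    ∃ Y : (ι → ℝ) → ι → ℝ, Continuous Y ∧ (∀ u, ‖Y u - X u‖ < e) ∧ ∃ x : ℝ → ι → ℝ, x 0 = x₀ ∧
      ∀ t ∈ Icc 0 T, x t = x₀ + (∫ s in (0 : ℝ)..t, Y (x s)) ∧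
        HasDerivWithinAt x (Y (x t)) (Icc 0 T) t := by
  obtain ⟨Y, hY, hYX, -⟩ := hX.exists_contDiff_approx 1 (ε := fun _ => e) continuous_const
    fun _ => he
  simp only [dist_eq_norm] at hYX
  refine ⟨Y, hY.continuous, hYX, ?_⟩
  have hM0 : 0 ≤ M := (norm_nonneg _).trans (hM 0)
  set L : NNReal := ⟨M + e, by positivity⟩
  -- The farthest a solution of speed at most `M + e` can travel in time `T`, so one application
  -- covers all of `[0, T]`.
  set a : NNReal := L * ⟨T, hT⟩
  have hL : ∀ u, ‖Y u‖ ≤ L := fun u => by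
    have h1 := norm_add_le (Y u - X u) (X u)
    rw [sub_add_cancel] at h1
    change _ ≤ M + e
    linarith [hYX u, hM u]
  obtain ⟨K, hK⟩ := (ContDiff.locallyLipschitz (𝕂 := ℝ)
    hY).locallyLipschitzOn.exists_lipschitzOnWith_of_compact (isCompact_closedBall x₀ (a : ℝ))
  have hPL : IsPicardLindelof (fun _ => Y) (⟨0, le_rfl, hT⟩ : Icc (0 : ℝ) T) x₀ a 0 L K := by
    refine IsPicardLindelof.of_time_independent (fun u _ => hL u) hK ?_
    simp only [sub_zero, sub_self, hT, max_eq_left, NNReal.coe_zero]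
    exact le_rfl
  obtain ⟨y, hy0, hy⟩ := hPL.exists_eq_forall_mem_Icc_hasDerivWithinAt₀
  refine ⟨y, hy0, fun t ht => ⟨?_, hy t ht⟩⟩
  have hycont : ContinuousOn y (Icc 0 T) := fun s hs => (hy s hs).continuousWithinAt
  have hsub : Icc 0 t ⊆ Icc 0 T := Icc_subset_Icc_right ht.2
  have := intervalIntegral.integral_eq_sub_of_hasDeriv_right_of_le ht.1 (hycont.mono hsub)
    (f' := fun s => Y (y s))
    (fun s hs => (hy s (hsub (Ioo_subset_Icc_self hs))).mono_of_mem_nhdsWithin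
      (Icc_mem_nhdsGT_of_mem ⟨hs.1.le, hs.2.trans_le ht.2⟩))
    ((hY.continuous.comp_continuousOn (hycont.mono hsub)).intervalIntegrable_of_Icc ht.1)
  rw [this, show y 0 = x₀ from hy0, add_sub_cancel]

/-- The derivative of the squared distance splits into a dissipative part, which is nonpositive, and
a part linear in the errors `e` and `e'`. It makes approximate solutions a Cauchy sequence. -/
theorem DissipativeOn.sum_sq_sub_le {X : (ι → ℝ) → ι → ℝ} {S : Set (ι → ℝ)}
    (hX : DissipativeOn X S) {T R e e' : ℝ} {x y x' y' : ℝ → ι → ℝ}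
    (hx : ∀ t ∈ Icc 0 T, x t ∈ S ∧ HasDerivWithinAt x (x' t) (Icc 0 T) t)
    (hy : ∀ t ∈ Icc 0 T, y t ∈ S ∧ HasDerivWithinAt y (y' t) (Icc 0 T) t)
    (hx' : ∀ t ∈ Icc 0 T, ‖x' t - X (x t)‖ ≤ e) (hy' : ∀ t ∈ Icc 0 T, ‖y' t - X (y t)‖ ≤ e')
    (hR : ∀ t ∈ Icc 0 T, ‖x t - y t‖ ≤ R) (h0 : x 0 = y 0) {t : ℝ} (ht : t ∈ Icc 0 T) :
    ∑ i, (x t i - y t i) ^ 2 ≤ 2 * (Fintype.card ι * (R * (e + e'))) * t := by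
  have hd := fun t ht => (hasDerivWithinAt_sum_sq_sub (hx t ht).2 (hy t ht).2).sub
    ((hasDerivAt_id t).const_mul (2 * (Fintype.card ι * (R * (e + e'))))).hasDerivWithinAt
  have hanti := antitoneOn_of_hasDerivWithinAt_nonpos (convex_Icc 0 T)
    (fun t ht => (hd t ht).continuousWithinAt)
    (fun t ht => (hd t (interior_subset ht)).mono interior_subset) fun t ht => ?_
  · have := hanti ⟨le_rfl, ht.1.trans ht.2⟩ ht ht.1
    simpa [h0] using this
  · have ht := interior_subset ht
    have h1 := hX (y t) (hy t ht).1 (x t) (hx t ht).1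
    have h2 := sum_mul_le_card_mul_norm (x t - y t) ((x' t - X (x t)) - (y' t - X (y t)))
    have h3 : ‖(x' t - X (x t)) - (y' t - X (y t))‖ ≤ e + e' :=
      (norm_sub_le _ _).trans (add_le_add (hx' t ht) (hy' t ht))
    have h4 : ‖x t - y t‖ * ‖(x' t - X (x t)) - (y' t - X (y t))‖ ≤ R * (e + e') :=
      mul_le_mul (hR t ht) h3 (norm_nonneg _) ((norm_nonneg _).trans (hR t ht))
    have h5 := h2.trans (mul_le_mul_of_nonneg_left h4 (Nat.cast_nonneg _))
    have h6 : ∑ i, (x t i - y t i) * (x' t i - y' t i) =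
        ∑ i, (x t i - y t i) * (X (x t) i - X (y t) i) +
          ∑ i, (x t - y t) i * ((x' t - X (x t)) - (y' t - X (y t))) i := by
      rw [← Finset.sum_add_distrib]
      refine Finset.sum_congr rfl fun i _ => ?_
      simp only [Pi.sub_apply]
      ring
    rw [h6]
    linarith

theorem DissipativeOn.exists_solution_Icc {X : (ι → ℝ) → ι → ℝ} (hXc : Continuous X) {M : ℝ}
    (hM : ∀ u, ‖X u‖ ≤ M) {J : Set ι} {b : ι → ℝ} {δ : ℝ} (hδ : 0 < δ)
    (hb : ∀ i ∈ J, ∀ u, u i = b i → X u i ≤ -δ) (hX : DissipativeOn X {u | ∀ i ∈ J, u i ≤ b i})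
    {x₀ : ι → ℝ} (hx₀ : ∀ i ∈ J, x₀ i ≤ b i) {T : ℝ} (hT : 0 ≤ T) :
    ∃ x : ℝ → ι → ℝ, x 0 = x₀ ∧ ∀ t ∈ Icc 0 T, x t ∈ {u | ∀ i ∈ J, u i ≤ b i} ∧
      HasDerivWithinAt x (X (x t)) (Icc 0 T) t := by
  have hM0 : 0 ≤ M := (norm_nonneg _).trans (hM 0)
  choose Y hYc hY x hx0 hx using fun n : ℕ => exists_approximate_solution hXc hM hT
    (div_pos hδ (Nat.cast_add_one_pos n)) x₀
  have hle : ∀ n : ℕ, δ / (n + 1) ≤ δ := fun n =>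
    div_le_self hδ.le (by linarith [(Nat.cast_nonneg n : (0 : ℝ) ≤ n)])
  have hYM : ∀ n u, ‖Y n u‖ ≤ M + δ := fun n u => by
    have h1 := norm_add_le (Y n u - X u) (X u)
    rw [sub_add_cancel] at h1
    linarith [(hY n u).le.trans (hle n), hM u]
  have hcont : ∀ n, ContinuousOn (x n) (Icc 0 T) := fun n t ht => (hx n t ht).2.continuousWithinAt
  -- On the face `u i = b i` the component of `X` is at most `-δ`, and the approximation error is
  -- strictly below `δ / (n + 1) ≤ δ`, so the approximating field points strictly inwards.
  have hmem : ∀ n, ∀ t ∈ Icc 0 T, x n t ∈ {u | ∀ i ∈ J, u i ≤ b i} := by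
    intro n t ht i hi
    refine image_le_of_deriv_right_lt_deriv_boundary (f := fun t => x n t i)
      (f' := fun t => Y n (x n t) i) (B := fun _ => b i) (B' := fun _ => 0)
      (continuousOn_pi.1 (hcont n) i) (fun s hs => ?_) (by simpa [hx0] using hx₀ i hi)
      (fun s => hasDerivAt_const _ _) (fun s hs he => ?_) ht
    · exact (hasDerivWithinAt_pi.1 (hx n s (Ico_subset_Icc_self hs)).2 i).mono_of_mem_nhdsWithin
        (Icc_mem_nhdsGE_of_mem hs)
    · have h1 := hb i hi (x n s) he
      have h2 := (norm_le_pi_norm (Y n (x n s) - X (x n s)) i).trans_lt (hY n (x n s))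
      rw [norm_eq_abs, Pi.sub_apply, abs_lt] at h2
      linarith [h2.2, hle n]
  have hdist : ∀ n, ∀ t ∈ Icc 0 T, ‖x n t - x₀‖ ≤ (M + δ) * T := by
    intro n t ht
    have := (convex_Icc 0 T).norm_image_sub_le_of_norm_hasDerivWithin_le
      (fun s hs => (hx n s hs).2) (fun s _ => hYM n (x n s)) ⟨le_rfl, hT⟩ ht
    rw [hx0, sub_zero, norm_of_nonneg ht.1] at this
    exact this.trans (by gcongr; exact ht.2)
  set C : ℝ := 2 * (Fintype.card ι * (2 * ((M + δ) * T))) * T with hC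
  have hC0 : 0 ≤ C := by positivity
  have hcauchy : ∀ n m, ∀ t ∈ Icc 0 T,
      ‖x n t - x m t‖ ^ 2 ≤ C * (δ / (n + 1) + δ / (m + 1)) := by
    intro n m t ht
    refine (norm_sq_le_sum_sq _).trans ((hX.sum_sq_sub_le
      (fun t ht => ⟨hmem n t ht, (hx n t ht).2⟩) (fun t ht => ⟨hmem m t ht, (hx m t ht).2⟩)
      (fun t _ => (hY n _).le) (fun t _ => (hY m _).le) (R := 2 * ((M + δ) * T)) ?_
      ((hx0 n).trans (hx0 m).symm) ht).trans ?_)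
    · intro t ht
      have h1 := norm_sub_le (x n t - x₀) (x m t - x₀)
      rw [sub_sub_sub_cancel_right] at h1
      linarith [hdist n t ht, hdist m t ht]
    · rw [hC]
      have h1 : (0 : ℝ) ≤ δ / (n + 1) + δ / (m + 1) := by positivity
      have : 2 * (Fintype.card ι * (2 * ((M + δ) * T) * (δ / (n + 1) + δ / (m + 1)))) * t ≤
          2 * (Fintype.card ι * (2 * ((M + δ) * T) * (δ / (n + 1) + δ / (m + 1)))) * T := by
        gcongr
        exact ht.2
      linarith
  have hδn : Tendsto (fun n : ℕ => δ / ((n : ℝ) + 1)) atTop (𝓝 0) :=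
    tendsto_const_div_atTop_nhds_zero_nat δ |>.comp (tendsto_add_atTop_nat 1) |>.congr fun n => by
      simp
  have hunif : UniformCauchySeqOn x atTop (Icc 0 T) := by
    rw [Metric.uniformCauchySeqOn_iff]
    intro e he
    have hlim : Tendsto (fun n : ℕ => C * (δ / ((n : ℝ) + 1))) atTop (𝓝 0) := by
      simpa using hδn.const_mul C
    obtain ⟨N, hN⟩ := eventually_atTop.1 (hlim.eventually (gt_mem_nhds (by positivity :
      0 < e ^ 2 / 2)))
    refine ⟨N, fun m hm n hn t ht => ?_⟩
    rw [dist_eq_norm]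
    have h1 := hcauchy m n t ht
    have h2 := hN m hm
    have h3 := hN n hn
    exact lt_of_pow_lt_pow_left₀ 2 he.le (by linarith)
  have hlim : ∀ t ∈ Icc 0 T, ∃ y, Tendsto (fun n => x n t) atTop (𝓝 y) := fun t ht =>
    cauchySeq_tendsto_of_complete (hunif.cauchySeq ht)
  classical
  set y : ℝ → ι → ℝ := fun t => if ht : t ∈ Icc 0 T then (hlim t ht).choose else 0
  have hy : ∀ t ∈ Icc 0 T, Tendsto (fun n => x n t) atTop (𝓝 (y t)) := by
    intro t ht
    simp only [y, dif_pos ht]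
    exact (hlim t ht).choose_spec
  have hyc : ContinuousOn y (Icc 0 T) :=
    (hunif.tendstoUniformlyOn_of_tendsto hy).continuousOn (Frequently.of_forall hcont)
  have hYy : ∀ t ∈ Icc 0 T, Tendsto (fun n => Y n (x n t)) atTop (𝓝 (X (y t))) := by
    intro t ht
    have h1 : Tendsto (fun n => Y n (x n t) - X (x n t)) atTop (𝓝 0) :=
      squeeze_zero_norm (fun n => (hY n _).le) hδn
    have h2 := h1.add ((hXc.tendsto _).comp (hy t ht))
    simpa using h2
  have hint : ∀ t ∈ Icc 0 T, y t = x₀ + ∫ s in (0 : ℝ)..t, X (y s) := by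
    intro t ht
    have hsub : uIoc 0 t ⊆ Icc 0 T := by
      rw [uIoc_of_le ht.1]
      exact Ioc_subset_Icc_self.trans (Icc_subset_Icc_right ht.2)
    have h1 : Tendsto (fun n => ∫ s in (0 : ℝ)..t, Y n (x n s)) atTop
        (𝓝 (∫ s in (0 : ℝ)..t, X (y s))) :=
      intervalIntegral.tendsto_integral_filter_of_dominated_convergence (fun _ => M + δ)
        (Eventually.of_forall fun n => (((hYc n).comp_continuousOn (hcont n)).mono
          hsub).aestronglyMeasurable measurableSet_uIoc)
        (Eventually.of_forall fun n => Eventually.of_forall fun s _ => hYM n _)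
        intervalIntegrable_const (Eventually.of_forall fun s hs => hYy s (hsub hs))
    refine tendsto_nhds_unique (hy t ht) ((h1.const_add x₀).congr fun n => ?_)
    exact ((hx n t ht).1).symm
  refine ⟨y, by simpa using hint 0 ⟨le_rfl, hT⟩, fun t ht => ⟨?_, ?_⟩⟩
  · intro i hi
    exact le_of_tendsto ((continuous_apply i).tendsto _ |>.comp (hy t ht))
      (Eventually.of_forall fun n => hmem n t ht i hi)
  · refine HasDerivWithinAt.congr ?_ hint (hint t ht)
    exact ODE.hasDerivWithinAt_picard_Icc (f := fun _ => X) (u := univ) ⟨le_rfl, hT⟩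
      (hXc.comp continuous_snd).continuousOn hyc
      (fun _ _ => mem_univ _) x₀ ht

theorem DissipativeOn.exists_solution {X : (ι → ℝ) → ι → ℝ} (hXc : Continuous X) {M : ℝ}
    (hM : ∀ u, ‖X u‖ ≤ M) {J : Set ι} {b : ι → ℝ} {δ : ℝ} (hδ : 0 < δ)
    (hb : ∀ i ∈ J, ∀ u, u i = b i → X u i ≤ -δ) (hX : DissipativeOn X {u | ∀ i ∈ J, u i ≤ b i})
    {x₀ : ι → ℝ} (hx₀ : ∀ i ∈ J, x₀ i ≤ b i) :
    ∃ x : ℝ → ι → ℝ, x 0 = x₀ ∧ ∀ t, 0 ≤ t → x t ∈ {u | ∀ i ∈ J, u i ≤ b i} ∧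
      HasDerivWithinAt x (X (x t)) (Ici 0) t := by
  choose x hx0 hx using fun n : ℕ =>
    DissipativeOn.exists_solution_Icc hXc hM hδ hb hX hx₀ (Nat.cast_nonneg (α := ℝ) n)
  have hagree : ∀ n m : ℕ, n ≤ m → EqOn (x n) (x m) (Icc 0 (n : ℝ)) := by
    intro n m hnm
    have hsub : Icc 0 (n : ℝ) ⊆ Icc 0 (m : ℝ) := Icc_subset_Icc_right (by exact_mod_cast hnm)
    exact hX.eqOn (convex_Icc _ _) ⟨le_rfl, Nat.cast_nonneg n⟩ (fun t ht => ht.1) (hx n)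
      (fun t ht => ⟨(hx m t (hsub ht)).1, (hx m t (hsub ht)).2.mono hsub⟩)
      ((hx0 n).trans (hx0 m).symm)
  set y : ℝ → ι → ℝ := fun t => x ⌈t⌉₊ t
  have hy : ∀ n : ℕ, EqOn y (x n) (Icc 0 (n : ℝ)) := fun n t ht =>
    hagree _ n (Nat.ceil_le.2 ht.2) ⟨ht.1, Nat.le_ceil t⟩
  refine ⟨y, by simp [y, hx0], fun t ht => ?_⟩
  -- The extra `1` makes the interval a neighbourhood of `t` within `[0, ∞)`, even when `t` is an
  -- integer.
  have htn : t < ((⌈t⌉₊ + 1 : ℕ) : ℝ) := by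
    push_cast
    linarith [Nat.le_ceil t]
  have htmem : t ∈ Icc 0 ((⌈t⌉₊ + 1 : ℕ) : ℝ) := ⟨ht, htn.le⟩
  rw [hy _ htmem]
  refine ⟨(hx _ t htmem).1, ?_⟩
  refine ((hx _ t htmem).2.congr (hy _) (hy _ htmem)).mono_of_mem_nhdsWithin ?_
  rw [← Ici_inter_Iic]
  exact inter_mem_nhdsWithin _ (Iic_mem_nhds htn)

end

/-! ### Exponential convergence to an equilibrium with definite linearization. -/

section

variable {ι : Type*} [Fintype ι]

theorem exists_forall_sum_mul_le_neg (L : (ι → ℝ) →L[ℝ] (ι → ℝ)) (W : Submodule ℝ (ι → ℝ))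
    (hL : ∀ d ∈ W, d ≠ 0 → ∑ i, d i * L d i < 0) :
    ∃ c, 0 < c ∧ ∀ d ∈ W, ∑ i, d i * L d i ≤ -c * ‖d‖ ^ 2 := by
  have hq : Continuous fun d : ι → ℝ => ∑ i, d i * L d i :=
    continuous_finsetSum _ fun i _ =>
      (continuous_apply i).mul ((continuous_apply i).comp L.continuous)
  have hK : IsCompact (Metric.sphere (0 : ι → ℝ) 1 ∩ W) :=
    (isCompact_sphere 0 1).inter_right W.closed_of_finiteDimensional
  have hscale : ∀ d ∈ W, d ≠ 0 → ‖d‖⁻¹ • d ∈ Metric.sphere (0 : ι → ℝ) 1 ∩ W := by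
    intro d hd h0
    refine ⟨?_, W.smul_mem _ hd⟩
    rw [mem_sphere_zero_iff_norm, norm_smul, norm_inv, norm_norm,
      inv_mul_cancel₀ (norm_ne_zero_iff.2 h0)]
  rcases (Metric.sphere (0 : ι → ℝ) 1 ∩ W).eq_empty_or_nonempty with he | hne
  · refine ⟨1, one_pos, fun d hd => ?_⟩
    by_cases h0 : d = 0
    · simp [h0]
    · exact absurd (hscale d hd h0) (by rw [he]; exact notMem_empty _)
  · obtain ⟨e, he, hmax⟩ := hK.exists_isMaxOn hne hq.continuousOn
    have he0 : e ≠ 0 := by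
      rintro rfl
      have := he.1
      simp at this
    refine ⟨-∑ i, e i * L e i, neg_pos.2 (hL e he.2 he0), fun d hd => ?_⟩
    by_cases h0 : d = 0
    · simp [h0]
    have h1 : ∑ i, (‖d‖⁻¹ • d) i * L (‖d‖⁻¹ • d) i ≤ ∑ i, e i * L e i := hmax (hscale d hd h0)
    have hd0 := norm_pos_iff.2 h0
    have h2 : ∑ i, (‖d‖⁻¹ • d) i * L (‖d‖⁻¹ • d) i = (‖d‖ ^ 2)⁻¹ * ∑ i, d i * L d i := by
      rw [Finset.mul_sum]
      refine Finset.sum_congr rfl fun i _ => ?_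
      simp only [map_smul, Pi.smul_apply, smul_eq_mul]
      ring
    rw [h2, inv_mul_le_iff₀ (by positivity)] at h1
    linarith

/-- Near `p` the linearization gives coercivity. A distant `u = p + d` is compared with `p + s • d`
near `p`: dissipativity between these two points shows that `∑ d * X` is no larger at `u`. -/
theorem DissipativeOn.exists_forall_sum_mul_le {X : (ι → ℝ) → ι → ℝ} {S : Set (ι → ℝ)}
    (hX : DissipativeOn X S) (hS : Convex ℝ S) {p : ι → ℝ} (hp : p ∈ S) (hXp : X p = 0)
    {L : (ι → ℝ) →L[ℝ] (ι → ℝ)} (hL : HasFDerivAt X L p) {W : Submodule ℝ (ι → ℝ)}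
    (hLW : ∀ d ∈ W, d ≠ 0 → ∑ i, d i * L d i < 0) {R : ℝ} (hR : 0 < R) :
    ∃ κ, 0 < κ ∧ ∀ u ∈ S, u - p ∈ W → ‖u - p‖ ≤ R →
      ∑ i, (u i - p i) * X u i ≤ -κ * ∑ i, (u i - p i) ^ 2 := by
  obtain ⟨c, hc, hcL⟩ := exists_forall_sum_mul_le_neg L W hLW
  set n : ℝ := (Fintype.card ι : ℝ)
  have hn0 : 0 ≤ n := Nat.cast_nonneg _
  have hlittle := hL.isLittleO.def (c := c / (2 * (n + 1))) (by positivity)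
  obtain ⟨ρ, hρ, hball⟩ := Metric.eventually_nhds_iff.1 hlittle
  have hnear : ∀ d ∈ W, ‖d‖ < ρ → ∑ i, d i * X (p + d) i ≤ -(c / 2) * ‖d‖ ^ 2 := by
    intro d hd hdρ
    have h1 := hball (y := p + d) (by simpa [dist_eq_norm] using hdρ)
    rw [hXp, sub_zero, add_sub_cancel_left] at h1
    have h2 := sum_mul_le_card_mul_norm d (X (p + d) - L d)
    have h3 : ∑ i, d i * X (p + d) i =
        ∑ i, d i * L d i + ∑ i, d i * (X (p + d) - L d) i := by
      rw [← Finset.sum_add_distrib]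
      refine Finset.sum_congr rfl fun i _ => ?_
      simp only [Pi.sub_apply]
      ring
    have h4 : n * (‖d‖ * ‖X (p + d) - L d‖) ≤ (n + 1) * (‖d‖ * (c / (2 * (n + 1)) * ‖d‖)) := by
      gcongr
      linarith
    have h5 : (n + 1) * (‖d‖ * (c / (2 * (n + 1)) * ‖d‖)) = c / 2 * ‖d‖ ^ 2 := by
      field_simp
    rw [h3]
    linarith [hcL d hd]
  -- The first bound keeps `1 - s` positive, the second brings `p + s • d` into the ball of radius
  -- `ρ`.
  set s : ℝ := min (1 / 2) (ρ / (2 * R))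
  have hs0 : 0 < s := lt_min (by norm_num) (by positivity)
  have hs1 : s ≤ 1 / 2 := min_le_left _ _
  have hsR : s * R < ρ := by
    have h1 : s * R ≤ ρ / (2 * R) * R := by gcongr; exact min_le_right _ _
    have h2 : ρ / (2 * R) * R = ρ / 2 := by field_simp
    linarith
  refine ⟨c / 2 * s / (n + 1), by positivity, fun u hu hW huR => ?_⟩
  set d := u - p with hd
  have hpu : p + s • d ∈ S := hS.add_smul_sub_mem hp hu ⟨hs0.le, by linarith⟩
  have h1 := hX (p + s • d) hpu u hu
  have h2 := hnear (s • d) (W.smul_mem s hW) (by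
    rw [norm_smul, norm_of_nonneg hs0.le]
    exact lt_of_le_of_lt (by gcongr) hsR)
  have h3 : ∑ i, (u i - (p + s • d) i) * (X u i - X (p + s • d) i) =
      (1 - s) * (∑ i, d i * X u i - ∑ i, d i * X (p + s • d) i) := by
    rw [← Finset.sum_sub_distrib, Finset.mul_sum]
    refine Finset.sum_congr rfl fun i _ => ?_
    simp only [hd, Pi.add_apply, Pi.smul_apply, Pi.sub_apply, smul_eq_mul]
    ring
  have h4 : ∑ i, (s • d) i * X (p + s • d) i = s * ∑ i, d i * X (p + s • d) i := by
    rw [Finset.mul_sum]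
    refine Finset.sum_congr rfl fun i _ => ?_
    simp only [Pi.smul_apply, smul_eq_mul]
    ring
  rw [h3] at h1
  have h5 : ∑ i, d i * X u i ≤ ∑ i, d i * X (p + s • d) i := by nlinarith
  rw [h4, norm_smul, norm_of_nonneg hs0.le] at h2
  have h6 : ∑ i, d i * X (p + s • d) i ≤ -(c / 2 * s) * ‖d‖ ^ 2 := by
    refine le_of_mul_le_mul_left (h2.trans (le_of_eq ?_)) hs0
    ring
  have h7 : ∑ i, d i ^ 2 ≤ (n + 1) * ‖d‖ ^ 2 :=
    (sum_sq_le_card_mul_norm_sq d).trans (by gcongr; linarith)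
  have h8 : c / 2 * s / (n + 1) * ∑ i, d i ^ 2 ≤ c / 2 * s * ‖d‖ ^ 2 := by
    refine (mul_le_mul_of_nonneg_left h7 (by positivity)).trans (le_of_eq ?_)
    field_simp
  change ∑ i, d i * X u i ≤ -_ * ∑ i, d i ^ 2
  linarith

/-- The distance to `p` does not increase, so the solution stays in one ball, where a single `κ`
serves; then `exp (2 * κ * t)` times the squared distance is nonincreasing. -/
theorem DissipativeOn.convergesExp {X : (ι → ℝ) → ι → ℝ} {S : Set (ι → ℝ)}
    (hX : DissipativeOn X S) (hS : Convex ℝ S) {p : ι → ℝ} (hp : p ∈ S) (hXp : X p = 0)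
    {L : (ι → ℝ) →L[ℝ] (ι → ℝ)} (hL : HasFDerivAt X L p) {W : Submodule ℝ (ι → ℝ)}
    (hLW : ∀ d ∈ W, d ≠ 0 → ∑ i, d i * L d i < 0) {x : ℝ → ι → ℝ}
    (hx : ∀ t ∈ Ici (0 : ℝ), x t ∈ S ∧ HasDerivWithinAt x (X (x t)) (Ici 0) t)
    (hxW : ∀ t, 0 ≤ t → x t - p ∈ W) : ConvergesExp x p := by
  set φ : ℝ → ℝ := fun t => ∑ i, (x t i - p i) ^ 2
  have hφ0 : ∀ t, 0 ≤ φ t := fun t => Finset.sum_nonneg fun i _ => sq_nonneg _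
  have hp' : ∀ t ∈ Ici (0 : ℝ), p ∈ S ∧ HasDerivWithinAt (fun _ => p) (X p) (Ici 0) t :=
    fun t _ => ⟨hp, hXp ▸ hasDerivWithinAt_const _ _ _⟩
  have hanti := hX.antitoneOn_sum_sq_sub (convex_Ici 0) hx hp'
  obtain ⟨κ, hκ, hdec⟩ := hX.exists_forall_sum_mul_le hS hp hXp hL hLW
    (R := √(φ 0) + 1) (by positivity)
  have hnorm : ∀ t, ‖x t - p‖ ≤ √(φ t) := fun t =>
    le_sqrt_of_sq_le (norm_sq_le_sum_sq (x t - p))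
  have hbound : ∀ t, 0 ≤ t → ‖x t - p‖ ≤ √(φ 0) + 1 := by
    intro t ht
    have : √(φ t) ≤ √(φ 0) := sqrt_le_sqrt (hanti self_mem_Ici ht ht)
    linarith [hnorm t]
  have hder : ∀ t ∈ Ici (0 : ℝ), HasDerivWithinAt (fun t => exp (2 * κ * t) * φ t)
      (exp (2 * κ * t) * (2 * κ) * φ t +
        exp (2 * κ * t) * (2 * ∑ i, (x t i - p i) * (X (x t) i - X p i))) (Ici 0) t := by
    intro t ht
    have h1 : HasDerivAt (fun t => exp (2 * κ * t)) (exp (2 * κ * t) * (2 * κ)) t := by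
      simpa using ((hasDerivAt_id t).const_mul (2 * κ)).exp
    exact h1.hasDerivWithinAt.mul (hasDerivWithinAt_sum_sq_sub (hx t ht).2 (hp' t ht).2)
  have hanti' : AntitoneOn (fun t => exp (2 * κ * t) * φ t) (Ici 0) := by
    refine antitoneOn_of_hasDerivWithinAt_nonpos (convex_Ici 0)
      (fun t ht => (hder t ht).continuousWithinAt)
      (fun t ht => (hder t (interior_subset ht)).mono interior_subset) fun t ht => ?_
    have ht := interior_subset ht
    have h1 := hdec (x t) (hx t ht).1 (hxW t ht) (hbound t ht)
    simp only [hXp, Pi.zero_apply, sub_zero]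
    have h2 := mul_le_mul_of_nonneg_left h1 (exp_pos (2 * κ * t)).le
    change _ ≤ exp (2 * κ * t) * (-κ * φ t) at h2
    linarith
  refine ⟨√(φ 0), κ, hκ, fun t ht i => ?_⟩
  have h1 := hanti' self_mem_Ici ht ht
  simp only [mul_zero, exp_zero, one_mul] at h1
  have h2 : (exp (κ * t) * ‖x t - p‖) ^ 2 ≤ φ 0 := by
    rw [mul_pow, ← exp_two_mul_eq_sq, ← mul_assoc]
    refine le_trans ?_ h1
    gcongr
    exact norm_sq_le_sum_sq (x t - p)
  have h3 := le_sqrt_of_sq_le h2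
  have h4 := norm_le_pi_norm (x t - p) i
  rw [norm_eq_abs, Pi.sub_apply] at h4
  refine h4.trans ?_
  rw [neg_mul, exp_neg, ← div_eq_mul_inv, le_div_iff₀ (exp_pos _)]
  linarith

end

/-! ### The extended flow on a surface -/

theorem timeInterval_convex (τ : EReal) : Convex ℝ (timeInterval τ) :=
  OrdConnected.convex ⟨fun _ hx _ hy _ hz => ⟨hx.1.trans hz.1,
    lt_of_le_of_lt (EReal.coe_le_coe_iff.2 hz.2) hy.2⟩⟩

theorem timeInterval_top : timeInterval ⊤ = Ici 0 := by
  ext t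
  simp [timeInterval]

theorem timeInterval_subset (τ : EReal) : timeInterval τ ⊆ Ici 0 := fun _ ht => ht.1

theorem zero_mem_timeInterval {τ : EReal} {t : ℝ} (ht : t ∈ timeInterval τ) :
    0 ∈ timeInterval τ :=
  ⟨le_rfl, lt_of_le_of_lt (EReal.coe_le_coe_iff.2 ht.1) ht.2⟩

theorem le_uInv_of_uCoord_le {R u : ℝ} (hu : u < 0) (h : uCoord .hyperbolic 1 R ≤ u) :
    R ≤ uInv .hyperbolic 1 u := by
  have hs : 0 < sinh (-u) := sinh_pos_iff.2 (neg_pos.2 hu)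
  rw [uCoord_hyperbolic_one, neg_le] at h
  have h1 : sinh (-u) ≤ exp (-R) := by
    rw [← sinh_arsinh (exp (-R))]
    exact sinh_le_sinh.2 h
  rw [uInv, if_neg one_ne_zero, le_neg, ← log_exp (-R)]
  exact log_le_log hs h1

namespace TriangleGluing

variable {F : Type*} {T : TriangleGluing F} {ε : T.Vertex → ℝ} {η : T.Edge → ℝ}

theorem exists_forall_extAngle_le (hε : ∀ v, ε v = 0 ∨ ε v = 1)
    (h1 : T.StructureCondition1 ε η) {β : ℝ} (hβ : 0 < β) (c : F × Fin 3)
    (hc : ε (T.vertex c) = 1) :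
    ∃ R, ∀ f : T.Vertex → ℝ, R ≤ f (T.vertex c) → T.extAngle .hyperbolic ε η f c ≤ β := by
  have key : ∀ {ε₁ ε₂ ε₃ η₁ η₂ η₃ : ℝ}, ε₁ = 1 → (ε₂ = 0 ∨ ε₂ = 1) → (ε₃ = 0 ∨ ε₃ = 1) →
      0 < ε₂ * ε₃ + η₁ → 0 < ε₃ * ε₁ + η₂ → 0 < ε₁ * ε₂ + η₃ →
      ∃ R, ∀ f₁ f₂ f₃ : ℝ, R ≤ f₁ →
        extTriangleAngle .hyperbolic (edgeLength .hyperbolic ε₂ ε₃ η₁ f₂ f₃)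
          (edgeLength .hyperbolic ε₃ ε₁ η₂ f₃ f₁) (edgeLength .hyperbolic ε₁ ε₂ η₃ f₁ f₂) ≤ β := by
    rintro _ ε₂ ε₃ η₁ η₂ η₃ rfl hε₂ hε₃ h₁ h₂ h₃
    exact exists_forall_extTriangleAngle_le hε₂ hε₃ h₁ h₂ h₃ hβ
  obtain ⟨t, a⟩ := c
  fin_cases a
  · obtain ⟨R, hR⟩ := key hc (hε (T.vertex (t, 1))) (hε (T.vertex (t, 2))) (h1 (t, 0)) (h1 (t, 1))
      (h1 (t, 2))
    exact ⟨R, fun f => hR _ _ _⟩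
  · obtain ⟨R, hR⟩ := key hc (hε (T.vertex (t, 2))) (hε (T.vertex (t, 0))) (h1 (t, 1)) (h1 (t, 2))
      (h1 (t, 0))
    exact ⟨R, fun f => hR _ _ _⟩
  · obtain ⟨R, hR⟩ := key hc (hε (T.vertex (t, 0))) (hε (T.vertex (t, 1))) (h1 (t, 2)) (h1 (t, 0))
      (h1 (t, 1))
    exact ⟨R, fun f => hR _ _ _⟩

theorem IsConnected.nonempty_vertex (hT : T.IsConnected) : Nonempty T.Vertex :=
  let ⟨t⟩ := hT.nonempty
  ⟨T.vertex (t, 0)⟩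

variable [Fintype F]

/-- Once the conformal factor at `v` is large, the angles at `v` add up to at most `δ`, so the
extended curvature there is at least `2π - δ`. -/
theorem exists_barrier (hε : ∀ v, ε v = 0 ∨ ε v = 1) (h1 : T.StructureCondition1 ε η)
    {Kbar : T.Vertex → ℝ} {v : T.Vertex} (hv : ε v = 1) {δ : ℝ} (hδ : 0 < δ)
    (hK : Kbar v + 2 * δ ≤ 2 * π) :
    ∃ b < 0, ∀ u ∈ uBox T ε .hyperbolic, b ≤ u v →
      flowField T ε η .hyperbolic Kbar u v ≤ -δ := by
  classical
  have hβ : 0 < δ / (Fintype.card (F × Fin 3) + 1) := by positivity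
  have hR : ∀ c : F × Fin 3, ∃ R, ∀ f : T.Vertex → ℝ, R ≤ f v →
      (if T.vertex c = v then T.extAngle .hyperbolic ε η f c else 0) ≤
        δ / (Fintype.card (F × Fin 3) + 1) := by
    intro c
    by_cases h : T.vertex c = v
    · subst h
      simpa using exists_forall_extAngle_le hε h1 hβ c hv
    · exact ⟨0, fun f _ => by simpa [h] using hβ.le⟩
  choose R hR using hR
  -- `∑ c, |R c|` exceeds or equals each of the thresholds `R c`.
  have hmem := uCoord_mem_uRange .hyperbolic (.inr rfl) (∑ c, |R c|) one_ne_zero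
  refine ⟨uCoord .hyperbolic 1 (∑ c, |R c|), hmem, fun u hu hb => ?_⟩
  have hle : ∑ c, |R c| ≤ confVec T ε .hyperbolic u v := by
    rw [confVec, hv]
    exact le_uInv_of_uCoord_le (hu v (by rw [hv]; exact one_ne_zero)) hb
  have hsum := Finset.sum_le_card_nsmul Finset.univ
    (fun c => if T.vertex c = v then T.extAngle .hyperbolic ε η (confVec T ε .hyperbolic u) c
      else 0) _ fun c _ => hR c _ (((le_abs_self _).trans (Finset.single_le_sum
        (f := fun c => |R c|) (fun c _ => abs_nonneg _) (Finset.mem_univ c))).trans hle)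
  rw [Finset.card_univ, nsmul_eq_mul, mul_div_assoc', mul_div_right_comm] at hsum
  have hfrac : (Fintype.card (F × Fin 3) : ℝ) / (Fintype.card (F × Fin 3) + 1) * δ ≤ 1 * δ := by
    gcongr
    rw [div_le_one (by positivity)]
    linarith
  rw [flowField, extCurvature]
  linarith

theorem dissipativeOn_flowField (hε : ∀ v, ε v = 0 ∨ ε v = 1) (h1 : T.StructureCondition1 ε η)
    (h2 : T.StructureCondition2 ε η) (g : Geometry) (Kbar : T.Vertex → ℝ) :
    DissipativeOn (flowField T ε η g Kbar) (uBox T ε g) :=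
  fun _ hu _ hv => flowField_dissipative hε h1 h2 g Kbar hu hv

theorem norm_flowField_le (g : Geometry) (Kbar u : T.Vertex → ℝ) :
    ‖flowField T ε η g Kbar u‖ ≤ ∑ w, |Kbar w| + 2 * π + Fintype.card (F × Fin 3) * π :=
  (pi_norm_le_iff_of_nonneg (by positivity)).2 fun v => abs_flowField_le g Kbar u v

theorem isExtRicciFlow_iff (hε : ∀ v, ε v = 0 ∨ ε v = 1) {g : Geometry} {Kbar : T.Vertex → ℝ}
    {τ : EReal} {f : ℝ → T.Vertex → ℝ} :
    T.IsExtRicciFlow g ε η Kbar τ f ↔ ∀ t ∈ timeInterval τ, T.uVec g ε (f t) ∈ uBox T ε g ∧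
      HasDerivWithinAt (fun s => T.uVec g ε (f s))
        (flowField T ε η g Kbar (T.uVec g ε (f t))) (timeInterval τ) t := by
  refine forall₂_congr fun t _ => ?_
  rw [and_iff_right (uVec_mem_uBox hε g _), hasDerivWithinAt_pi]
  simp only [flowField, confVec_uVec hε]

theorem IsExtRicciFlow.eqOn (hε : ∀ v, ε v = 0 ∨ ε v = 1) (h1 : T.StructureCondition1 ε η)
    (h2 : T.StructureCondition2 ε η) {g : Geometry} {Kbar : T.Vertex → ℝ}
    {τ : EReal} {f φ : ℝ → T.Vertex → ℝ} (hf : T.IsExtRicciFlow g ε η Kbar τ f)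
    (hφ : T.IsExtRicciFlow g ε η Kbar τ φ) (h0 : f 0 = φ 0) : EqOn f φ (timeInterval τ) := by
  intro t ht
  have h := (dissipativeOn_flowField hε h1 h2 g Kbar).eqOn (timeInterval_convex τ)
    (zero_mem_timeInterval ht) (fun s hs => hs.1) ((isExtRicciFlow_iff hε).1 hf)
    ((isExtRicciFlow_iff hε).1 hφ) (by simp only [h0]) ht
  rw [← confVec_uVec hε g (f t), ← confVec_uVec hε g (φ t)]
  exact congrArg _ h

theorem IsExtRicciFlow.mono {g : Geometry} {Kbar : T.Vertex → ℝ} {f : ℝ → T.Vertex → ℝ}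
    (hf : T.IsExtRicciFlow g ε η Kbar ⊤ f) (τ : EReal) : T.IsExtRicciFlow g ε η Kbar τ f := by
  intro t ht v
  have hsub : timeInterval τ ⊆ timeInterval ⊤ := by
    rw [timeInterval_top]
    exact timeInterval_subset τ
  exact (hf t (hsub ht) v).mono hsub

theorem IsRicciFlow.isExtRicciFlow (hε : ∀ v, ε v = 0 ∨ ε v = 1)
    (h1 : T.StructureCondition1 ε η) {g : Geometry} {Kbar : T.Vertex → ℝ} {τ : EReal}
    {f : ℝ → T.Vertex → ℝ} (hf : T.IsRicciFlow g ε η Kbar τ f) :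
    T.IsExtRicciFlow g ε η Kbar τ f := by
  intro t ht
  rw [extCurvature_eq_curvature hε h1]
  exact (hf t ht).2

theorem exists_flowField_solution_hyperbolic [Nonempty T.Vertex] (hε : ∀ v, ε v = 0 ∨ ε v = 1)
    (h1 : T.StructureCondition1 ε η) (h2 : T.StructureCondition2 ε η) {Kbar : T.Vertex → ℝ}
    (hK : ∀ v, Kbar v < 2 * π) {u₀ : T.Vertex → ℝ} (hu₀ : u₀ ∈ uBox T ε .hyperbolic) :
    ∃ u : ℝ → T.Vertex → ℝ, u 0 = u₀ ∧ ∀ t, 0 ≤ t → u t ∈ uBox T ε .hyperbolic ∧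
      HasDerivWithinAt u (flowField T ε η .hyperbolic Kbar (u t)) (Ici 0) t := by
  classical
  obtain ⟨w, hw⟩ := Finite.exists_min fun v => 2 * π - Kbar v
  set δ : ℝ := (2 * π - Kbar w) / 2 with hδ_def
  have hδ : 0 < δ := half_pos (sub_pos.2 (hK w))
  have hbar : ∀ v, ∃ b, (ε v = 1 → b < 0 ∧ u₀ v ≤ b) ∧ (ε v = 1 →
      ∀ u ∈ uBox T ε .hyperbolic, b ≤ u v → flowField T ε η .hyperbolic Kbar u v ≤ -δ) := by
    intro v
    by_cases hv : ε v = 1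
    · obtain ⟨b, hb, h⟩ := exists_barrier hε h1 (Kbar := Kbar) hv hδ (by linarith [hw v])
      have hu : u₀ v < 0 := hu₀ v (by rw [hv]; exact one_ne_zero)
      exact ⟨max b (u₀ v), fun _ => ⟨max_lt hb hu, le_max_right _ _⟩,
        fun _ u hu' hle => h u hu' ((le_max_left _ _).trans hle)⟩
    · exact ⟨0, fun h => absurd h hv, fun h => absurd h hv⟩
  choose b hb hbX using hbar
  -- Truncation at the barrier makes the field continuous on the whole space; solutions never cross
  -- the barrier, so they solve the original equation.
  set clip : (T.Vertex → ℝ) → T.Vertex → ℝ := fun u v => if ε v = 1 then min (u v) (b v) else u v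
  have hclip_cont : Continuous clip := continuous_pi fun v => by
    by_cases hv : ε v = 1 <;> simp only [clip, hv, if_true, if_false] <;> fun_prop
  have hclip_mem : ∀ u, clip u ∈ uBox T ε .hyperbolic := by
    intro u v hv
    have hv1 := (hε v).resolve_left hv
    simp only [clip, hv1, if_true]
    exact (min_le_right _ _).trans_lt (hb v hv1).1
  have hclip_eq : ∀ u ∈ {u : T.Vertex → ℝ | ∀ v ∈ {v | ε v = 1}, u v ≤ b v}, clip u = u := by
    intro u hu
    funext v
    by_cases hv : ε v = 1
    · simpa only [clip, hv, if_true, min_eq_left_iff] using hu v hv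
    · simp only [clip, hv, if_false]
  have hsub : {u : T.Vertex → ℝ | ∀ v ∈ {v | ε v = 1}, u v ≤ b v} ⊆ uBox T ε .hyperbolic :=
    fun u hu => hclip_eq u hu ▸ hclip_mem u
  obtain ⟨u, hu0, hu⟩ := DissipativeOn.exists_solution
    (X := fun u => flowField T ε η .hyperbolic Kbar (clip u)) (J := {v | ε v = 1}) (b := b)
    ((continuousOn_flowField hε h1 .hyperbolic Kbar).comp_continuous hclip_cont hclip_mem)
    (fun u => norm_flowField_le _ _ _) hδ
    (fun v hv u huv => hbX v hv _ (hclip_mem u) (by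
      have hv : ε v = 1 := hv
      simp only [clip, hv, if_true, huv, min_self, le_refl]))
    (fun u hu v hv => by
      simp only [hclip_eq u hu, hclip_eq v hv]
      exact dissipativeOn_flowField hε h1 h2 _ Kbar u (hsub hu) v (hsub hv))
    (x₀ := u₀) (fun v hv => (hb v hv).2)
  refine ⟨u, hu0, fun t ht => ⟨hsub (hu t ht).1, ?_⟩⟩
  have := (hu t ht).2
  rwa [hclip_eq _ (hu t ht).1] at this

theorem exists_flowField_solution_euclidean (hε : ∀ v, ε v = 0 ∨ ε v = 1)
    (h1 : T.StructureCondition1 ε η) (h2 : T.StructureCondition2 ε η) (Kbar u₀ : T.Vertex → ℝ) :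
    ∃ u : ℝ → T.Vertex → ℝ, u 0 = u₀ ∧ ∀ t, 0 ≤ t → u t ∈ uBox T ε .euclidean ∧
      HasDerivWithinAt u (flowField T ε η .euclidean Kbar (u t)) (Ici 0) t := by
  have hbox : ∀ u, u ∈ uBox T ε .euclidean := fun u v => mem_univ _
  obtain ⟨u, hu0, hu⟩ := DissipativeOn.exists_solution
    (X := flowField T ε η .euclidean Kbar) (J := ∅) (b := 0) (δ := 1)
    ((continuousOn_flowField hε h1 .euclidean Kbar).comp_continuous continuous_id hbox)
    (norm_flowField_le _ _) one_pos (by simp)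
    (fun u _ v _ => dissipativeOn_flowField hε h1 h2 _ Kbar u (hbox u) v (hbox v))
    (x₀ := u₀) (by simp)
  exact ⟨u, hu0, fun t ht => ⟨hbox _, (hu t ht).2⟩⟩

theorem exists_isExtRicciFlow (hT : T.IsConnected) (hε : ∀ v, ε v = 0 ∨ ε v = 1)
    (h1 : T.StructureCondition1 ε η) (h2 : T.StructureCondition2 ε η) (g : Geometry)
    {Kbar : T.Vertex → ℝ} (hK : g = .hyperbolic → ∀ v, Kbar v < 2 * π) (f₀ : T.Vertex → ℝ) :
    ∃ f : ℝ → T.Vertex → ℝ, f 0 = f₀ ∧ T.IsExtRicciFlow g ε η Kbar ⊤ f := by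
  have := hT.nonempty_vertex
  obtain ⟨u, hu0, hu⟩ : ∃ u : ℝ → T.Vertex → ℝ, u 0 = T.uVec g ε f₀ ∧ ∀ t, 0 ≤ t →
      u t ∈ uBox T ε g ∧ HasDerivWithinAt u (flowField T ε η g Kbar (u t)) (Ici 0) t := by
    cases g
    · exact exists_flowField_solution_euclidean hε h1 h2 Kbar _
    · exact exists_flowField_solution_hyperbolic hε h1 h2 (hK rfl) (uVec_mem_uBox hε _ f₀)
  refine ⟨fun t => confVec T ε g (u t), by simp only [hu0, confVec_uVec hε], ?_⟩
  rw [isExtRicciFlow_iff hε, timeInterval_top]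
  intro t ht
  rw [uVec_confVec hε g (hu t ht).1]
  exact ⟨(hu t ht).1, (hu t ht).2.congr (fun s hs => uVec_confVec hε g (hu s hs).1)
    (uVec_confVec hε g (hu t ht).1)⟩

theorem isOpen_isConformalStructure (hε : ∀ v, ε v = 0 ∨ ε v = 1)
    (h1 : T.StructureCondition1 ε η) (g : Geometry) :
    IsOpen {f | T.IsConformalStructure g ε η f} := by
  simp only [IsConformalStructure, ofPred_forall]
  refine isOpen_iInter_of_finite fun t => ?_
  have h := fun a => continuous_sideLength hε h1 g (t, a)
  exact ((isOpen_lt continuous_const (h 0)).inter ((isOpen_lt continuous_const (h 1)).inter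
    (isOpen_lt continuous_const (h 2)))).inter ((isOpen_lt (h 0) ((h 1).add (h 2))).inter
    ((isOpen_lt (h 1) ((h 0).add (h 2))).inter (isOpen_lt (h 2) ((h 0).add (h 1)))))

/-- Nondegeneracy is an open condition and the solution is continuous at time `0`. -/
theorem IsExtRicciFlow.exists_isRicciFlow (hε : ∀ v, ε v = 0 ∨ ε v = 1)
    (h1 : T.StructureCondition1 ε η) {g : Geometry} {Kbar : T.Vertex → ℝ}
    {f : ℝ → T.Vertex → ℝ} (hf : T.IsExtRicciFlow g ε η Kbar ⊤ f)
    (h0 : T.IsConformalStructure g ε η (f 0)) :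
    ∃ τ > 0, T.IsRicciFlow g ε η Kbar τ f := by
  have hcont : ContinuousWithinAt f (Ici 0) 0 := by
    refine continuousWithinAt_pi.2 fun v => ?_
    have h := (hf 0 ⟨le_rfl, EReal.coe_lt_top 0⟩ v).continuousWithinAt
    rw [timeInterval_top] at h
    refine (ContinuousAt.comp_continuousWithinAt (g := uInv g (ε v))
      (f := fun s => T.uVec g ε (f s) v) (hasDerivAt_uInv g (hε v) (uVec_mem_uBox hε g (f 0) v)).continuousAt h).congr
      (fun t _ => ?_) ?_ <;> exact (congrFun (confVec_uVec hε g _) v).symm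
  have hev := hcont.eventually ((isOpen_isConformalStructure hε h1 g).mem_nhds h0)
  obtain ⟨τ, hτ, h⟩ := mem_nhdsGE_iff_exists_Ico_subset.1 hev
  refine ⟨(τ : EReal), EReal.coe_pos.2 hτ, fun t ht => ⟨h ⟨ht.1, EReal.coe_lt_coe_iff.1 ht.2⟩, ?_⟩⟩
  rw [← extCurvature_eq_curvature hε h1]
  exact hf.mono τ t ht

/-! ### Convergence -/

theorem flowField_curvature_eq_zero (hε : ∀ v, ε v = 0 ∨ ε v = 1)
    (h1 : T.StructureCondition1 ε η) (g : Geometry) (f : T.Vertex → ℝ) :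
    flowField T ε η g (T.curvature g ε η f) (T.uVec g ε f) = 0 := by
  funext v
  rw [flowField, confVec_uVec hε, extCurvature_eq_curvature hε h1, sub_self, Pi.zero_apply]

theorem IsExtRicciFlow.convergesExp_hyperbolic (hT : T.IsConnected)
    (hε : ∀ v, ε v = 0 ∨ ε v = 1) (h1 : T.StructureCondition1 ε η)
    (h2 : T.StructureCondition2 ε η) {fbar : T.Vertex → ℝ}
    (hfbar : T.IsConformalStructure .hyperbolic ε η fbar) {f : ℝ → T.Vertex → ℝ}
    (hf : T.IsExtRicciFlow .hyperbolic ε η (T.curvature .hyperbolic ε η fbar) ⊤ f) :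
    ConvergesExp (fun t => T.uVec .hyperbolic ε (f t)) (T.uVec .hyperbolic ε fbar) := by
  obtain ⟨L, hL, hneg⟩ := exists_hasFDerivAt_flowField hT hε h1 h2 .hyperbolic
    (T.curvature .hyperbolic ε η fbar) hfbar
  rw [isExtRicciFlow_iff hε, timeInterval_top] at hf
  exact (dissipativeOn_flowField hε h1 h2 .hyperbolic _).convergesExp (uBox_convex _)
    (uVec_mem_uBox hε _ fbar) (flowField_curvature_eq_zero hε h1 _ fbar) hL (W := ⊤)
    (fun d _ hd => hneg d hd) hf fun _ _ => Submodule.mem_top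

/-- The total extended curvature is the same for all `f`, so the components of the field add up to
zero. -/
theorem IsExtRicciFlow.sum_eq_euclidean (hε : ∀ v, ε v = 0 ∨ ε v = 1)
    (h1 : T.StructureCondition1 ε η) {fbar : T.Vertex → ℝ} {f : ℝ → T.Vertex → ℝ}
    (hf : T.IsExtRicciFlow .euclidean ε η (T.curvature .euclidean ε η fbar) ⊤ f) {t : ℝ}
    (ht : 0 ≤ t) : ∑ v, f t v = ∑ v, f 0 v := by
  rw [IsExtRicciFlow, timeInterval_top] at hf
  have hd : ∀ s ∈ Ici (0 : ℝ), HasDerivWithinAt (fun s => ∑ v, f s v) 0 (Ici 0) s := by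
    intro s hs
    refine (HasDerivWithinAt.fun_sum fun v _ => hf s hs v).congr_deriv ?_
    rw [Finset.sum_sub_distrib, ← extCurvature_eq_curvature hε h1,
      sum_extCurvature_euclidean hε h1, sum_extCurvature_euclidean hε h1, sub_self]
  have := (convex_Ici (0 : ℝ)).norm_image_sub_le_of_norm_hasDerivWithin_le hd (C := 0)
    (fun _ _ => by simp) self_mem_Ici ht
  rw [zero_mul] at this
  exact sub_eq_zero.1 (norm_le_zero_iff.1 this)

/-- Adding a constant to `fbar` rescales all lengths and keeps the curvature; the constant is chosen
to match the conserved sum. Then `f t - p` stays in the hyperplane of sum zero, which meets the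
neutral directions only in `0`. -/
theorem IsExtRicciFlow.convergesExp_euclidean (hT : T.IsConnected)
    (hε : ∀ v, ε v = 0 ∨ ε v = 1) (h1 : T.StructureCondition1 ε η)
    (h2 : T.StructureCondition2 ε η) {fbar : T.Vertex → ℝ}
    (hfbar : T.IsConformalStructure .euclidean ε η fbar) {f : ℝ → T.Vertex → ℝ}
    (hf : T.IsExtRicciFlow .euclidean ε η (T.curvature .euclidean ε η fbar) ⊤ f) :
    ConvergesExp f
      (fun v => fbar v + (∑ w, f 0 w - ∑ w, fbar w) / Fintype.card T.Vertex) := by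
  have := hT.nonempty_vertex
  have hN : (Fintype.card T.Vertex : ℝ) ≠ 0 := Nat.cast_ne_zero.2 Fintype.card_ne_zero
  set c := (∑ w, f 0 w - ∑ w, fbar w) / Fintype.card T.Vertex with hc
  set p : T.Vertex → ℝ := fun v => fbar v + c
  have hp : T.IsConformalStructure .euclidean ε η p := isConformalStructure_add_const c hfbar
  have hsum := fun t (ht : 0 ≤ t) => hf.sum_eq_euclidean hε h1 ht
  rw [← curvature_euclidean_add_const fbar c] at hf
  obtain ⟨L, hL, hneg⟩ := exists_hasFDerivAt_flowField hT hε h1 h2 .euclidean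
    (T.curvature .euclidean ε η p) hp
  rw [isExtRicciFlow_iff hε, timeInterval_top] at hf
  set W : Submodule ℝ (T.Vertex → ℝ) :=
    LinearMap.ker (∑ v, LinearMap.proj v : (T.Vertex → ℝ) →ₗ[ℝ] ℝ)
  have hW : ∀ d, d ∈ W ↔ ∑ v, d v = 0 := fun d => by simp [W, LinearMap.mem_ker]
  refine (dissipativeOn_flowField hε h1 h2 .euclidean _).convergesExp (uBox_convex _)
    (uVec_mem_uBox hε _ p) (flowField_curvature_eq_zero hε h1 _ p) hL (W := W)
    (fun d hd hd0 => hneg d ?_) hf fun t ht => ?_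
  · rintro ⟨k, hk⟩
    have h0 := (hW d).1 hd
    simp only [hk, Finset.sum_const, Finset.card_univ, nsmul_eq_mul] at h0
    exact hd0 (funext fun v => (hk v).trans ((mul_eq_zero.1 h0).resolve_left hN))
  · rw [hW]
    change ∑ v, (f t v - (fbar v + c)) = 0
    rw [Finset.sum_sub_distrib, hsum t ht, Finset.sum_add_distrib, Finset.sum_const,
      Finset.card_univ, nsmul_eq_mul, hc, mul_div_cancel₀ _ hN]
    ring

/-- By the Gauss–Bonnet formula the only possible constant is the average. -/
theorem curvature_euclidean_eq_averageCurvature (hT : T.IsConnected)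
    (hε : ∀ v, ε v = 0 ∨ ε v = 1) (h1 : T.StructureCondition1 ε η) {f : T.Vertex → ℝ} {k : ℝ}
    (hk : ∀ v, T.curvature .euclidean ε η f v = k) :
    T.curvature .euclidean ε η f = fun _ => T.averageCurvature := by
  have := hT.nonempty_vertex
  have hN : (Fintype.card T.Vertex : ℝ) ≠ 0 := Nat.cast_ne_zero.2 Fintype.card_ne_zero
  have h := sum_extCurvature_euclidean_eq_eulerChar hε h1 f
  rw [extCurvature_eq_curvature hε h1] at h
  simp only [hk, Finset.sum_const, Finset.card_univ, nsmul_eq_mul] at h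
  funext v
  rw [hk, averageCurvature, ← h, mul_div_cancel_left₀ _ hN]

end TriangleGluing

end DiscreteConformal

theorem theorem1p2 {F : Type*} [Fintype F] (T : TriangleGluing F) (hT : T.IsConnected)
    (ε : T.Vertex → ℝ) (η : T.Edge → ℝ) (hε : ∀ v, ε v = 0 ∨ ε v = 1)
    (h1 : T.StructureCondition1 ε η) (h2 : T.StructureCondition2 ε η) :
    -- the extended angles are continuous
    (∀ (g : Geometry) (c : F × Fin 3), Continuous fun f => T.extAngle g ε η f c) ∧
    -- (a) long time existence: the flow from any initial value extends to all times; it covers the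
    -- normalized Euclidean flow (`Kbar` the average curvature) and the hyperbolic flow (`Kbar = 0`)
    (∀ (g : Geometry) (Kbar : T.Vertex → ℝ), (g = .hyperbolic → ∀ v, Kbar v < 2 * π) →
      ∀ f₀ : T.Vertex → ℝ, ∃ f : ℝ → T.Vertex → ℝ, f 0 = f₀ ∧
        T.IsExtRicciFlow g ε η Kbar ⊤ f ∧
        (T.IsConformalStructure g ε η f₀ → ∃ τ > 0, T.IsRicciFlow g ε η Kbar τ f) ∧
        ∀ (τ : EReal) (φ : ℝ → T.Vertex → ℝ), φ 0 = f₀ → T.IsRicciFlow g ε η Kbar τ φ →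
          ∀ t ∈ timeInterval τ, φ t = f t) ∧
    -- (b) uniqueness of the solution of the extended flow
    (∀ (g : Geometry) (Kbar : T.Vertex → ℝ) (τ : EReal) (f φ : ℝ → T.Vertex → ℝ),
      T.IsExtRicciFlow g ε η Kbar τ f → T.IsExtRicciFlow g ε η Kbar τ φ → f 0 = φ 0 →
        ∀ t ∈ timeInterval τ, f t = φ t) ∧
    -- (c) exponential convergence to a discrete conformal structure with prescribed curvature
    (∀ fbar : T.Vertex → ℝ, T.IsConformalStructure .euclidean ε η fbar →
      ∀ f : ℝ → T.Vertex → ℝ,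
        T.IsExtRicciFlow .euclidean ε η (T.curvature .euclidean ε η fbar) ⊤ f →
          ConvergesExp f
            (fun v => fbar v + (∑ w, f 0 w - ∑ w, fbar w) / Fintype.card T.Vertex)) ∧
    (∀ fbar : T.Vertex → ℝ, T.IsConformalStructure .hyperbolic ε η fbar →
      ∀ f : ℝ → T.Vertex → ℝ,
        T.IsExtRicciFlow .hyperbolic ε η (T.curvature .hyperbolic ε η fbar) ⊤ f →
          ConvergesExp (fun t => T.uVec .hyperbolic ε (f t)) (T.uVec .hyperbolic ε fbar)) ∧
    -- (c) in particular, constant curvature (Euclidean) and zero curvature (hyperbolic)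
    ((∃ fbar : T.Vertex → ℝ, T.IsConformalStructure .euclidean ε η fbar ∧
        ∃ k : ℝ, ∀ v, T.curvature .euclidean ε η fbar v = k) →
      ∀ f : ℝ → T.Vertex → ℝ,
        T.IsExtRicciFlow .euclidean ε η (fun _ => T.averageCurvature) ⊤ f →
          ∃ flim : T.Vertex → ℝ, T.IsConformalStructure .euclidean ε η flim ∧
            (∀ v, T.curvature .euclidean ε η flim v = T.averageCurvature) ∧
            ConvergesExp f flim) ∧
    ((∃ fbar : T.Vertex → ℝ, T.IsConformalStructure .hyperbolic ε η fbar ∧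
        ∀ v, T.curvature .hyperbolic ε η fbar v = 0) →
      ∀ f : ℝ → T.Vertex → ℝ,
        T.IsExtRicciFlow .hyperbolic ε η (fun _ => 0) ⊤ f →
          ∃ flim : T.Vertex → ℝ, T.IsConformalStructure .hyperbolic ε η flim ∧
            (∀ v, T.curvature .hyperbolic ε η flim v = 0) ∧
            ConvergesExp (fun t => T.uVec .hyperbolic ε (f t)) (T.uVec .hyperbolic ε flim)) := by
  refine ⟨fun g c => TriangleGluing.continuous_extAngle hε h1 g c, ?_, ?_, ?_, ?_, ?_, ?_⟩
  · intro g Kbar hK f₀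
    obtain ⟨f, hf0, hf⟩ := TriangleGluing.exists_isExtRicciFlow hT hε h1 h2 g hK f₀
    refine ⟨f, hf0, hf, fun h0 => hf.exists_isRicciFlow hε h1 (by rwa [hf0]), ?_⟩
    intro τ φ hφ0 hφ
    exact (hφ.isExtRicciFlow hε h1).eqOn hε h1 h2 (hf.mono τ) (hφ0.trans hf0.symm)
  · intro g Kbar τ f φ hf hφ h0
    exact hf.eqOn hε h1 h2 hφ h0
  · intro fbar hfbar f hf
    exact hf.convergesExp_euclidean hT hε h1 h2 hfbar
  · intro fbar hfbar f hf
    exact hf.convergesExp_hyperbolic hT hε h1 h2 hfbar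
  · rintro ⟨fbar, hfbar, k, hk⟩ f hf
    have hcurv := TriangleGluing.curvature_euclidean_eq_averageCurvature hT hε h1 hk
    rw [← hcurv] at hf
    refine ⟨_, TriangleGluing.isConformalStructure_add_const _ hfbar, fun v => ?_,
      hf.convergesExp_euclidean hT hε h1 h2 hfbar⟩
    rw [TriangleGluing.curvature_euclidean_add_const, hcurv]
  · rintro ⟨fbar, hfbar, hk⟩ f hf
    have hcurv : T.curvature .hyperbolic ε η fbar = fun _ => 0 := funext hk
    rw [← hcurv] at hf
    exact ⟨fbar, hfbar, hk, hf.convergesExp_hyperbolic hT hε h1 h2 hfbar⟩
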